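/- Let $d,m\ge 1$ be integers. Let $Q=(q_{kl}):\mathbb R^d\to\mathbb R^{d\times d}$, $V=(v_{ij}):\mathbb R^d\to\mathbb R^{m\times m}$ and $F_{ij},C_{ij}:\mathbb R^d\to\mathbb R^d$ $(1\le i,j\le m)$ satisfy the following hypotheses, where $\langle\cdot,\cdot\rangle$ is linear in its first argument and $|\cdot|$ is the Euclidean norm. **(H1)** $Q$ is measurable, $Q(x)$ is symmetric for every $x$, and there are $\eta_1,\eta_2>0$ with $\eta_1|\xi|^2\le\langle Q(x)\xi,\xi\rangle\le\eta_2|\xi|^2$ for all $x,\xi\in\mathbb R^d$; $F_{ij},C_{ij}\in L^\infty(\mathbb R^d,\mathbb R^d)$ for all $i,j$; $v_{ij}\in L^1_{\rm loc}(\mathbb R^d)$ for all $i,j$, and there is $M>0$ with $|\operatorname{Im}\langle V(x)\xi,\xi\rangle|\le M\operatorname{Re}\langle V(x)\xi,\xi\rangle$ for all $x\in\mathbb R^d$, $\xi\in\mathbb C^m$. **(H2)** $F_{ij},C_{ij}\in W^{1,\infty}_{\rm loc}$ for all $i,j$, and there is $\gamma\in\mathbb R$ such that, for almost every $x\in\mathbb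 R^d$ and all $\xi\in\mathbb R^m$, $$\sum_{i,j=1}^m\operatorname{div}(F_{ij})(x)\,\xi_i\xi_j\le\gamma|\xi|^2\quad\text{and}\quad\sum_{i,j=1}^m\operatorname{div}(C_{ij})(x)\,\xi_i\xi_j\le\gamma|\xi|^2 .$$ Let $V_s=\frac12(V+V^*)$, let $D(\mathrm a)=\{f\in H^1(\mathbb R^d,\mathbb C^m):\int_{\mathbb R^d}\langle V_sf,f\rangle\,dx<\infty\}$, and for $f,g\in D(\mathrm a)$ let $$\mathrm a(f,g)=\sum_{i=1}^m\int\langle Q\nabla f_i,\nabla g_i\rangle\,dx+\sum_{i,j=1}^m\int(F_{ij}\cdot\nabla f_j)\,\bar g_i\,dx+\sum_{i,j=1}^m\int f_j\langle C_{ij},\nabla g_i\rangle\,dx+\int\langle Vf,g\rangle\,dx .$$ Let $L_2$ be the realization in $L^2(\mathbb R^d,\mathbb C^m)$ of $\mathcal L f=\operatorname{div}(Q\nabla f)-F\cdot\nabla f+\operatorname{div}(Cf)-Vf$ associated with $\mathrm a$: $f\in D(L_2)$ and $L_2f=h$ if and only if $f\in D(\mathrm a)$, $h\in L^2(\mathbb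 R^d,\mathbb C^m)$ and $\mathrm a(f,g)=-\langle h,g\rangle_{L^2}$ for all $g\in D(\mathrm a)$. Then there is exactly one $C_0$-semigroup $\{S_2(t)\}_{t\ge0}$ on $L^2(\mathbb R^d,\mathbb C^m)$ whose generator is $L_2$, and there exists $\tilde\omega\in\mathbb R$ such that $\{e^{-\tilde\omega t}S_2(t)\}_{t\ge0}$ is $L^\infty$-contractive: $$\|e^{-\tilde\omega t}S_2(t)f\|_\infty\le\|f\|_\infty\qquad\text{for all }t\ge0\text{ and all }f\in L^2(\mathbb R^d,\mathbb C^m)\cap L^\infty(\mathbb R^d,\mathbb C^m),$$ where $\|f\|_\infty=\operatorname{ess\,sup}_{x}|f(x)|$. -/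

import Mathlib

open MeasureTheory Filter Topology
open scoped NNReal ENNReal ContDiff ComplexConjugate

namespace EllipticSystem

/-- The space `ℝ^d` with its Euclidean norm. -/
abbrev Dom (d : ℕ) : Type := EuclideanSpace ℝ (Fin d)

/-- The Hilbert space `L²(ℝ^d, ℂ^m)`. -/
abbrev L2 (d m : ℕ) : Type :=
  Lp (EuclideanSpace ℂ (Fin m)) 2 (volume : Measure (EuclideanSpace ℝ (Fin d)))

/-- The (real) coefficients of the differential expression
`𝓛 f = div(Q ∇f) - F · ∇f + div(C f) - V f`. -/
structure Coeffs (d m : ℕ) where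
  Q : Dom d → Matrix (Fin d) (Fin d) ℝ
  F : Fin m → Fin m → Dom d → Dom d
  C : Fin m → Fin m → Dom d → Dom d
  V : Dom d → Matrix (Fin m) (Fin m) ℝ

/-- For a real matrix `A` and complex vectors `ξ, ζ`, the number `⟨A ξ, ζ⟩`, which is linear in `ξ`
and conjugate linear in `ζ`. -/
noncomputable def pair {n : ℕ} (A : Matrix (Fin n) (Fin n) ℝ) (ξ ζ : Fin n → ℂ) : ℂ :=
  ∑ i, (∑ j, (A i j : ℂ) * ξ j) * conj (ζ i)

/-- The symmetric part `(A + Aᵀ) / 2` of a real matrix. -/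
noncomputable def symPart {n : ℕ} (A : Matrix (Fin n) (Fin n) ℝ) : Matrix (Fin n) (Fin n) ℝ :=
  (1 / 2 : ℝ) • (A + A.transpose)

section WeakDerivatives

variable {d : ℕ} {G : Type*} [NormedAddCommGroup G] [NormedSpace ℝ G]

/-- `v` is the distributional partial derivative `∂_k u`; both are locally integrable functions. -/
def IsWeakPartial (k : Fin d) (u v : Dom d → G) : Prop :=
  LocallyIntegrable u volume ∧ LocallyIntegrable v volume ∧
    ∀ φ : Dom d → ℝ, ContDiff ℝ ∞ φ → HasCompactSupport φ →
      ∫ x, (fderiv ℝ φ x (EuclideanSpace.single k 1)) • u x = -∫ x, φ x • v x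

open Classical in
/-- A representative of the distributional partial derivative `∂_k u` (it is unique up to null
sets), and `0` if `∂_k u` is not a locally integrable function. -/
noncomputable def weakPartial (k : Fin d) (u : Dom d → G) : Dom d → G :=
  if h : ∃ v, IsWeakPartial k u v then h.choose else 0

theorem isWeakPartial_weakPartial {k : Fin d} {u v : Dom d → G} (h : IsWeakPartial k u v) :
    IsWeakPartial k u (weakPartial k u) := by
  have h' : ∃ v, IsWeakPartial k u v := ⟨v, h⟩
  rw [weakPartial, dif_pos h']
  exact h'.choose_spec

/-- `u ∈ L^∞_loc(ℝ^d)`. -/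
def MemLinftyLoc (u : Dom d → G) : Prop :=
  ∀ R : ℝ, MemLp u ∞ (volume.restrict (Metric.ball (0 : Dom d) R))

/-- `u ∈ W^{1,∞}_loc(ℝ^d)`. -/
def MemW1inftyLoc (u : Dom d → G) : Prop :=
  MemLinftyLoc u ∧ ∀ k : Fin d, ∃ v, IsWeakPartial k u v ∧ MemLinftyLoc v

/-- The distributional divergence of a vector field. -/
noncomputable def weakDiv (b : Dom d → Dom d) (x : Dom d) : ℝ :=
  ∑ k, weakPartial k (fun y => b y k) x

end WeakDerivatives

variable {d m : ℕ}

/-- First set of hypotheses. -/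
structure HypH1 (a : Coeffs d m) : Prop where
  measurable_Q : ∀ i j, Measurable fun x => a.Q x i j
  symm_Q : ∀ x, (a.Q x).IsSymm
  elliptic_Q : ∃ η₁ η₂ : ℝ, 0 < η₁ ∧ 0 < η₂ ∧ ∀ x (ξ : Dom d),
    η₁ * ‖ξ‖ ^ 2 ≤ ∑ i, ∑ j, a.Q x i j * ξ j * ξ i ∧
      ∑ i, ∑ j, a.Q x i j * ξ j * ξ i ≤ η₂ * ‖ξ‖ ^ 2
  bounded_F : ∀ i j, MemLp (a.F i j) ∞ volume
  bounded_C : ∀ i j, MemLp (a.C i j) ∞ volume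
  locallyIntegrable_V : ∀ i j, LocallyIntegrable (fun x => a.V x i j) volume
  sectorial_V : ∃ M : ℝ, 0 < M ∧ ∀ x (ξ : EuclideanSpace ℂ (Fin m)),
    |(pair (a.V x) ξ ξ).im| ≤ M * (pair (a.V x) ξ ξ).re

/-- Second set of hypotheses. -/
structure HypH2 (a : Coeffs d m) : Prop where
  regular_F : ∀ i j k, MemW1inftyLoc fun x => a.F i j x k
  regular_C : ∀ i j k, MemW1inftyLoc fun x => a.C i j x k
  div_le : ∃ γ : ℝ,
    (∀ᵐ x, ∀ ξ : EuclideanSpace ℝ (Fin m),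
      ∑ i, ∑ j, weakDiv (a.F i j) x * ξ i * ξ j ≤ γ * ‖ξ‖ ^ 2) ∧
    (∀ᵐ x, ∀ ξ : EuclideanSpace ℝ (Fin m),
      ∑ i, ∑ j, weakDiv (a.C i j) x * ξ i * ξ j ≤ γ * ‖ξ‖ ^ 2)

/-- The `k`-th distributional partial derivative of the component `f_i`. -/
noncomputable def grad (f : L2 d m) (i : Fin m) (x : Dom d) (k : Fin d) : ℂ :=
  weakPartial k (fun y => f y i) x

/-- `f ∈ H¹(ℝ^d, ℂ^m)`. -/
def MemH1 (f : L2 d m) : Prop :=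
  ∀ (i : Fin m) (k : Fin d), ∃ v : Dom d → ℂ,
    IsWeakPartial k (fun x => f x i) v ∧ MemLp v 2 volume

/-- The form domain: all `f ∈ H¹(ℝ^d, ℂ^m)` with `∫ ⟨V_s f, f⟩ < ∞`. -/
def MemFormDomain (a : Coeffs d m) (f : L2 d m) : Prop :=
  MemH1 f ∧ Integrable (fun x => pair (symPart (a.V x)) (f x) (f x)) volume

/-- The sesquilinear form associated with `-𝓛` (meaningful on the form domain). -/
noncomputable def form (a : Coeffs d m) (f g : L2 d m) : ℂ :=
  (∑ i, ∫ x, pair (a.Q x) (grad f i x) (grad g i x)) +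
  (∑ i, ∑ j, ∫ x, (∑ k, (a.F i j x k : ℂ) * grad f j x k) * conj (g x i)) +
  (∑ i, ∑ j, ∫ x, f x j * ∑ k, (a.C i j x k : ℂ) * conj (grad g i x k)) +
  ∫ x, pair (a.V x) (f x) (g x)

/-- The graph of the realization `L₂` of `𝓛` in `L²(ℝ^d, ℂ^m)`: `f ∈ D(L₂)` and `L₂ f = h`, that is,
`f` lies in the form domain and `form a f g = -⟨h, g⟩₂` for all `g` in the form domain.
Mathlib's inner product is conjugate linear in its first argument. -/
def IsL2Realization (a : Coeffs d m) (f h : L2 d m) : Prop :=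
  MemFormDomain a f ∧ ∀ g : L2 d m, MemFormDomain a g → form a f g = -inner ℂ g h

section Semigroups

variable {X : Type*} [NormedAddCommGroup X] [NormedSpace ℂ X]

/-- `C₀`-semigroups of bounded linear operators. -/
structure IsC0Semigroup (S : ℝ≥0 → X →L[ℂ] X) : Prop where
  map_zero : S 0 = ContinuousLinearMap.id ℂ X
  map_add : ∀ s t, S (s + t) = (S s).comp (S t)
  tendsto_zero : ∀ f, Tendsto (fun t => S t f) (𝓝 0) (𝓝 f)

/-- The graph of the generator: `f` lies in the domain of the generator of `S`, which maps
`f` to `h`. -/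
def GeneratorGraph (S : ℝ≥0 → X →L[ℂ] X) (f h : X) : Prop :=
  Tendsto (fun t : ℝ≥0 => ((t : ℝ)⁻¹ : ℂ) • (S t f - f)) (𝓝[>] 0) (𝓝 h)

end Semigroups

/-- `S` is the `C₀`-semigroup on `L²(ℝ^d, ℂ^m)` generated by the realization `L₂` of `𝓛`. -/
def IsSemigroupS2 (a : Coeffs d m) (S : ℝ≥0 → L2 d m →L[ℂ] L2 d m) : Prop :=
  IsC0Semigroup S ∧ ∀ f h, GeneratorGraph S f h ↔ IsL2Realization a f h

/-- `L^∞`-contractivity of the rescaled family `exp(-w t) S(t)`, `t ≥ 0`. The `L^∞` norm is taken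
with respect to the Euclidean norm of `ℂ^m`. -/
def IsLinftyContractive (w : ℝ) (S : ℝ≥0 → L2 d m →L[ℂ] L2 d m) : Prop :=
  ∀ (t : ℝ≥0) (f : L2 d m), MemLp f ∞ volume →
    eLpNorm ((Real.exp (-w * t) : ℂ) • S t f : L2 d m) ∞ volume ≤ eLpNorm f ∞ volume

end EllipticSystem

/-!
An abstract generation theorem reduces both claims to the resolvent equation of `L₂`, which is
solved by the Lax–Milgram theorem and estimated in `L^∞` by testing it with a truncation of its
solution.

*Abstract part.* Let `G` be the graph of a densely defined operator `A` on a Hilbert space such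
that `A - w` is dissipative and `l + w - A` is onto for `l > 0`. The Yosida approximations
`A_l = l (J_l - 1)`, where `J_l = l (l + w - A)⁻¹`, generate contraction semigroups that converge
strongly as `l → ∞` (`exists_contraction_semigroup`). Since `exp (t A_l)` is an infinite convex
combination of the powers of `J_l`, the limit preserves every closed convex set that contains `0`
and is preserved by all `J_l`. An energy inequality for the difference of two orbits shows that
the semigroup is determined by its generator (`IsC0Semigroup.eq_of_generatorGraph_iff`). Hence
only resolvents have to be studied (`existsUnique_semigroup`).

*Generation.* By ellipticity and the boundedness of `F` and `C`, the form satisfies a Gårding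
inequality (`exists_formDensity_re_ge`); the sectoriality of `V` makes it bounded with respect to
the form norm `∫ |f|² + |∇f|² + Re ⟨V f, f⟩`, by polarization (`norm_pair_le`). The form domain is
complete for this norm, so that the Lax–Milgram theorem solves the resolvent equation
(`exists_realizationGraph_eq`).

*Contractivity in `L^∞`.* By the abstract part it suffices that `(l + w) u - L₂ u = l y` and
`|y| ≤ 1` imply `|u| ≤ 1`, with `w` independent of `l` (`exists_mem_unitBallLinfty`). Let `Ψ` be a
bounded nondecreasing function vanishing exactly on `(-∞, 1]`, and test the equation with
`g = Ψ(|u|²) u`. The term with `Q` is at least `η₁ Ψ |∇u|²`, because the derivative of `Ψ(|u|²)`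
adds `Ψ' ⟨Q ∇|u|², ∇|u|²⟩ / 2 ≥ 0`; the terms with `F` and `V` carry the factor `Ψ` and are
controlled pointwise. The term with `C` contains `∇g`, and hence `Ψ'`, but by integration by parts
it equals a term with the factor `Ψ` and `∇u` up to `∫ Ψ Re ∑ div(C_ij) u_j ū_i`, which the
divergence condition bounds by `γ ∫ Ψ |u|²` (`exists_integral_crossTerm_ge`). Altogether
`Re a(u, g) ≥ -w ∫ Ψ |u|²`, and the equation gives `∫ Ψ |u| (|u| - 1) ≤ 0`, whose integrand is
positive where `|u| > 1`.

The calculus of weak derivatives used for this (integration by parts for pairs of `H¹` functions,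
the chain rule for differentiable Lipschitz functions of several `H¹` functions) rests on the
convergence of difference quotients in `L²` (`IsWeakPartial.tendsto_translate`).
-/

namespace EllipticSystem

/-! ### Exponentials of bounded operators -/

section HilleYosida

variable {X : Type*} [NormedAddCommGroup X] [NormedSpace ℂ X] [CompleteSpace X]

theorem exp_add_smul (A : X →L[ℂ] X) (s t : ℝ) :
    NormedSpace.exp ((s + t) • A) = NormedSpace.exp (s • A) * NormedSpace.exp (t • A) := by
  let _ : NormedAlgebra ℚ (X →L[ℂ] X) := NormedAlgebra.restrictScalars ℚ ℝ _
  rw [add_smul]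
  exact NormedSpace.exp_add_of_commute (((Commute.refl A).smul_left s).smul_right t)

/-- `exp (s (J - 1))` is an infinite convex combination of the powers of `J`; it preserves every
closed convex set that contains `0` and is preserved by `J`. -/
theorem exp_smul_sub_one_mem (J : X →L[ℂ] X) {K : Set X} (hconv : Convex ℝ K) (hcl : IsClosed K)
    (h0 : 0 ∈ K) (hJ : ∀ x ∈ K, J x ∈ K) {s : ℝ} (hs : 0 ≤ s) {x : X} (hx : x ∈ K) :
    NormedSpace.exp (s • (J - 1)) x ∈ K := by
  let _ : NormedAlgebra ℚ (X →L[ℂ] X) := NormedAlgebra.restrictScalars ℚ ℝ _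
  have hsplit : NormedSpace.exp (s • (J - 1)) = Real.exp (-s) • NormedSpace.exp (s • J) := by
    have h1 : s • (J - 1) = (algebraMap ℝ (X →L[ℂ] X)) (-s) + s • J := by
      rw [Algebra.algebraMap_eq_smul_one, smul_sub, neg_smul]; abel
    rw [h1, NormedSpace.exp_add_of_commute (Algebra.commute_algebraMap_left _ _),
      ← NormedSpace.algebraMap_exp_comm, ← Real.exp_eq_exp_ℝ, Algebra.algebraMap_eq_smul_one,
      smul_mul_assoc, one_mul]
  have hsum := (NormedSpace.exp_series_hasSum_exp' (𝕂 := ℝ) (s • J)).mapL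
    (ContinuousLinearMap.apply ℂ X x)
  have hsum' := (hsum.const_smul (Real.exp (-s))).tendsto_sum_nat
  have hlim : Real.exp (-s) • (ContinuousLinearMap.apply ℂ X x) (NormedSpace.exp (s • J)) =
      NormedSpace.exp (s • (J - 1)) x := by
    rw [hsplit]; rfl
  rw [hlim] at hsum'
  refine hcl.mem_of_tendsto hsum' (Eventually.of_forall fun N => ?_)
  set w : ℕ → ℝ := fun k => Real.exp (-s) * (s ^ k / k.factorial)
  have hw : ∀ k, 0 ≤ w k := fun k => by positivity
  have hpow : ∀ k, (J ^ k) x ∈ K := by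
    intro k
    induction k with
    | zero => simpa using hx
    | succ k ih => rw [pow_succ']; exact hJ _ ih
  have hterm : ∀ k, Real.exp (-s) • (ContinuousLinearMap.apply ℂ X x)
      (((k.factorial : ℝ))⁻¹ • (s • J) ^ k) = w k • (J ^ k) x := by
    intro k
    rw [smul_pow]
    simp only [ContinuousLinearMap.apply_apply, _root_.smul_apply, smul_smul, w]
    congr 1
    ring
  have hle : ∑ k ∈ Finset.range N, w k ≤ 1 := by
    rw [← Finset.mul_sum]
    calc _ ≤ Real.exp (-s) * Real.exp s := by
          gcongr; exact Real.sum_le_exp_of_nonneg hs N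
      _ = 1 := by rw [← Real.exp_add]; simp
  simp only [hterm]
  rcases (Finset.sum_nonneg fun k (_ : k ∈ Finset.range N) => hw k).eq_or_lt with h | h
  · have : ∀ k ∈ Finset.range N, w k = 0 :=
      (Finset.sum_eq_zero_iff_of_nonneg fun k _ => hw k).1 h.symm
    rw [Finset.sum_eq_zero fun k hk => by rw [this k hk, zero_smul]]
    exact h0
  · have hc := hconv.centerMass_mem (t := Finset.range N) (w := w) (z := fun k => (J ^ k) x)
      (fun k _ => hw k) h (fun k _ => hpow k)
    have := hconv.smul_mem_of_zero_mem h0 hc ⟨h.le, hle⟩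
    rwa [Finset.centerMass, smul_smul, mul_inv_cancel₀ h.ne', one_smul] at this

theorem norm_exp_smul_sub_one_apply_le (J : X →L[ℂ] X) (hJ : ∀ x, ‖J x‖ ≤ ‖x‖) {s : ℝ}
    (hs : 0 ≤ s) (x : X) : ‖NormedSpace.exp (s • (J - 1)) x‖ ≤ ‖x‖ := by
  have := exp_smul_sub_one_mem J (convex_closedBall (0 : X) ‖x‖) Metric.isClosed_closedBall
    (by simp) (fun y hy => by simpa using (hJ y).trans (by simpa using hy)) hs
    (by simp : x ∈ Metric.closedBall (0 : X) ‖x‖)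
  simpa using this

theorem hasDerivAt_exp_smul_apply (A : X →L[ℂ] X) (f : X) (t : ℝ) :
    HasDerivAt (fun s : ℝ => NormedSpace.exp (s • A) f) (NormedSpace.exp (t • A) (A f)) t :=
  (((ContinuousLinearMap.apply ℂ X f).restrictScalars ℝ).hasFDerivAt).comp_hasDerivAt t
    (hasDerivAt_exp_smul_const A t)

/-- Two commuting contraction semigroups are compared by differentiating
`s ↦ exp (s A) exp ((t - s) B) f`. -/
theorem norm_exp_smul_sub_exp_smul_le {A B : X →L[ℂ] X} (hAB : Commute A B)
    (hA : ∀ s : ℝ, 0 ≤ s → ∀ x, ‖NormedSpace.exp (s • A) x‖ ≤ ‖x‖)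
    (hB : ∀ s : ℝ, 0 ≤ s → ∀ x, ‖NormedSpace.exp (s • B) x‖ ≤ ‖x‖) {t : ℝ} (ht : 0 ≤ t) (f : X) :
    ‖NormedSpace.exp (t • A) f - NormedSpace.exp (t • B) f‖ ≤ t * ‖A f - B f‖ := by
  let _ : NormedAlgebra ℚ (X →L[ℂ] X) := NormedAlgebra.restrictScalars ℚ ℝ _
  set φ : ℝ → X := fun s => NormedSpace.exp (s • A) (NormedSpace.exp ((t - s) • B) f)
  have hφ : ∀ s, φ s = NormedSpace.exp (s • (A - B)) (NormedSpace.exp (t • B) f) := by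
    intro s
    have : NormedSpace.exp (s • (A - B)) * NormedSpace.exp (t • B) =
        NormedSpace.exp (s • A) * NormedSpace.exp ((t - s) • B) := by
      rw [← NormedSpace.exp_add_of_commute, ← NormedSpace.exp_add_of_commute]
      · congr 1; rw [smul_sub, sub_smul]; abel
      · exact (hAB.smul_left s).smul_right _
      · exact ((hAB.sub_left (Commute.refl B)).smul_left s).smul_right _
    exact (congrArg (fun T : X →L[ℂ] X => T f) this).symm
  have hderiv : ∀ s, HasDerivAt φ
      (NormedSpace.exp (s • A) (NormedSpace.exp ((t - s) • B) (A f - B f))) s := by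
    intro s
    have h1 := hasDerivAt_exp_smul_apply (A - B) (NormedSpace.exp (t • B) f) s
    have h2 : NormedSpace.exp (s • (A - B)) ((A - B) (NormedSpace.exp (t • B) f)) =
        NormedSpace.exp (s • A) (NormedSpace.exp ((t - s) • B) (A f - B f)) := by
      have : NormedSpace.exp (s • (A - B)) * ((A - B) * NormedSpace.exp (t • B)) =
          NormedSpace.exp (s • A) * (NormedSpace.exp ((t - s) • B) * (A - B)) := by
        have hc : Commute (A - B) (NormedSpace.exp (t • B)) :=
          (((hAB.sub_left (Commute.refl B))).smul_right t).exp_right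
        rw [hc.eq, ← mul_assoc, ← mul_assoc, ← NormedSpace.exp_add_of_commute,
          ← NormedSpace.exp_add_of_commute]
        · congr 2; rw [smul_sub, sub_smul]; abel
        · exact (hAB.smul_left s).smul_right _
        · exact ((hAB.sub_left (Commute.refl B)).smul_left s).smul_right _
      exact congrArg (fun T : X →L[ℂ] X => T f) this
    rw [h2] at h1
    exact h1.congr_of_eventuallyEq (Eventually.of_forall hφ)
  have := norm_image_sub_le_of_norm_deriv_le_segment' (f := φ) (a := 0) (b := t)
    (C := ‖A f - B f‖) (fun s _ => (hderiv s).hasDerivWithinAt)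
    (fun s hs => (hA s hs.1 _).trans (hB _ (sub_nonneg.2 hs.2.le) _)) t ⟨ht, le_rfl⟩
  simpa [φ, mul_comm] using this

/-- If `exp (s A) A f` stays `C`-close to `h` on `[0, t]`, then `exp (t A) f` is `C t`-close to
`f + t h`. -/
theorem norm_exp_smul_sub_sub_le {A : X →L[ℂ] X} {t C : ℝ} (ht : 0 ≤ t) (f h : X)
    (hC : ∀ s, 0 ≤ s → s ≤ t → ‖NormedSpace.exp (s • A) (A f) - h‖ ≤ C) :
    ‖NormedSpace.exp (t • A) f - f - t • h‖ ≤ C * t := by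
  have := norm_image_sub_le_of_norm_deriv_le_segment'
    (f := fun s : ℝ => NormedSpace.exp (s • A) f - s • h) (a := 0) (b := t) (C := C)
    (fun s _ => ((hasDerivAt_exp_smul_apply A f s).sub
      ((hasDerivAt_id s).smul_const h)).hasDerivWithinAt)
    (fun s hs => by simpa using hC s hs.1 hs.2.le) t ⟨ht, le_rfl⟩
  simpa [sub_right_comm] using this

end HilleYosida

/-! ### The Hille–Yosida theorem -/

section HilleYosida

variable {X : Type*} [NormedAddCommGroup X] [NormedSpace ℂ X]

/-- The graph `G` of a linear operator `A` has the operators `J l = l (l - A)⁻¹`, `l > 0`, as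
everywhere defined contractions. -/
theorem exists_resolvent {G : Submodule ℂ (X × X)}
    (hdiss : ∀ p ∈ G, ∀ l : ℝ, 0 < l → l * ‖p.1‖ ≤ ‖(l : ℂ) • p.1 - p.2‖)
    (hsurj : ∀ l : ℝ, 0 < l → ∀ y, ∃ p ∈ G, (l : ℂ) • p.1 - p.2 = y) {l : ℝ} (hl : 0 < l) :
    ∃ J : X →L[ℂ] X, (∀ y, (J y, (l : ℂ) • (J y - y)) ∈ G) ∧ ∀ y, ‖J y‖ ≤ ‖y‖ := by
  have hl' : (l : ℂ) ≠ 0 := by exact_mod_cast hl.ne'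
  have hex : ∀ y, ∃ u, (u, (l : ℂ) • (u - y)) ∈ G := fun y => by
    obtain ⟨p, hp, hpy⟩ := hsurj l hl ((l : ℂ) • y)
    refine ⟨p.1, ?_⟩
    rw [smul_sub, ← hpy]
    simpa using hp
  choose R hR using hex
  have huniq : ∀ u y, (u, (l : ℂ) • (u - y)) ∈ G → ‖u‖ ≤ ‖y‖ := fun u y h => by
    have := hdiss _ h l hl
    simp only [smul_sub, sub_sub_cancel, norm_smul, Complex.norm_real, Real.norm_eq_abs,
      abs_of_pos hl] at this
    exact le_of_mul_le_mul_left this hl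
  have hinj : ∀ u v y, (u, (l : ℂ) • (u - y)) ∈ G → (v, (l : ℂ) • (v - y)) ∈ G → u = v := by
    intro u v y hu hv
    have := huniq (u - v) 0 (by
      convert G.sub_mem hu hv using 1
      simp [smul_sub])
    rwa [norm_zero, norm_le_zero_iff, sub_eq_zero] at this
  let J₀ : X →ₗ[ℂ] X :=
    { toFun := R
      map_add' := fun y z => hinj _ _ (y + z) (hR _) (by
        convert G.add_mem (hR y) (hR z) using 1
        simp only [Prod.mk_add_mk, smul_sub, smul_add]
        congr 1; abel)
      map_smul' := fun c y => hinj _ _ (c • y) (hR _) (by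
        convert G.smul_mem c (hR y) using 1
        refine Prod.ext rfl ?_
        simp only [Prod.smul_mk, RingHom.id_apply]
        module) }
  exact ⟨J₀.mkContinuous 1 fun y => by simpa [J₀] using huniq _ _ (hR y), hR,
    fun y => huniq _ _ (hR y)⟩

/-- The operators `l (l - A)⁻¹` for different `l` commute, by the resolvent identity. -/
theorem commute_resolvent {G : Submodule ℂ (X × X)}
    (hdiss : ∀ p ∈ G, ∀ l : ℝ, 0 < l → l * ‖p.1‖ ≤ ‖(l : ℂ) • p.1 - p.2‖)
    {l m : ℝ} (hl : 0 < l) (hm : 0 < m) {J J' : X →L[ℂ] X}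
    (hJ : ∀ y, (J y, (l : ℂ) • (J y - y)) ∈ G) (hJ' : ∀ y, (J' y, (m : ℂ) • (J' y - y)) ∈ G) :
    Commute J J' := by
  -- the resolvent identity `(m - l) J J' = m J - l J'`
  have key : ∀ (l m : ℝ), 0 < l → 0 < m → ∀ J J' : X →L[ℂ] X,
      (∀ y, (J y, (l : ℂ) • (J y - y)) ∈ G) → (∀ y, (J' y, (m : ℂ) • (J' y - y)) ∈ G) →
      ∀ y, ((m : ℂ) - l) • J (J' y) = (m : ℂ) • J y - (l : ℂ) • J' y := by
    intro l m hl hm J J' hJ hJ' y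
    have h1 := G.smul_mem ((m : ℂ) - l) (hJ (J' y))
    have h2 := G.sub_mem (G.smul_mem (m : ℂ) (hJ y)) (G.smul_mem (l : ℂ) (hJ' y))
    have := hdiss _ (G.sub_mem h1 h2) l hl
    have h0 : (l : ℂ) • (((m : ℂ) - l) • (J (J' y), (l : ℂ) • (J (J' y) - J' y)) -
        ((m : ℂ) • (J y, (l : ℂ) • (J y - y)) - (l : ℂ) • (J' y, (m : ℂ) • (J' y - y)))).1 -
        (((m : ℂ) - l) • (J (J' y), (l : ℂ) • (J (J' y) - J' y)) -
        ((m : ℂ) • (J y, (l : ℂ) • (J y - y)) - (l : ℂ) • (J' y, (m : ℂ) • (J' y - y)))).2 = 0 := by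
      simp only [Prod.smul_mk, Prod.mk_sub_mk]
      module
    rw [h0, norm_zero] at this
    have h3 := norm_le_zero_iff.1 (nonpos_of_mul_nonpos_right this hl)
    exact sub_eq_zero.1 h3
  rcases eq_or_ne l m with rfl | hne
  · have : J = J' := by
      ext y
      have := hdiss _ (G.sub_mem (hJ y) (hJ' y)) l hl
      have h0 : (l : ℂ) • ((J y, (l : ℂ) • (J y - y)) - (J' y, (l : ℂ) • (J' y - y))).1 -
          ((J y, (l : ℂ) • (J y - y)) - (J' y, (l : ℂ) • (J' y - y))).2 = 0 := by
        simp only [Prod.mk_sub_mk]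
        module
      rw [h0, norm_zero] at this
      exact sub_eq_zero.1 (norm_le_zero_iff.1 (nonpos_of_mul_nonpos_right this hl))
    rw [this]
  · ext y
    have hne' : ((m : ℂ) - l) ≠ 0 := by
      rw [sub_ne_zero]; exact_mod_cast hne.symm
    have h1 := key l m hl hm J J' hJ hJ' y
    have h2 := key m l hm hl J' J hJ' hJ y
    have h3 : ((m : ℂ) - l) • J (J' y) = ((m : ℂ) - l) • J' (J y) := by
      rw [h1, ← neg_sub (l : ℂ) m, neg_smul, h2]; abel
    exact smul_right_injective X hne' h3

/-- `1` is not an eigenvalue of the generator of a contraction semigroup. -/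
theorem eq_zero_of_generatorGraph_self {T : ℝ≥0 → X →L[ℂ] X}
    (hT : ∀ t x, ‖T t x‖ ≤ ‖x‖) {w : X} (hw : GeneratorGraph T w w) : w = 0 := by
  have hlim : Tendsto (fun t : ℝ≥0 => ‖((t : ℝ)⁻¹ : ℂ) • (T t w - w) - w‖) (𝓝[>] 0) (𝓝 0) := by
    have := (hw.sub_const w).norm
    rwa [sub_self, norm_zero] at this
  refine norm_le_zero_iff.1 (ge_of_tendsto hlim ?_)
  filter_upwards [self_mem_nhdsWithin] with t ht
  have ht' : (0 : ℝ) < t := ht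
  have htc : ((t : ℝ) : ℂ) ≠ 0 := by exact_mod_cast ht'.ne'
  set e := ((t : ℝ)⁻¹ : ℂ) • (T t w - w) - w with he
  have h1 : ((1 + t : ℝ) : ℂ) • w = T t w - ((t : ℝ) : ℂ) • e := by
    rw [he, smul_sub, smul_smul, mul_inv_cancel₀ htc]
    push_cast
    module
  have h2 := congrArg norm h1
  rw [norm_smul, Complex.norm_real, Real.norm_of_nonneg (by positivity)] at h2
  have h3 := norm_sub_le (T t w) (((t : ℝ) : ℂ) • e)
  rw [norm_smul, Complex.norm_real, Real.norm_of_nonneg ht'.le] at h3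
  have h4 := hT t w
  have : (t : ℝ) * ‖w‖ ≤ t * ‖e‖ := by linarith
  exact le_of_mul_le_mul_left this ht'

/-- The Yosida approximations of a densely defined dissipative operator with graph `G`: bounded
operators `A n = (n + 1) (J n - 1)` generating commuting contraction semigroups, which converge
strongly to the operator on its domain. -/
theorem exists_yosida {G : Submodule ℂ (X × X)}
    (hdense : Dense {f : X | ∃ h, (f, h) ∈ G})
    (hdiss : ∀ p ∈ G, ∀ l : ℝ, 0 < l → l * ‖p.1‖ ≤ ‖(l : ℂ) • p.1 - p.2‖)
    (hsurj : ∀ l : ℝ, 0 < l → ∀ y, ∃ p ∈ G, (l : ℂ) • p.1 - p.2 = y) :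
    ∃ J : ℕ → X →L[ℂ] X, ∃ A : ℕ → X →L[ℂ] X, (∀ n, A n = ((n : ℝ) + 1) • (J n - 1)) ∧
      (∀ n y, (J n y, (((n : ℝ) + 1 : ℝ) : ℂ) • (J n y - y)) ∈ G) ∧ (∀ n y, ‖J n y‖ ≤ ‖y‖) ∧
      (∀ n m, Commute (A n) (A m)) ∧ (∀ f h, (f, h) ∈ G → ∀ n, A n f = J n h) ∧
      ∀ y, Tendsto (fun n => J n y) atTop (𝓝 y) := by
  have hc : ∀ n : ℕ, 0 < (n : ℝ) + 1 := fun n => by positivity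
  choose J hJG hJ using fun n : ℕ => exists_resolvent hdiss hsurj (hc n)
  have hA : ∀ f h, (f, h) ∈ G → ∀ n : ℕ, (((n : ℝ) + 1) • (J n - 1)) f = J n h := by
    intro f h hf n
    set l : ℝ := (n : ℝ) + 1
    -- `l (J f - f)` and `J h` solve the same resolvent equation
    have hmem := G.sub_mem (G.smul_mem (l : ℂ) (G.sub_mem (hJG n f) hf)) (hJG n h)
    have := hdiss _ hmem l (hc n)
    have h0 : (l : ℂ) • ((l : ℂ) • ((J n f, (l : ℂ) • (J n f - f)) - (f, h)) -
        (J n h, (l : ℂ) • (J n h - h))).1 - ((l : ℂ) • ((J n f, (l : ℂ) • (J n f - f)) - (f, h)) -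
        (J n h, (l : ℂ) • (J n h - h))).2 = 0 := by
      simp only [Prod.mk_sub_mk, Prod.smul_mk]
      module
    rw [h0, norm_zero] at this
    have h3 := sub_eq_zero.1 (norm_le_zero_iff.1 (nonpos_of_mul_nonpos_right this (hc n)))
    change (l : ℂ) • (J n f - f) = J n h at h3
    rw [← h3]
    rfl
  refine ⟨J, fun n => ((n : ℝ) + 1) • (J n - 1), fun n => rfl, hJG, hJ, fun n m => ?_, hA, ?_⟩
  · have := commute_resolvent hdiss (hc n) (hc m) (hJG n) (hJG m)
    exact (((this.sub_left (Commute.one_left _)).sub_right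
      ((Commute.one_right _))).smul_left _).smul_right _
  · have hD : ∀ f h, (f, h) ∈ G → Tendsto (fun n => J n f) atTop (𝓝 f) := by
      intro f h hf
      rw [tendsto_iff_norm_sub_tendsto_zero]
      have hlim : Tendsto (fun n : ℕ => (1 / ((n : ℝ) + 1)) * ‖h‖) atTop (𝓝 0) := by
        simpa using tendsto_one_div_add_atTop_nhds_zero_nat.mul_const ‖h‖
      refine squeeze_zero (fun _ => norm_nonneg _) (fun n => ?_) hlim
      have := hA f h hf n
      change ((n : ℝ) + 1) • (J n f - f) = J n h at this
      have h2 := congrArg norm this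
      rw [norm_smul, Real.norm_of_nonneg (hc n).le] at h2
      rw [div_mul_eq_mul_div, one_mul, le_div_iff₀' (hc n), h2]
      exact hJ n h
    intro y
    rw [Metric.tendsto_atTop]
    intro ε hε
    obtain ⟨f, ⟨h, hf⟩, hfy⟩ := hdense.exists_dist_lt y (show 0 < ε / 3 by positivity)
    obtain ⟨N, hN⟩ := Metric.tendsto_atTop.1 (hD f h hf) (ε / 3) (by positivity)
    refine ⟨N, fun n hn => ?_⟩
    have h1 := hN n hn
    have h2 := hJ n (y - f)
    rw [map_sub, ← dist_eq_norm, ← dist_eq_norm] at h2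
    have h3 := dist_triangle4 (J n y) (J n f) f y
    rw [dist_comm f y] at h3
    linarith

variable [CompleteSpace X]

/-- **Hille–Yosida theorem** for contraction semigroups. The semigroup is the strong limit of the
exponentials of the Yosida approximations; for this reason it preserves every closed convex set
containing `0` that is preserved by the operators `l (l - A)⁻¹`. -/
theorem exists_contraction_semigroup {G : Submodule ℂ (X × X)}
    (hdense : Dense {f : X | ∃ h, (f, h) ∈ G})
    (hdiss : ∀ p ∈ G, ∀ l : ℝ, 0 < l → l * ‖p.1‖ ≤ ‖(l : ℂ) • p.1 - p.2‖)
    (hsurj : ∀ l : ℝ, 0 < l → ∀ y, ∃ p ∈ G, (l : ℂ) • p.1 - p.2 = y) :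
    ∃ T : ℝ≥0 → X →L[ℂ] X, IsC0Semigroup T ∧ (∀ f h, GeneratorGraph T f h ↔ (f, h) ∈ G) ∧
      ∀ K : Set X, Convex ℝ K → IsClosed K → 0 ∈ K →
        (∀ l : ℝ, 0 < l → ∀ p ∈ G, ∀ y ∈ K, (l : ℂ) • p.1 - p.2 = (l : ℂ) • y → p.1 ∈ K) →
        ∀ t, ∀ f ∈ K, T t f ∈ K := by
  obtain ⟨J, A, hAJ, hJG, hJ, hcomm, hA, hJlim⟩ := exists_yosida hdense hdiss hsurj
  have hc : ∀ n : ℕ, 0 < (n : ℝ) + 1 := fun n => by positivity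
  set U : ℕ → ℝ → X →L[ℂ] X := fun n t => NormedSpace.exp (t • A n) with hUdef
  have hUK : ∀ K : Set X, Convex ℝ K → IsClosed K → 0 ∈ K → ∀ n, (∀ x ∈ K, J n x ∈ K) →
      ∀ t, 0 ≤ t → ∀ f ∈ K, U n t f ∈ K := by
    intro K h1 h2 h3 n h4 t ht f hf
    simp only [hUdef, hAJ, smul_smul]
    exact exp_smul_sub_one_mem (J n) h1 h2 h3 h4 (mul_nonneg ht (hc n).le) hf
  have hU : ∀ n t, 0 ≤ t → ∀ x, ‖U n t x‖ ≤ ‖x‖ := by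
    intro n t ht x
    simp only [hUdef, hAJ, smul_smul]
    exact norm_exp_smul_sub_one_apply_le (J n) (hJ n) (mul_nonneg ht (hc n).le) x
  have hAlim : ∀ f h, (f, h) ∈ G → Tendsto (fun n => A n f) atTop (𝓝 h) := by
    intro f h hf
    simp only [hA f h hf]
    exact hJlim h
  have hcauchy : ∀ t : ℝ≥0, ∀ f, CauchySeq fun n => U n t f := by
    intro t f
    rw [Metric.cauchySeq_iff]
    intro ε hε
    obtain ⟨g, ⟨h, hg⟩, hgf⟩ := hdense.exists_dist_lt f (show 0 < ε / 3 by positivity)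
    obtain ⟨N, hN⟩ := Metric.cauchySeq_iff.1 (hAlim g h hg).cauchySeq (ε / (3 * (t + 1)))
      (by positivity)
    refine ⟨N, fun n hn k hk => ?_⟩
    have h1 := norm_exp_smul_sub_exp_smul_le (hcomm n k) (hU n) (hU k) t.2 g
    rw [← dist_eq_norm, ← dist_eq_norm] at h1
    have h2 := hU n t t.2 (f - g)
    have h3 := hU k t t.2 (f - g)
    rw [map_sub, ← dist_eq_norm, ← dist_eq_norm] at h2 h3
    have h4 := dist_triangle4 (U n t f) (U n t g) (U k t g) (U k t f)
    rw [dist_comm (U k t g)] at h4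
    have h5 : (t : ℝ) * dist (A n g) (A k g) ≤ ε / 3 := by
      calc (t : ℝ) * dist (A n g) (A k g) ≤ (t + 1) * (ε / (3 * (t + 1))) := by
            gcongr
            · linarith
            · exact (hN n hn k hk).le
        _ = ε / 3 := by
            have : (t : ℝ) + 1 ≠ 0 := by positivity
            field_simp
    exact lt_of_le_of_lt h4 (by
      have h6 : dist (U n t g) (U k t g) ≤ ε / 3 := h1.trans h5
      linarith)
  choose T₀ hT₀ using fun (t : ℝ≥0) (f : X) => cauchySeq_tendsto_of_complete (hcauchy t f)
  let T : ℝ≥0 → X →L[ℂ] X := fun t => continuousLinearMapOfTendsto (fun n => U n (t : ℝ))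
    (tendsto_pi_nhds.2 fun f => hT₀ t f)
  have hT : ∀ (t : ℝ≥0) f, Tendsto (fun n => U n t f) atTop (𝓝 (T t f)) := hT₀
  have hTle : ∀ t x, ‖T t x‖ ≤ ‖x‖ := fun t x =>
    le_of_tendsto (hT t x).norm (Eventually.of_forall fun n => hU n t t.2 x)
  -- the approximating semigroups are strongly continuous at `0`, uniformly in `n`
  have hequi : ∀ h : X, ∀ ε > 0, ∃ δ > 0, ∀ s, 0 ≤ s → s ≤ δ → ∀ n, ‖U n s h - h‖ ≤ ε := by
    intro h ε hε
    obtain ⟨g, ⟨g', hg⟩, hgh⟩ := hdense.exists_dist_lt h (show 0 < ε / 3 by positivity)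
    refine ⟨ε / (3 * (‖g'‖ + 1)), by positivity, fun s hs hsδ n => ?_⟩
    have h1 : ‖U n s g - g‖ ≤ ‖g'‖ * s := by
      have := norm_exp_smul_sub_sub_le (A := A n) hs g 0 (C := ‖g'‖) (fun r hr _ => by
        rw [sub_zero, hA g g' hg]
        exact (hU n r hr _).trans (hJ n _))
      simpa using this
    have h2 : ‖g'‖ * s ≤ ε / 3 := by
      calc ‖g'‖ * s ≤ (‖g'‖ + 1) * (ε / (3 * (‖g'‖ + 1))) := by gcongr; linarith
        _ = ε / 3 := by
            have : ‖g'‖ + 1 ≠ 0 := by positivity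
            field_simp
    have h3 := hU n s hs (h - g)
    rw [map_sub, ← dist_eq_norm, ← dist_eq_norm] at h3
    rw [← dist_eq_norm] at h1 ⊢
    have h4 := dist_triangle4 (U n s h) (U n s g) g h
    rw [dist_comm g h] at h4
    linarith
  have hzero : ∀ f, Tendsto (fun t => T t f) (𝓝 0) (𝓝 f) := by
    intro f
    rw [Metric.tendsto_nhds]
    intro ε hε
    obtain ⟨δ, hδ, h⟩ := hequi f (ε / 2) (by positivity)
    have : ∀ᶠ t : ℝ≥0 in 𝓝 0, (t : ℝ) < δ :=
      (NNReal.continuous_coe.tendsto 0).eventually_lt_const (by simpa using hδ)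
    filter_upwards [this] with t ht
    rw [dist_eq_norm]
    have : ‖T t f - f‖ ≤ ε / 2 := le_of_tendsto ((hT t f).sub_const f).norm
      (Eventually.of_forall fun n => h t t.2 ht.le n)
    linarith
  have hgen : ∀ f h, (f, h) ∈ G → GeneratorGraph T f h := by
    intro f h hf
    rw [GeneratorGraph, Metric.tendsto_nhds]
    intro ε hε
    obtain ⟨δ, hδ, hδ'⟩ := hequi h (ε / 2) (by positivity)
    have : ∀ᶠ t : ℝ≥0 in 𝓝[>] 0, (t : ℝ) < δ := nhdsWithin_le_nhds
      ((NNReal.continuous_coe.tendsto 0).eventually_lt_const (by simpa using hδ))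
    filter_upwards [this, self_mem_nhdsWithin] with t ht ht0
    have ht0' : (0 : ℝ) < t := ht0
    have h1 : ∀ n, ‖U n t f - f - (t : ℝ) • h‖ ≤ (‖A n f - h‖ + ε / 2) * t := by
      intro n
      refine norm_exp_smul_sub_sub_le t.2 f h fun s hs hst => ?_
      calc _ = ‖U n s (A n f - h) + (U n s h - h)‖ := by rw [map_sub]; congr 1; abel
        _ ≤ _ := (norm_add_le _ _).trans (add_le_add (hU n s hs _) (hδ' s hs (hst.trans ht.le) n))
    have h2 : Tendsto (fun n => (‖A n f - h‖ + ε / 2) * (t : ℝ)) atTop (𝓝 ((0 + ε / 2) * t)) := by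
      refine (Tendsto.add_const _ ?_).mul_const _
      exact tendsto_iff_norm_sub_tendsto_zero.1 (hAlim f h hf)
    have h3 := le_of_tendsto_of_tendsto' (((hT t f).sub_const f).sub_const ((t : ℝ) • h)).norm h2 h1
    have htc : ((t : ℝ) : ℂ) ≠ 0 := by exact_mod_cast ht0'.ne'
    have h4 : ((t : ℝ)⁻¹ : ℂ) • (T t f - f) - h =
        ((t : ℝ)⁻¹ : ℂ) • (T t f - f - (t : ℝ) • h) := by
      rw [← Complex.coe_smul, smul_sub _ (T t f - f), smul_smul, inv_mul_cancel₀ htc, one_smul]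
    rw [dist_eq_norm, h4, norm_smul, norm_inv, Complex.norm_real, Real.norm_of_nonneg ht0'.le]
    calc _ ≤ (t : ℝ)⁻¹ * ((0 + ε / 2) * t) := by gcongr
      _ = ε / 2 := by field_simp; ring
      _ < ε := by linarith
  refine ⟨T, ⟨?_, ?_, hzero⟩, fun f h => ⟨fun hfh => ?_, hgen f h⟩, ?_⟩
  · ext f
    refine tendsto_nhds_unique (hT 0 f) ?_
    simp [hUdef]
  · intro s t
    ext f
    refine tendsto_nhds_unique (hT (s + t) f) ?_
    have h1 : ∀ n, U n ((s + t : ℝ≥0) : ℝ) f = U n s (U n t f - T t f) + U n s (T t f) := by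
      intro n
      rw [← map_add, sub_add_cancel]
      exact congrArg (fun B : X →L[ℂ] X => B f) (exp_add_smul (A n) s t)
    simp only [h1]
    have h2 : Tendsto (fun n => U n s (U n t f - T t f)) atTop (𝓝 0) :=
      squeeze_zero_norm (fun n => hU n s s.2 _)
        (tendsto_iff_norm_sub_tendsto_zero.1 (hT t f))
    simpa using h2.add (hT s (T t f))
  · -- the generator of `T` extends `G`, and it is no larger, as `1 - G` is onto
    obtain ⟨p, hp, hpy⟩ := hsurj 1 one_pos (f - h)
    simp only [Complex.ofReal_one, one_smul] at hpy
    have h1 : GeneratorGraph T (f - p.1) (h - p.2) := by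
      have := hfh.sub (hgen p.1 p.2 hp)
      refine this.congr fun t => ?_
      rw [map_sub, ← smul_sub]
      congr 1; abel
    have h2 : h - p.2 = f - p.1 := by
      have : p.2 = p.1 - (f - h) := by rw [← hpy]; abel
      rw [this]; abel
    rw [h2] at h1
    have h3 := eq_zero_of_generatorGraph_self hTle h1
    rw [h3] at h2
    rw [sub_eq_zero.1 h3, sub_eq_zero.1 h2]
    exact hp
  · intro K h1 h2 h3 h4 t f hf
    refine h2.mem_of_tendsto (hT t f) (Eventually.of_forall fun n =>
      hUK K h1 h2 h3 n (fun x hx => h4 _ (hc n) _ (hJG n x) x hx ?_) t t.2 f hf)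
    simp [smul_sub]

end HilleYosida

/-! ### Uniqueness, and semigroups with quasi-dissipative generator -/

section Uniqueness

/-- A `C₀`-semigroup is bounded near `0`, by the uniform boundedness principle. -/
theorem IsC0Semigroup.exists_norm_le {X : Type*} [NormedAddCommGroup X] [NormedSpace ℂ X]
    [CompleteSpace X] {S : ℝ≥0 → X →L[ℂ] X} (hS : IsC0Semigroup S) :
    ∃ δ : ℝ≥0, 0 < δ ∧ ∃ M : ℝ, ∀ t ≤ δ, ‖S t‖ ≤ M := by
  by_contra! hcon
  choose t ht hM using fun n : ℕ => hcon (1 / ((n : ℝ≥0) + 1)) (by positivity) n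
  have ht0 : Tendsto t atTop (𝓝 0) :=
    tendsto_of_tendsto_of_tendsto_of_le_of_le tendsto_const_nhds
      tendsto_one_div_add_atTop_nhds_zero_nat (fun _ => zero_le) ht
  obtain ⟨C, hC⟩ := banach_steinhaus (g := fun n => S (t n)) fun f => by
    obtain ⟨C, hC⟩ := (Metric.isBounded_range_of_tendsto _
      ((hS.tendsto_zero f).comp ht0)).exists_norm_le
    exact ⟨C, fun n => hC _ ⟨n, rfl⟩⟩
  obtain ⟨n, hn⟩ := exists_nat_gt C
  exact absurd (hC n) (not_le.2 (hn.trans (hM n)))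

theorem IsC0Semigroup.continuous {X : Type*} [NormedAddCommGroup X] [NormedSpace ℂ X]
    [CompleteSpace X] {S : ℝ≥0 → X →L[ℂ] X} (hS : IsC0Semigroup S) (f : X) :
    Continuous fun t => S t f := by
  obtain ⟨δ, hδ, M, hM⟩ := hS.exists_norm_le
  have hM0 : 0 ≤ M := (norm_nonneg _).trans (hM 0 zero_le)
  refine continuous_iff_continuousAt.2 fun t => ?_
  obtain ⟨C, hC⟩ : ∃ C : ℝ, ∀ r, r ≤ t → t ≤ r + δ → ‖S r‖ ≤ C := by
    refine ⟨M + ‖S (t - δ)‖ * M, fun r hr hrt => ?_⟩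
    rcases le_total t δ with h | h
    · exact (hM r (hr.trans h)).trans (le_add_of_nonneg_right (by positivity))
    · have h1 : r = (t - δ) + (r - (t - δ)) := by
        rw [add_tsub_cancel_of_le (tsub_le_iff_right.2 hrt)]
      rw [h1, hS.map_add]
      refine (ContinuousLinearMap.opNorm_comp_le _ _).trans ?_
      refine le_trans ?_ (le_add_of_nonneg_left hM0)
      gcongr
      refine hM _ ?_
      rw [tsub_le_iff_left, tsub_add_cancel_of_le h]
      exact hr
  have hC0 : 0 ≤ C := (norm_nonneg _).trans (hC t le_rfl (by simp))
  rw [ContinuousAt, tendsto_iff_norm_sub_tendsto_zero]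
  have hz : Tendsto (fun r : ℝ≥0 => C * ‖S (nndist r t) f - f‖) (𝓝 t) (𝓝 0) := by
    have h1 : Tendsto (fun r : ℝ≥0 => nndist r t) (𝓝 t) (𝓝 0) := by
      have : Continuous fun r : ℝ≥0 => nndist r t := by fun_prop
      simpa using this.tendsto t
    simpa using (tendsto_iff_norm_sub_tendsto_zero.1
      ((hS.tendsto_zero f).comp h1)).const_mul C
  have hev : ∀ᶠ r : ℝ≥0 in 𝓝 t, t ≤ r + δ := by
    have : Tendsto (fun r : ℝ≥0 => r + δ) (𝓝 t) (𝓝 (t + δ)) := by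
      exact (continuous_id.add continuous_const).tendsto t
    filter_upwards [this.eventually_const_lt (lt_add_of_pos_right t hδ)] with r hr using hr.le
  refine squeeze_zero' (Eventually.of_forall fun _ => norm_nonneg _) ?_ hz
  filter_upwards [hev] with r hr
  have key : ∀ a b : ℝ≥0, a ≤ b → S b f - S a f = S a (S (nndist b a) f - f) := by
    intro a b hab
    have h1 : b = a + nndist b a := by
      ext
      have : (a : ℝ) ≤ b := hab
      simp [NNReal.dist_eq, abs_of_nonneg (sub_nonneg.2 this)]
    rw [map_sub]
    congr 1
    conv_lhs => rw [h1, hS.map_add]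
    rfl
  rcases le_total r t with h | h
  · rw [← norm_neg, neg_sub, key r t h, nndist_comm]
    exact ContinuousLinearMap.le_of_opNorm_le _ (hC r h hr) _
  · rw [key t r h]
    exact ContinuousLinearMap.le_of_opNorm_le _ (hC t le_rfl (by simp)) _

theorem GeneratorGraph.map {X : Type*} [NormedAddCommGroup X] [NormedSpace ℂ X]
    {S : ℝ≥0 → X →L[ℂ] X} (hS : IsC0Semigroup S) {f h : X} (hf : GeneratorGraph S f h) (t : ℝ≥0) :
    GeneratorGraph S (S t f) (S t h) := by
  refine (((S t).continuous.tendsto h).comp hf).congr fun r => ?_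
  have h1 : S t (S r f) = S r (S t f) := by
    rw [← ContinuousLinearMap.comp_apply, ← ContinuousLinearMap.comp_apply, ← hS.map_add,
      ← hS.map_add, add_comm]
  simp [h1]

/-- An orbit starting in the domain of the generator is differentiable from the right. -/
theorem GeneratorGraph.hasDerivWithinAt {X : Type*} [NormedAddCommGroup X] [NormedSpace ℂ X]
    {S : ℝ≥0 → X →L[ℂ] X} (hS : IsC0Semigroup S) {f h : X} (hf : GeneratorGraph S f h) {t : ℝ}
    (ht : 0 ≤ t) :
    HasDerivWithinAt (fun s : ℝ => S s.toNNReal f) (S t.toNNReal h) (Set.Ici t) t := by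
  rw [← hasDerivWithinAt_Ioi_iff_Ici, hasDerivWithinAt_iff_tendsto_slope' (by simp)]
  have h1 : Tendsto (fun s : ℝ => (s - t).toNNReal) (𝓝[>] t) (𝓝[>] 0) := by
    refine tendsto_nhdsWithin_iff.2 ⟨?_, ?_⟩
    · have : Continuous fun s : ℝ => (s - t).toNNReal := by fun_prop
      have h2 := this.tendsto t
      rw [sub_self, Real.toNNReal_zero] at h2
      exact h2.mono_left nhdsWithin_le_nhds
    · filter_upwards [self_mem_nhdsWithin] with s hs
      exact Real.toNNReal_pos.2 (sub_pos.2 hs)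
  refine (((S t.toNNReal).continuous.tendsto h).comp (Tendsto.comp hf h1)).congr' ?_
  filter_upwards [self_mem_nhdsWithin] with s hs
  have hst : 0 ≤ s - t := (sub_pos.2 hs).le
  have h2 : s.toNNReal = t.toNNReal + (s - t).toNNReal := by
    rw [← Real.toNNReal_add ht hst]; congr 1; ring
  simp only [Function.comp_apply, slope, vsub_eq_sub, map_smul, map_sub, Real.coe_toNNReal _ hst,
    h2, hS.map_add, ContinuousLinearMap.comp_apply]
  rw [← Complex.ofReal_inv, Complex.coe_smul]

variable {X : Type*} [NormedAddCommGroup X] [InnerProductSpace ℂ X] [CompleteSpace X]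

/-- A `C₀`-semigroup on a Hilbert space with quasi-dissipative generator is determined by its
generator: the difference of two orbits with the same initial value satisfies a differential
inequality for its squared norm. -/
theorem IsC0Semigroup.eq_of_generatorGraph_iff {S T : ℝ≥0 → X →L[ℂ] X} (hS : IsC0Semigroup S)
    (hT : IsC0Semigroup T) (hST : ∀ f h, GeneratorGraph S f h ↔ GeneratorGraph T f h) {w : ℝ}
    (hdiss : ∀ f h, GeneratorGraph S f h → (inner ℂ f h).re ≤ w * ‖f‖ ^ 2)
    (hdense : Dense {f : X | ∃ h, GeneratorGraph S f h}) : S = T := by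
  funext t
  refine ContinuousLinearMap.ext_on (hdense.mono Submodule.subset_span) ?_
  rintro f ⟨h, hf⟩
  set u : ℝ → X := fun s => S s.toNNReal f - T s.toNNReal f with hu
  have hderiv : ∀ s, 0 ≤ s → HasDerivWithinAt u (S s.toNNReal h - T s.toNNReal h) (Set.Ici s) s :=
    fun s hs => (hf.hasDerivWithinAt hS hs).sub (((hST f h).1 hf).hasDerivWithinAt hT hs)
  have hgraph : ∀ s, GeneratorGraph S (u s) (S s.toNNReal h - T s.toNNReal h) := by
    intro s
    have h1 := (hf.map hS s.toNNReal).sub ((hST _ _).2 (((hST f h).1 hf).map hT s.toNNReal))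
    refine h1.congr fun r => ?_
    simp only [hu, map_sub, ← smul_sub]
    congr 1; abel
  have hcont : Continuous u := ((hS.continuous f).comp continuous_real_toNNReal).sub
    ((hT.continuous f).comp continuous_real_toNNReal)
  have hnsq : ∀ s, 0 ≤ s → HasDerivWithinAt (fun s => ‖u s‖ ^ 2)
      (2 * (inner ℂ (u s) (S s.toNNReal h - T s.toNNReal h)).re) (Set.Ici s) s := by
    intro s hs
    have h1 := Complex.reCLM.hasFDerivAt.comp_hasDerivWithinAt s
      ((hderiv s hs).inner ℂ (hderiv s hs))
    refine (h1.congr_of_eventuallyEq (Eventually.of_forall fun r => ?_) ?_).congr_deriv ?_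
    · exact (inner_self_eq_norm_sq (𝕜 := ℂ) (u r)).symm
    · exact (inner_self_eq_norm_sq (𝕜 := ℂ) (u s)).symm
    · rw [Complex.reCLM_apply, Complex.add_re, two_mul]
      congr 1
      exact inner_re_symm (𝕜 := ℂ) _ _
  have hphi := image_le_of_deriv_right_le_deriv_boundary
    (f := fun s => Real.exp (-(2 * w) * s) * ‖u s‖ ^ 2) (a := 0) (b := t)
    (f' := fun s => Real.exp (-(2 * w) * s) * (-(2 * w)) * ‖u s‖ ^ 2 +
      Real.exp (-(2 * w) * s) * (2 * (inner ℂ (u s) (S s.toNNReal h - T s.toNNReal h)).re))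
    (B := fun _ => 0) (B' := fun _ => 0)
    (by
      have h1 : Continuous fun s : ℝ => Real.exp (-(2 * w) * s) := by fun_prop
      exact (h1.mul (hcont.norm.pow 2)).continuousOn)
    (fun s hs => by
      have h1 : HasDerivAt (fun s : ℝ => Real.exp (-(2 * w) * s))
          (Real.exp (-(2 * w) * s) * (-(2 * w))) s := by
        simpa using ((hasDerivAt_id s).const_mul (-(2 * w))).exp
      exact h1.hasDerivWithinAt.mul (hnsq s hs.1))
    (by simp [hu, hS.map_zero, hT.map_zero])
    continuousOn_const (fun s _ => hasDerivWithinAt_const _ _ _)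
    (fun s hs => by
      have h3 : ∀ e r N : ℝ, 0 ≤ e → r ≤ w * N → e * (-(2 * w)) * N + e * (2 * r) ≤ 0 := by
        intro e r N he hr
        have := mul_nonneg he (sub_nonneg.2 hr)
        linarith
      exact h3 _ _ _ (Real.exp_pos _).le (hdiss _ _ (hgraph s)))
    (Set.right_mem_Icc.2 t.2)
  have h1 : ‖u t‖ ^ 2 ≤ 0 := nonpos_of_mul_nonpos_right hphi (Real.exp_pos _)
  have h2 : u t = 0 := by
    have : ‖u t‖ = 0 := by nlinarith [norm_nonneg (u t)]
    exact norm_eq_zero.1 this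
  have h3 : S t f - T t f = 0 := by simpa [hu] using h2
  exact sub_eq_zero.1 h3

/-- Generation theorem for a densely defined operator on a Hilbert space, given by its graph `G`,
such that `G - w` is dissipative and `l + w - G` is onto for all `l > 0`. The rescaled semigroup
preserves the closed convex sets containing `0` that are preserved by the resolvents. -/
theorem existsUnique_semigroup {G : Submodule ℂ (X × X)} {w : ℝ}
    (hdense : Dense {f : X | ∃ h, (f, h) ∈ G})
    (hdiss : ∀ p ∈ G, (inner ℂ p.1 p.2).re ≤ w * ‖p.1‖ ^ 2)
    (hsurj : ∀ l : ℝ, 0 < l → ∀ y, ∃ p ∈ G, ((l + w : ℝ) : ℂ) • p.1 - p.2 = y) :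
    (∃! S : ℝ≥0 → X →L[ℂ] X, IsC0Semigroup S ∧ ∀ f h, GeneratorGraph S f h ↔ (f, h) ∈ G) ∧
    ∀ S : ℝ≥0 → X →L[ℂ] X, (IsC0Semigroup S ∧ ∀ f h, GeneratorGraph S f h ↔ (f, h) ∈ G) →
      ∀ K : Set X, Convex ℝ K → IsClosed K → 0 ∈ K →
        (∀ l : ℝ, 0 < l → ∀ p ∈ G, ∀ y ∈ K,
          ((l + w : ℝ) : ℂ) • p.1 - p.2 = (l : ℂ) • y → p.1 ∈ K) →
        ∀ t : ℝ≥0, ∀ f ∈ K, (Real.exp (-w * t) : ℂ) • S t f ∈ K := by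
  -- the graph of the shifted operator
  let Φ : X × X →ₗ[ℂ] X × X :=
    (LinearMap.fst ℂ X X).prod (LinearMap.snd ℂ X X + (w : ℂ) • LinearMap.fst ℂ X X)
  have hΦ : ∀ p, p ∈ G.comap Φ ↔ (p.1, p.2 + (w : ℂ) • p.1) ∈ G := fun p => Iff.rfl
  have hmem : ∀ p ∈ G, (p.1, p.2 - (w : ℂ) • p.1) ∈ G.comap Φ := fun p hp => by
    rw [hΦ]; simpa using hp
  obtain ⟨T, hT, hTG, hTK⟩ := exists_contraction_semigroup (G := G.comap Φ)
    (hdense.mono fun f hf => by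
      obtain ⟨h, hf⟩ := hf
      exact ⟨_, hmem _ hf⟩)
    (fun p hp l hl => by
      rcases eq_or_ne p.1 0 with h0 | h0
      · rw [h0, norm_zero, mul_zero]; exact norm_nonneg _
      have h1 := hdiss _ ((hΦ p).1 hp)
      have h2 : (inner ℂ p.1 ((l : ℂ) • p.1 - p.2)).re ≤ ‖p.1‖ * ‖(l : ℂ) • p.1 - p.2‖ :=
        re_inner_le_norm (𝕜 := ℂ) _ _
      have h3 : (inner ℂ p.1 p.1).re = ‖p.1‖ ^ 2 := by
        rw [inner_self_eq_norm_sq_to_K]; norm_cast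
      simp only [inner_add_right, inner_sub_right, inner_smul_right, Complex.add_re,
        Complex.sub_re, Complex.re_ofReal_mul, h3] at h1 h2
      have h4 : 0 < ‖p.1‖ := norm_pos_iff.2 h0
      refine le_of_mul_le_mul_left ?_ h4
      nlinarith)
    (fun l hl y => by
      obtain ⟨p, hp, hpy⟩ := hsurj l hl y
      refine ⟨_, hmem p hp, ?_⟩
      rw [← hpy]
      push_cast
      module)
  have hexp : ∀ t : ℝ≥0, (Real.exp (-w * t) : ℂ) * (Real.exp (w * t) : ℂ) = 1 := fun t => by
    rw [← Complex.ofReal_mul, ← Real.exp_add]; simp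
  let S : ℝ≥0 → X →L[ℂ] X := fun t => (Real.exp (w * t) : ℂ) • T t
  have hS : IsC0Semigroup S := by
    refine ⟨by simp [S, hT.map_zero], fun s t => ?_, fun f => ?_⟩
    · simp only [S, hT.map_add, ContinuousLinearMap.smul_comp, ContinuousLinearMap.comp_smul,
        smul_smul]
      congr 1
      rw [← Complex.ofReal_mul, ← Real.exp_add]
      push_cast
      ring_nf
    · have h1 : Tendsto (fun t : ℝ≥0 => (Real.exp (w * t) : ℂ)) (𝓝 0) (𝓝 1) := by
        have : Continuous fun t : ℝ≥0 => (Real.exp (w * t) : ℂ) := by fun_prop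
        simpa using this.tendsto 0
      have h2 := h1.smul (hT.tendsto_zero f)
      rwa [one_smul] at h2
  have hSG : ∀ f h, GeneratorGraph S f h ↔ (f, h) ∈ G := by
    -- `(S t f - f) / t` is `(T t f - f) / t` up to a term tending to `w f`
    have h1 : ∀ f, Tendsto (fun t : ℝ≥0 => ((t : ℝ)⁻¹ : ℂ) • (S t f - T t f)) (𝓝[>] 0)
        (𝓝 ((w : ℂ) • f)) := by
      intro f
      have h2 : HasDerivAt (fun t : ℝ => Real.exp (w * t)) w 0 := by
        simpa using ((hasDerivAt_id (0 : ℝ)).const_mul w).exp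
      have h3 : Tendsto (fun t : ℝ≥0 => (t : ℝ)) (𝓝[>] 0) (𝓝[≠] 0) := by
        refine tendsto_nhdsWithin_iff.2 ⟨?_, ?_⟩
        · exact (NNReal.continuous_coe.tendsto' 0 0 rfl).mono_left nhdsWithin_le_nhds
        · filter_upwards [self_mem_nhdsWithin] with t ht
          have : (0 : ℝ) < t := ht
          exact this.ne'
      have h4 := (hasDerivAt_iff_tendsto_slope.1 h2).comp h3
      have h5 := ((Complex.continuous_ofReal.tendsto _).comp h4).smul
        ((hT.tendsto_zero f).mono_left nhdsWithin_le_nhds)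
      refine h5.congr fun t => ?_
      simp only [Function.comp_apply, slope, sub_zero, mul_zero, Real.exp_zero, vsub_eq_sub,
        smul_eq_mul, S, _root_.smul_apply]
      push_cast
      module
    intro f h
    have h2 : GeneratorGraph S f h ↔ GeneratorGraph T f (h - (w : ℂ) • f) := by
      constructor
      · intro h3
        refine (Tendsto.sub h3 (h1 f)).congr fun t => ?_
        rw [← smul_sub]; congr 1; abel
      · intro h3
        have := Tendsto.add h3 (h1 f)
        rw [sub_add_cancel] at this
        refine this.congr fun t => ?_
        rw [← smul_add]; congr 1; abel
    rw [h2, hTG, hΦ, sub_add_cancel]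
  have huniq : ∀ S' : ℝ≥0 → X →L[ℂ] X,
      (IsC0Semigroup S' ∧ ∀ f h, GeneratorGraph S' f h ↔ (f, h) ∈ G) → S' = S := by
    rintro S' ⟨h1, h2⟩
    refine h1.eq_of_generatorGraph_iff hS (fun f h => (h2 f h).trans (hSG f h).symm)
      (w := w) (fun f h hf => hdiss _ ((h2 f h).1 hf)) ?_
    simpa only [h2] using hdense
  refine ⟨⟨S, ⟨hS, hSG⟩, huniq⟩, fun S' hS' K h1 h2 h3 h4 t f hf => ?_⟩
  rw [huniq S' hS']
  have h5 := hTK K h1 h2 h3 (fun l hl p hp y hy hpy => by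
    refine h4 l hl (p.1, p.2 + (w : ℂ) • p.1) ((hΦ p).1 hp) y hy ?_
    rw [← hpy]
    push_cast
    module) t f hf
  simpa only [S, _root_.smul_apply, smul_smul, hexp, one_smul] using h5

end Uniqueness

/-! ### Weak partial derivatives -/

section WeakPartial

variable {d : ℕ} {G G' : Type*} [NormedAddCommGroup G] [NormedSpace ℝ G]
  [NormedAddCommGroup G'] [NormedSpace ℝ G'] {k : Fin d} {u v u' v' : Dom d → G}

/-- The classical partial derivative of a test function. -/
noncomputable def dpart (k : Fin d) (φ : Dom d → ℝ) (x : Dom d) : ℝ :=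
  fderiv ℝ φ x (EuclideanSpace.single k 1)

theorem contDiff_dpart {φ : Dom d → ℝ} (hφ : ContDiff ℝ ∞ φ) : ContDiff ℝ ∞ (dpart k φ) :=
  (hφ.fderiv_right (m := ∞) (by simp)).clm_apply contDiff_const

theorem hasCompactSupport_dpart {φ : Dom d → ℝ} (hφ : HasCompactSupport φ) :
    HasCompactSupport (dpart k φ) :=
  hφ.fderiv_apply (𝕜 := ℝ) _

theorem IsWeakPartial.congr (h : IsWeakPartial k u v) (hu : u =ᵐ[volume] u')
    (hv : v =ᵐ[volume] v') : IsWeakPartial k u' v' := by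
  refine ⟨h.1.congr hu, h.2.1.congr hv, fun φ h1 h2 => ?_⟩
  have e1 : ∫ x, dpart k φ x • u x = ∫ x, dpart k φ x • u' x := by
    refine integral_congr_ae ?_
    filter_upwards [hu] with x hx using by rw [hx]
  have e2 : ∫ x, φ x • v x = ∫ x, φ x • v' x := by
    refine integral_congr_ae ?_
    filter_upwards [hv] with x hx using by rw [hx]
  rw [← e2]
  exact e1.symm.trans (h.2.2 φ h1 h2)

theorem IsWeakPartial.ae_unique [CompleteSpace G] (h : IsWeakPartial k u v)
    (h' : IsWeakPartial k u v') : v =ᵐ[volume] v' := by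
  refine ae_eq_of_integral_contDiff_smul_eq h.2.1 h'.2.1 fun φ h1 h2 => ?_
  have := (h.2.2 φ h1 h2).symm.trans (h'.2.2 φ h1 h2)
  exact neg_inj.1 this

theorem IsWeakPartial.weakPartial_ae_eq [CompleteSpace G] (h : IsWeakPartial k u v) :
    weakPartial k u =ᵐ[volume] v :=
  (isWeakPartial_weakPartial h).ae_unique h

theorem IsWeakPartial.clm_comp (L : G →L[ℝ] G') [CompleteSpace G] [CompleteSpace G']
    (h : IsWeakPartial k u v) :
    IsWeakPartial k (fun x => L (u x)) (fun x => L (v x)) := by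
  refine ⟨fun x => ?_, fun x => ?_, fun φ h1 h2 => ?_⟩
  · obtain ⟨s, hs, hi⟩ := h.1 x
    exact ⟨s, hs, L.integrable_comp hi⟩
  · obtain ⟨s, hs, hi⟩ := h.2.1 x
    exact ⟨s, hs, L.integrable_comp hi⟩
  · have h3 := h.1.integrable_smul_left_of_hasCompactSupport
      (contDiff_dpart (k := k) h1).continuous (hasCompactSupport_dpart h2)
    have h4 := h.2.1.integrable_smul_left_of_hasCompactSupport h1.continuous h2
    have := congrArg L (h.2.2 φ h1 h2)
    rw [map_neg, ← L.integral_comp_comm h4] at this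
    have h5 := L.integral_comp_comm h3
    simp only [map_smul] at this h5
    exact h5.trans this

theorem IsWeakPartial.add (h : IsWeakPartial k u v) (h' : IsWeakPartial k u' v') :
    IsWeakPartial k (fun x => u x + u' x) (fun x => v x + v' x) := by
  refine ⟨h.1.add h'.1, h.2.1.add h'.2.1, fun φ h1 h2 => ?_⟩
  have c1 := (contDiff_dpart (k := k) h1).continuous
  have c2 := hasCompactSupport_dpart (k := k) h2
  have i1 := h.1.integrable_smul_left_of_hasCompactSupport c1 c2
  have i2 := h'.1.integrable_smul_left_of_hasCompactSupport c1 c2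
  have i3 := h.2.1.integrable_smul_left_of_hasCompactSupport h1.continuous h2
  have i4 := h'.2.1.integrable_smul_left_of_hasCompactSupport h1.continuous h2
  have e1 := h.2.2 φ h1 h2
  have e2 := h'.2.2 φ h1 h2
  simp only [smul_add]
  rw [integral_add i3 i4, neg_add, ← e1, ← e2]
  exact integral_add i1 i2

theorem IsWeakPartial.zero : IsWeakPartial k (fun _ => (0 : G)) (fun _ => 0) :=
  ⟨locallyIntegrable_zero, locallyIntegrable_zero, fun φ _ _ => by simp⟩

theorem dpart_mul {φ ψ : Dom d → ℝ} (hφ : ContDiff ℝ ∞ φ) (hψ : ContDiff ℝ ∞ ψ) (x : Dom d) :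
    dpart k (fun y => φ y * ψ y) x = dpart k φ x * ψ x + φ x * dpart k ψ x := by
  have h1 := (hφ.differentiable (by simp)).differentiableAt (x := x)
  have h2 := (hψ.differentiable (by simp)).differentiableAt (x := x)
  simp only [dpart]
  rw [fderiv_fun_mul h1 h2]
  simp only [_root_.add_apply, _root_.smul_apply, smul_eq_mul]
  ring

/-- Product rule for a smooth function with compact support. -/
theorem IsWeakPartial.smooth_smul (h : IsWeakPartial k u v) {φ : Dom d → ℝ}
    (hφ : ContDiff ℝ ∞ φ) (hφc : HasCompactSupport φ) :
    IsWeakPartial k (fun x => φ x • u x) (fun x => dpart k φ x • u x + φ x • v x) := by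
  have d1 := contDiff_dpart (k := k) hφ
  have d2 := hasCompactSupport_dpart (k := k) hφc
  refine ⟨(h.1.integrable_smul_left_of_hasCompactSupport hφ.continuous hφc).locallyIntegrable,
    ((h.1.integrable_smul_left_of_hasCompactSupport d1.continuous d2).add
      (h.2.1.integrable_smul_left_of_hasCompactSupport hφ.continuous hφc)).locallyIntegrable,
    fun ψ h1 h2 => ?_⟩
  have e := h.2.2 (fun y => ψ y * φ y) (h1.mul hφ) h2.mul_right
  have d3 := contDiff_dpart (k := k) h1
  have d4 := hasCompactSupport_dpart (k := k) h2
  have i1 : Integrable fun x => (dpart k ψ x * φ x) • u x :=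
    h.1.integrable_smul_left_of_hasCompactSupport (d3.mul hφ).continuous d4.mul_right
  have i2 : Integrable fun x => (ψ x * dpart k φ x) • u x :=
    h.1.integrable_smul_left_of_hasCompactSupport (h1.mul d1).continuous h2.mul_right
  have i3 : Integrable fun x => (ψ x * φ x) • v x :=
    h.2.1.integrable_smul_left_of_hasCompactSupport (h1.mul hφ).continuous h2.mul_right
  have e2 : ∫ x, dpart k (fun y => ψ y * φ y) x • u x =
      (∫ x, (dpart k ψ x * φ x) • u x) + ∫ x, (ψ x * dpart k φ x) • u x := by
    rw [← integral_add i1 i2]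
    refine integral_congr_ae (Eventually.of_forall fun x => ?_)
    simp only [dpart_mul h1 hφ, add_smul]
  have e3 : ∫ x, ψ x • (dpart k φ x • u x + φ x • v x) =
      (∫ x, (ψ x * dpart k φ x) • u x) + ∫ x, (ψ x * φ x) • v x := by
    rw [← integral_add i2 i3]
    refine integral_congr_ae (Eventually.of_forall fun x => ?_)
    simp only [smul_add, smul_smul]
  have e4 : ∫ x, (fderiv ℝ ψ x (EuclideanSpace.single k 1)) • φ x • u x =
      ∫ x, (dpart k ψ x * φ x) • u x := by
    refine integral_congr_ae (Eventually.of_forall fun x => ?_)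
    simp only [smul_smul, dpart]
  rw [e3, e4]
  have e5 := e2.symm.trans e
  rw [neg_add, ← e5]
  abel

/-- A smooth function with compact support has its classical partial derivatives as weak ones. -/
theorem isWeakPartial_of_contDiff {φ : Dom d → ℝ} (hφ : ContDiff ℝ ∞ φ)
    (hφc : HasCompactSupport φ) : IsWeakPartial k φ (dpart k φ) := by
  have d1 := contDiff_dpart (k := k) hφ
  have d2 := hasCompactSupport_dpart (k := k) hφc
  refine ⟨hφ.continuous.locallyIntegrable, d1.continuous.locallyIntegrable, fun ψ h1 h2 => ?_⟩
  have d3 := contDiff_dpart (k := k) h1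
  have d4 := hasCompactSupport_dpart (k := k) h2
  have := integral_mul_fderiv_eq_neg_fderiv_mul_of_integrable (μ := volume)
    (f := ψ) (g := φ) (v := EuclideanSpace.single k 1)
    ((d3.mul hφ).continuous.integrable_of_hasCompactSupport d4.mul_right)
    ((h1.mul d1).continuous.integrable_of_hasCompactSupport h2.mul_right)
    ((h1.mul hφ).continuous.integrable_of_hasCompactSupport h2.mul_right)
    (fun x _ => (h1.differentiable (by simp)).differentiableAt)
    (fun x _ => (hφ.differentiable (by simp)).differentiableAt)
  simp only [smul_eq_mul]
  exact (neg_eq_iff_eq_neg.2 this).symm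

end WeakPartial

/-! ### Difference quotients and integration by parts -/

section DifferenceQuotients

variable {d : ℕ} {k : Fin d}

theorem norm_single_one : ‖(EuclideanSpace.single k (1 : ℝ) : Dom d)‖ = 1 := by simp

theorem hasDerivAt_comp_line {φ : Dom d → ℝ} (hφ : ContDiff ℝ ∞ φ) (x : Dom d) (s : ℝ) :
    HasDerivAt (fun s : ℝ => φ (x - s • EuclideanSpace.single k 1))
      (-dpart k φ (x - s • EuclideanSpace.single k 1)) s := by
  have h1 := ((hφ.differentiable (by simp)).differentiableAt
    (x := x - s • EuclideanSpace.single k 1)).hasFDerivAt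
  have h2 : HasDerivAt (fun s : ℝ => x - s • (EuclideanSpace.single k 1 : Dom d))
      (-(EuclideanSpace.single k 1 : Dom d)) s := by
    simpa using ((hasDerivAt_id s).smul_const (EuclideanSpace.single k 1 : Dom d)).const_sub x
  have := h1.comp_hasDerivAt s h2
  rw [map_neg] at this
  exact this

theorem contDiff_translate {φ : Dom d → ℝ} (hφ : ContDiff ℝ ∞ φ) (e : Dom d) :
    ContDiff ℝ ∞ fun x => φ (x - e) := hφ.comp (contDiff_id.sub contDiff_const)

theorem hasCompactSupport_translate {φ : Dom d → ℝ} (hφ : HasCompactSupport φ) (e : Dom d) :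
    HasCompactSupport fun x => φ (x - e) :=
  hφ.comp_homeomorph (Homeomorph.subRight e)

theorem dpart_translate (φ : Dom d → ℝ) (e x : Dom d) :
    dpart k (fun x => φ (x - e)) x = dpart k φ (x - e) := by
  simp only [dpart]
  rw [fderiv_comp_sub]

/-- The pairing of a translated test function with a locally integrable function is differentiable
in the translation parameter. -/
theorem hasDerivAt_integral_translate {u : Dom d → ℂ} (h : LocallyIntegrable u volume)
    {φ : Dom d → ℝ} (hφ : ContDiff ℝ ∞ φ) (hφc : HasCompactSupport φ) (s₀ : ℝ) :
    HasDerivAt (fun s : ℝ => ∫ x, φ (x - s • EuclideanSpace.single k 1) • u x)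
      (∫ x, (-dpart k φ (x - s₀ • EuclideanSpace.single k 1)) • u x) s₀ := by
  set e : Dom d := EuclideanSpace.single k 1 with he
  have hen : ‖e‖ = 1 := norm_single_one
  have d1 := contDiff_dpart (k := k) hφ
  have d2 := hasCompactSupport_dpart (k := k) hφc
  obtain ⟨M, hM⟩ := d2.exists_bound_of_continuous d1.continuous
  obtain ⟨R, hR⟩ := d2.isCompact.isBounded.subset_closedBall (0 : Dom d)
  set B : Set (Dom d) := Metric.closedBall 0 (R + |s₀| + 1)
  have hint : ∀ s : ℝ, Integrable fun x => φ (x - s • e) • u x := fun s => by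
    have c1 : ContDiff ℝ ∞ fun x => φ (x - s • e) := contDiff_translate hφ (s • e)
    have c2 : HasCompactSupport fun x => φ (x - s • e) := hasCompactSupport_translate hφc (s • e)
    exact h.integrable_smul_left_of_hasCompactSupport c1.continuous c2
  have hint' : ∀ s : ℝ, Integrable fun x => (-dpart k φ (x - s • e)) • u x := fun s => by
    have c1 : ContDiff ℝ ∞ fun x => -dpart k φ (x - s • e) := (contDiff_translate d1 (s • e)).neg
    have c2 : HasCompactSupport fun x => -dpart k φ (x - s • e) :=
      (hasCompactSupport_translate d2 (s • e)).neg
    exact h.integrable_smul_left_of_hasCompactSupport c1.continuous c2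
  have hbound : Integrable (B.indicator fun x => M * ‖u x‖) := by
    rw [integrable_indicator_iff Metric.isClosed_closedBall.measurableSet]
    exact (h.integrableOn_isCompact (isCompact_closedBall _ _)).norm.const_mul M
  have hle : ∀ᵐ x : Dom d, ∀ s ∈ Metric.ball s₀ 1,
      ‖(-dpart k φ (x - s • e)) • u x‖ ≤ B.indicator (fun x => M * ‖u x‖) x := by
    refine Eventually.of_forall fun x s hs => ?_
    by_cases hx : x ∈ B
    · rw [Set.indicator_of_mem hx, norm_smul, norm_neg]
      gcongr
      exact hM _
    · rw [Set.indicator_of_notMem hx]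
      have h0 : dpart k φ (x - s • e) = 0 := by
        refine image_eq_zero_of_notMem_tsupport fun hmem => hx ?_
        have h1 := hR hmem
        simp only [B, Metric.mem_closedBall, dist_zero_right, Metric.mem_ball,
          Real.dist_eq] at h1 hs ⊢
        have h2 : ‖x‖ ≤ ‖x - s • e‖ + ‖s • e‖ := by
          simpa using norm_add_le (x - s • e) (s • e)
        rw [norm_smul, hen, mul_one, Real.norm_eq_abs] at h2
        have h3 : |s| ≤ |s - s₀| + |s₀| := by simpa using abs_add_le (s - s₀) s₀
        linarith
      rw [h0, neg_zero, zero_smul, norm_zero]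
  have hder : ∀ᵐ x : Dom d, ∀ s ∈ Metric.ball s₀ 1,
      HasDerivAt (fun s : ℝ => φ (x - s • e) • u x) ((-dpart k φ (x - s • e)) • u x) s :=
    Eventually.of_forall fun x s _ => (hasDerivAt_comp_line hφ x s).smul_const (u x)
  exact (hasDerivAt_integral_of_dominated_loc_of_deriv_le (μ := volume) (𝕜 := ℝ)
    (F := fun s x => φ (x - s • e) • u x) (F' := fun s x => (-dpart k φ (x - s • e)) • u x)
    (Metric.ball_mem_nhds s₀ one_pos)
    (Eventually.of_forall fun s => (hint s).aestronglyMeasurable) (hint s₀)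
    (hint' s₀).aestronglyMeasurable hle hbound hder).2

theorem IsWeakPartial.hasDerivAt_translate {u v : Dom d → ℂ} (h : IsWeakPartial k u v)
    {φ : Dom d → ℝ} (hφ : ContDiff ℝ ∞ φ) (hφc : HasCompactSupport φ) (s₀ : ℝ) :
    HasDerivAt (fun s : ℝ => ∫ x, φ (x - s • EuclideanSpace.single k 1) • u x)
      (∫ x, φ (x - s₀ • EuclideanSpace.single k 1) • v x) s₀ := by
  set e : Dom d := EuclideanSpace.single k 1
  refine (hasDerivAt_integral_translate h.1 hφ hφc s₀).congr_deriv ?_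
  have := h.2.2 _ (contDiff_translate hφ (s₀ • e)) (hasCompactSupport_translate hφc (s₀ • e))
  have h2 : ∫ x, dpart k φ (x - s₀ • e) • u x = -∫ x, φ (x - s₀ • e) • v x := by
    rw [← this]
    refine integral_congr_ae (Eventually.of_forall fun x => ?_)
    simp only [← dpart_translate (k := k) φ (s₀ • e) x]
    rfl
  simp only [neg_smul, integral_neg]
  exact neg_eq_iff_eq_neg.2 h2

/-- Translation by `s e_k`, as an isometry of `L²(ℝ^d, ℂ)`. -/
noncomputable def translate (k : Fin d) (s : ℝ) :
    Lp ℂ 2 (volume : Measure (Dom d)) →ₗᵢ[ℂ] Lp ℂ 2 (volume : Measure (Dom d)) :=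
  Lp.compMeasurePreservingₗᵢ ℂ (fun x => x + s • EuclideanSpace.single k 1)
    (measurePreserving_add_right volume _)

theorem translate_coeFn (s : ℝ) (f : Lp ℂ 2 (volume : Measure (Dom d))) :
    translate k s f =ᵐ[volume] fun x => f (x + s • EuclideanSpace.single k 1) :=
  Lp.coeFn_compMeasurePreserving f (measurePreserving_add_right volume _)

theorem continuous_translate (f : Lp ℂ 2 (volume : Measure (Dom d))) :
    Continuous fun s => translate k s f := by
  let g : ℝ → C(Dom d, Dom d) := fun s => ⟨fun x => x + s • EuclideanSpace.single k 1, by fun_prop⟩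
  have hg : Continuous g := ContinuousMap.continuous_of_continuous_uncurry _ (by
    change Continuous fun p : ℝ × Dom d => p.2 + p.1 • (EuclideanSpace.single k 1 : Dom d)
    fun_prop)
  exact (continuous_const (y := f)).compMeasurePreservingLp hg
    (fun s => measurePreserving_add_right volume _) (by simp)

theorem translate_zero (f : Lp ℂ 2 (volume : Measure (Dom d))) : translate k 0 f = f := by
  refine Lp.ext ?_
  filter_upwards [translate_coeFn (k := k) 0 f] with x hx
  rw [hx]; simp

/-- A subspace of `L²` that contains the real test functions is dense. -/
theorem dense_of_test_mem {D : Submodule ℂ (Lp ℂ 2 (volume : Measure (Dom d)))}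
    (hD : ∀ (φ : Dom d → ℝ), ContDiff ℝ ∞ φ → HasCompactSupport φ →
      ∀ ψ : Lp ℂ 2 (volume : Measure (Dom d)), (ψ =ᵐ[volume] fun x => (φ x : ℂ)) → ψ ∈ D) :
    Dense (D : Set (Lp ℂ 2 (volume : Measure (Dom d)))) := by
  rw [Submodule.dense_iff_topologicalClosure_eq_top, Submodule.topologicalClosure_eq_top_iff,
    Submodule.eq_bot_iff]
  intro w hw
  have hw2 : ∀ᵐ x, w x = 0 := by
    refine ae_eq_zero_of_integral_contDiff_smul_eq_zero
      ((Lp.memLp w).locallyIntegrable (by norm_num)) fun φ h1 h2 => ?_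
    have hmem : MemLp (fun x => (φ x : ℂ)) 2 (volume : Measure (Dom d)) :=
      (Complex.continuous_ofReal.comp h1.continuous).memLp_of_hasCompactSupport
        (h2.comp_left (g := fun r : ℝ => (r : ℂ)) (by simp))
    have h3 := (Submodule.mem_orthogonal D w).1 hw _ (hD φ h1 h2 (hmem.toLp _) hmem.coeFn_toLp)
    rw [L2.inner_def] at h3
    rw [← h3]
    refine integral_congr_ae ?_
    filter_upwards [hmem.coeFn_toLp] with x hx
    rw [hx]
    simp [mul_comm]
  exact (Lp.eq_zero_iff_ae_eq_zero).2 hw2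

/-- If `v = ∂_k u` weakly and both functions are square integrable, then the difference quotients
of `u` converge to `v` in `L²`: tested against smooth functions, `s ↦ u(· + s e_k)` has derivative
`v(· + s e_k)`, and translations are strongly continuous. -/
theorem IsWeakPartial.tendsto_translate {u v : Lp ℂ 2 (volume : Measure (Dom d))}
    (h : IsWeakPartial k u v) :
    Tendsto (fun s : ℝ => ((s : ℂ)⁻¹) • (translate k s u - u)) (𝓝[≠] 0) (𝓝 v) := by
  let D : Submodule ℂ (Lp ℂ 2 (volume : Measure (Dom d))) :=
    { carrier := {ψ | ∀ s : ℝ, HasDerivAt (fun s => inner ℂ ψ (translate k s u))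
        (inner ℂ ψ (translate k s v)) s}
      add_mem' := fun {a b} ha hb s => by
        simp only [inner_add_left]
        exact (ha s).add (hb s)
      zero_mem' := fun s => by
        simp only [inner_zero_left]
        exact hasDerivAt_const _ _
      smul_mem' := fun c a ha s => by
        simp only [inner_smul_left]
        exact (ha s).const_mul _ }
  have hpair : ∀ (φ : Dom d → ℝ) (ψ f : Lp ℂ 2 (volume : Measure (Dom d))),
      (ψ =ᵐ[volume] fun x => (φ x : ℂ)) → ∀ s : ℝ, inner ℂ ψ (translate k s f) =
        ∫ x, φ (x - s • EuclideanSpace.single k 1) • f x := by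
    intro φ ψ f hψ s
    rw [L2.inner_def, ← integral_add_right_eq_self
      (fun x => φ (x - s • EuclideanSpace.single k 1) • f x) (s • (EuclideanSpace.single k 1 : Dom d))]
    refine integral_congr_ae ?_
    filter_upwards [hψ, translate_coeFn (k := k) s f] with x h1 h2
    rw [h1, h2]
    simp [mul_comm]
  have hD : Dense (D : Set (Lp ℂ 2 (volume : Measure (Dom d)))) := by
    refine dense_of_test_mem fun φ h1 h2 ψ hψ s => ?_
    simp only [hpair φ ψ _ hψ]
    exact h.hasDerivAt_translate h1 h2 s
  rw [Metric.tendsto_nhdsWithin_nhds]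
  intro ε hε
  obtain ⟨δ, hδ, hδ'⟩ := Metric.continuous_iff.1 (continuous_translate (k := k) v) 0 (ε / 2)
    (by positivity)
  simp only [translate_zero] at hδ'
  refine ⟨δ, hδ, fun {s} hs0 hs => ?_⟩
  have hs0' : s ≠ 0 := hs0
  have hest : ∀ ψ, ‖(inner ℂ ψ (translate k s u - u - (s : ℂ) • v) : ℂ)‖ ≤
      ε / 2 * |s| * ‖ψ‖ := by
    intro ψ
    refine hD.induction (P := fun ψ => ‖(inner ℂ ψ (translate k s u - u - (s : ℂ) • v) : ℂ)‖ ≤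
      ε / 2 * |s| * ‖ψ‖) ?_ (isClosed_le (by fun_prop) (by fun_prop)) ψ
    intro ψ hψ
    have h1 := Convex.norm_image_sub_le_of_norm_hasDerivWithin_le
      (f := fun r : ℝ => inner ℂ ψ (translate k r u) - (r : ℂ) * inner ℂ ψ v)
      (f' := fun r : ℝ => inner ℂ ψ (translate k r v) - 1 * inner ℂ ψ v)
      (s := Metric.ball 0 δ) (x := 0) (y := s) (C := ‖ψ‖ * (ε / 2))
      (fun r _ => ((hψ r).sub
        ((Complex.ofRealCLM.hasDerivAt (x := r)).mul_const _)).hasDerivWithinAt)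
      (fun r hr => by
        rw [one_mul, ← inner_sub_right]
        refine (norm_inner_le_norm _ _).trans ?_
        gcongr
        rw [← dist_eq_norm]
        exact (hδ' r hr).le)
      (convex_ball _ _) (Metric.mem_ball_self hδ) hs
    simp only [translate_zero, Complex.ofReal_zero, zero_mul, sub_zero, Real.norm_eq_abs] at h1
    rw [inner_sub_right, inner_sub_right, inner_smul_right, sub_right_comm]
    linarith
  have h2 : ‖translate k s u - u - (s : ℂ) • v‖ ≤ ε / 2 * |s| := by
    have h3 := hest (translate k s u - u - (s : ℂ) • v)
    rw [inner_self_eq_norm_sq_to_K] at h3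
    set N := ‖translate k s u - u - (s : ℂ) • v‖
    have h4 : N ^ 2 ≤ ε / 2 * |s| * N := by
      simpa using h3
    have h5 : 0 ≤ N := norm_nonneg _
    by_contra! hlt
    have : 0 < N := lt_of_le_of_lt (by positivity) hlt
    nlinarith
  have hsc : (s : ℂ) ≠ 0 := by exact_mod_cast hs0'
  have h6 : (s : ℂ)⁻¹ • (translate k s u - u) - v =
      (s : ℂ)⁻¹ • (translate k s u - u - (s : ℂ) • v) := by
    rw [smul_sub _ (translate k s u - u), smul_smul, inv_mul_cancel₀ hsc, one_smul]
  have hs1 : 0 < |s| := abs_pos.2 hs0'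
  rw [dist_eq_norm, h6, norm_smul, norm_inv, Complex.norm_real, Real.norm_eq_abs]
  calc _ ≤ |s|⁻¹ * (ε / 2 * |s|) := by gcongr
    _ = ε / 2 := by field_simp
    _ < ε := by linarith

theorem inner_translate_left (f g : Lp ℂ 2 (volume : Measure (Dom d))) (s : ℝ) :
    inner ℂ (translate k s f) g = inner ℂ f (translate k (-s) g) := by
  rw [L2.inner_def, L2.inner_def,
    ← integral_add_right_eq_self _ ((-s) • (EuclideanSpace.single k 1 : Dom d))]
  refine integral_congr_ae ?_
  have h1 := (measurePreserving_add_right (volume : Measure (Dom d))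
    ((-s) • EuclideanSpace.single k 1)).quasiMeasurePreserving.ae (translate_coeFn (k := k) s f)
  filter_upwards [translate_coeFn (k := k) (-s) g, h1] with x h2 h3
  rw [h2, h3]
  simp

/-- Integration by parts in `H¹`. -/
theorem IsWeakPartial.inner_eq_neg {u v f g : Lp ℂ 2 (volume : Measure (Dom d))}
    (h : IsWeakPartial k u v) (h' : IsWeakPartial k f g) :
    inner ℂ v f = -inner ℂ u g := by
  have h1 : Tendsto (fun s : ℝ => inner ℂ (((s : ℂ)⁻¹) • (translate k s u - u)) f) (𝓝[≠] 0)
      (𝓝 (inner ℂ v f)) := (h.tendsto_translate).inner tendsto_const_nhds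
  have hneg : Tendsto (fun s : ℝ => -s) (𝓝[≠] 0) (𝓝[≠] 0) := by
    refine tendsto_nhdsWithin_iff.2 ⟨?_, ?_⟩
    · exact (continuous_neg.tendsto' (0 : ℝ) 0 (by simp)).mono_left nhdsWithin_le_nhds
    · filter_upwards [self_mem_nhdsWithin] with s hs
      simpa using hs
  have h2 : Tendsto (fun s : ℝ => -inner ℂ u ((((-s : ℝ) : ℂ)⁻¹) • (translate k (-s) f - f)))
      (𝓝[≠] 0) (𝓝 (-inner ℂ u g)) :=
    (tendsto_const_nhds.inner (h'.tendsto_translate.comp hneg)).neg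
  refine tendsto_nhds_unique h1 (h2.congr fun s => ?_)
  rw [inner_smul_left, inner_smul_right, inner_sub_left, inner_sub_right, inner_translate_left]
  simp only [map_inv₀, Complex.conj_ofReal, Complex.ofReal_neg, inv_neg]
  ring

theorem IsWeakPartial.integral_conj_mul_eq_neg {u v f g : Dom d → ℂ} (h : IsWeakPartial k u v)
    (h' : IsWeakPartial k f g) (hu : MemLp u 2 volume) (hv : MemLp v 2 volume)
    (hf : MemLp f 2 volume) (hg : MemLp g 2 volume) :
    ∫ x, conj (v x) * f x = -∫ x, conj (u x) * g x := by
  have h1 := (h.congr hu.coeFn_toLp.symm hv.coeFn_toLp.symm).inner_eq_neg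
    (h'.congr hf.coeFn_toLp.symm hg.coeFn_toLp.symm)
  rw [L2.inner_def, L2.inner_def] at h1
  rw [integral_congr_ae (g := fun x => inner ℂ (hv.toLp v x) (hf.toLp f x)), h1,
    integral_congr_ae (g := fun x => conj (u x) * g x)]
  · filter_upwards [hu.coeFn_toLp, hg.coeFn_toLp] with x h1 h2
    rw [h1, h2, RCLike.inner_apply']
  · filter_upwards [hv.coeFn_toLp, hf.coeFn_toLp] with x h1 h2
    rw [h1, h2, RCLike.inner_apply']

end DifferenceQuotients

/-! ### Product rule and chain rule -/

section ChainRule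

variable {d : ℕ} {k : Fin d}

/-- Product rule for a real function `b` that is bounded together with its weak derivative. -/
theorem IsWeakPartial.bounded_smul {b b' : Dom d → ℝ} {g g' : Dom d → ℂ}
    (hb : IsWeakPartial k b b') (hb2 : MemLp b 2 volume) (hb2' : MemLp b' 2 volume)
    (hbi : MemLp b ∞ volume) (hbi' : MemLp b' ∞ volume)
    (hg : IsWeakPartial k g g') (hg2 : MemLp g 2 volume) (hg2' : MemLp g' 2 volume) :
    IsWeakPartial k (fun x => b x • g x) (fun x => b' x • g x + b x • g' x) ∧
      MemLp (fun x => b x • g x) 2 volume ∧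
      MemLp (fun x => b' x • g x + b x • g' x) 2 volume := by
  have m1 : MemLp (fun x => b x • g x) 2 volume := hg2.smul (p := ∞) (q := 2) (r := 2) hbi
  have m2 : MemLp (fun x => b' x • g x) 2 volume := hg2.smul (p := ∞) (q := 2) (r := 2) hbi'
  have m3 : MemLp (fun x => b x • g' x) 2 volume := hg2'.smul (p := ∞) (q := 2) (r := 2) hbi
  have l1 := m1.locallyIntegrable (by norm_num)
  have l2 := m2.locallyIntegrable (by norm_num)
  have l3 := m3.locallyIntegrable (by norm_num)
  refine ⟨⟨l1, l2.add l3, fun φ h1 h2 => ?_⟩, m1, m2.add m3⟩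
  have d1 := contDiff_dpart (k := k) h1
  have d2 := hasCompactSupport_dpart (k := k) h2
  have hφi : MemLp φ ∞ volume := h1.continuous.memLp_of_hasCompactSupport h2
  have hφi' : MemLp (dpart k φ) ∞ volume := d1.continuous.memLp_of_hasCompactSupport d2
  have n1 : MemLp (fun x => φ x • g x) 2 volume := hg2.smul (p := ∞) (q := 2) (r := 2) hφi
  have n2 : MemLp (fun x => dpart k φ x • g x) 2 volume :=
    hg2.smul (p := ∞) (q := 2) (r := 2) hφi'
  have n3 : MemLp (fun x => φ x • g' x) 2 volume := hg2'.smul (p := ∞) (q := 2) (r := 2) hφi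
  have key := (hb.clm_comp Complex.ofRealCLM).integral_conj_mul_eq_neg
    (hg.smooth_smul h1 h2) hb2.ofReal hb2'.ofReal n1 (n2.add n3)
  have i1 : Integrable fun x => dpart k φ x • b x • g x :=
    l1.integrable_smul_left_of_hasCompactSupport d1.continuous d2
  have i2 : Integrable fun x => φ x • b' x • g x :=
    l2.integrable_smul_left_of_hasCompactSupport h1.continuous h2
  have i3 : Integrable fun x => φ x • b x • g' x :=
    l3.integrable_smul_left_of_hasCompactSupport h1.continuous h2
  have e1 : ∫ x, conj (Complex.ofRealCLM (b' x)) * (φ x • g x) = ∫ x, φ x • b' x • g x := by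
    refine integral_congr_ae (Eventually.of_forall fun x => ?_)
    simp only [Complex.ofRealCLM_apply, Complex.conj_ofReal, Complex.real_smul]
    ring
  have e2 : ∫ x, conj (Complex.ofRealCLM (b x)) * (dpart k φ x • g x + φ x • g' x) =
      (∫ x, dpart k φ x • b x • g x) + ∫ x, φ x • b x • g' x := by
    rw [← integral_add i1 i3]
    refine integral_congr_ae (Eventually.of_forall fun x => ?_)
    simp only [Complex.ofRealCLM_apply, Complex.conj_ofReal, Complex.real_smul]
    ring
  rw [e1, e2] at key
  have e3 : ∫ x, φ x • (b' x • g x + b x • g' x) =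
      (∫ x, φ x • b' x • g x) + ∫ x, φ x • b x • g' x := by
    rw [← integral_add i2 i3]
    simp only [smul_add]
  rw [e3, key]
  change ∫ x, dpart k φ x • b x • g x = _
  ring

/-- Integration by parts for a product of two `H¹` functions and a bounded function with bounded
weak derivative. -/
theorem IsWeakPartial.integral_smul_mul_conj {b b' : Dom d → ℝ} {u u' g g' : Dom d → ℂ}
    (hb : IsWeakPartial k b b') (hb2 : MemLp b 2 volume) (hb2' : MemLp b' 2 volume)
    (hbi : MemLp b ∞ volume) (hbi' : MemLp b' ∞ volume)
    (hu : IsWeakPartial k u u') (hu2 : MemLp u 2 volume) (hu2' : MemLp u' 2 volume)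
    (hg : IsWeakPartial k g g') (hg2 : MemLp g 2 volume) (hg2' : MemLp g' 2 volume) :
    ∫ x, (b x : ℂ) * (u x * conj (g' x) + u' x * conj (g x)) =
      -∫ x, (b' x : ℂ) * (u x * conj (g x)) := by
  obtain ⟨h1, h2, h3⟩ := hb.bounded_smul hb2 hb2' hbi hbi' hu hu2 hu2'
  have key := hg.integral_conj_mul_eq_neg h1 hg2 hg2' h2 h3
  have m2 : MemLp (fun x => b' x • u x) 2 volume := hu2.smul (p := ∞) (q := 2) (r := 2) hbi'
  have m3 : MemLp (fun x => b x • u' x) 2 volume := hu2'.smul (p := ∞) (q := 2) (r := 2) hbi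
  have i1 : Integrable fun x => conj (g' x) * (b x • u x) :=
    hg2'.star.integrable_mul (p := 2) (q := 2) h2
  have i2 : Integrable fun x => conj (g x) * (b' x • u x) :=
    hg2.star.integrable_mul (p := 2) (q := 2) m2
  have i3 : Integrable fun x => conj (g x) * (b x • u' x) :=
    hg2.star.integrable_mul (p := 2) (q := 2) m3
  have e1 : ∫ x, (b x : ℂ) * (u x * conj (g' x) + u' x * conj (g x)) =
      (∫ x, conj (g' x) * (b x • u x)) + ∫ x, conj (g x) * (b x • u' x) := by
    rw [← integral_add i1 i3]
    refine integral_congr_ae (Eventually.of_forall fun x => ?_)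
    simp only [Complex.real_smul]
    ring
  have e2 : ∫ x, conj (g x) * (b' x • u x + b x • u' x) =
      (∫ x, (b' x : ℂ) * (u x * conj (g x))) + ∫ x, conj (g x) * (b x • u' x) := by
    have e3 : ∫ x, (b' x : ℂ) * (u x * conj (g x)) = ∫ x, conj (g x) * (b' x • u x) := by
      refine integral_congr_ae (Eventually.of_forall fun x => ?_)
      simp only [Complex.real_smul]
      ring
    rw [e3, ← integral_add i2 i3]
    simp only [mul_add]
  rw [e1, key, e2]
  ring

/-- The difference quotients of an `H¹` function converge in `L²`, stated for functions rather than
for their classes. -/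
theorem IsWeakPartial.tendsto_eLpNorm {u v : Dom d → ℂ} (h : IsWeakPartial k u v)
    (hu : MemLp u 2 volume) (hv : MemLp v 2 volume) :
    Tendsto (fun s : ℝ => eLpNorm
      (fun x => s⁻¹ • (u (x + s • EuclideanSpace.single k 1) - u x) - v x) 2 volume)
      (𝓝[≠] 0) (𝓝 0) := by
  have h1 := (h.congr hu.coeFn_toLp.symm hv.coeFn_toLp.symm).tendsto_translate
  rw [Lp.tendsto_Lp_iff_tendsto_eLpNorm'] at h1
  refine h1.congr fun s => eLpNorm_congr_ae ?_
  have h2 := (measurePreserving_add_right (volume : Measure (Dom d))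
    (s • EuclideanSpace.single k 1)).quasiMeasurePreserving.ae hu.coeFn_toLp
  filter_upwards [Lp.coeFn_sub ((s : ℂ)⁻¹ • (translate k s (hu.toLp u) - hu.toLp u)) (hv.toLp v),
    Lp.coeFn_smul ((s : ℂ)⁻¹) (translate k s (hu.toLp u) - hu.toLp u),
    Lp.coeFn_sub (translate k s (hu.toLp u)) (hu.toLp u),
    translate_coeFn (k := k) s (hu.toLp u), hu.coeFn_toLp, hv.coeFn_toLp, h2]
    with x h3 h4 h5 h6 h7 h8 h9
  rw [Pi.sub_apply, h4, Pi.smul_apply, h5, Pi.sub_apply, h6, h7, h8, h9, Complex.real_smul,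
    smul_eq_mul, Complex.ofReal_inv]

theorem tendsto_integral_mul_norm {F : Type*} [NormedAddCommGroup F] {φ : Dom d → ℝ}
    (hφ : MemLp φ 2 volume) {z : ℕ → Dom d → F} (hz : ∀ n, AEStronglyMeasurable (z n) volume)
    (h : Tendsto (fun n => eLpNorm (z n) 2 volume) atTop (𝓝 0)) :
    Tendsto (fun n => ∫ x, |φ x| * ‖z n x‖) atTop (𝓝 0) := by
  have h1 : Tendsto (fun n => eLpNorm (φ • fun x => ‖z n x‖) 1 volume) atTop (𝓝 0) := by
    have h2 : Tendsto (fun n => eLpNorm φ 2 volume * eLpNorm (fun x => ‖z n x‖) 2 volume) atTop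
        (𝓝 (eLpNorm φ 2 volume * 0)) := by
      refine ENNReal.Tendsto.const_mul ?_ (Or.inr hφ.2.ne)
      simpa only [eLpNorm_norm] using h
    rw [mul_zero] at h2
    exact tendsto_of_tendsto_of_tendsto_of_le_of_le tendsto_const_nhds h2 (fun _ => zero_le)
      fun n => eLpNorm_smul_le_mul_eLpNorm (hz n).norm hφ.1
  have h3 := (ENNReal.continuousAt_toReal ENNReal.zero_ne_top).tendsto.comp h1
  refine h3.congr fun n => ?_
  have h4 := integral_norm_eq_lintegral_enorm (hφ.1.smul (hz n).norm)
  rw [Function.comp_apply, eLpNorm_one_eq_lintegral_enorm, ← h4]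
  refine integral_congr_ae (Eventually.of_forall fun x => ?_)
  simp

/-- Dominated convergence with dominating functions `h + |z n|`, where `z n → 0` in `L²`. -/
theorem tendsto_integral_of_le_add {F : Type*} [NormedAddCommGroup F] {φ : Dom d → ℝ}
    (hφ : MemLp φ 2 volume) {z : ℕ → Dom d → F} (hz : ∀ n, MemLp (z n) 2 volume)
    (h : Tendsto (fun n => eLpNorm (z n) 2 volume) atTop (𝓝 0)) {w : ℕ → Dom d → ℂ}
    (hw : ∀ n, AEStronglyMeasurable (w n) volume) {b : Dom d → ℝ} (hb : MemLp b 2 volume)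
    (hle : ∀ n, ∀ᵐ x, ‖w n x‖ ≤ b x + ‖z n x‖)
    (hlim : ∀ᵐ x, Tendsto (fun n => w n x) atTop (𝓝 0)) :
    Tendsto (fun n => ∫ x, φ x • w n x) atTop (𝓝 0) := by
  have hb0 : Integrable fun x => |φ x| * |b x| := hφ.norm.integrable_mul hb.norm
  have h1 : Tendsto (fun n => ∫ x, |φ x| * max (‖w n x‖ - ‖z n x‖) 0) atTop
      (𝓝 (∫ _ : Dom d, (0 : ℝ))) := by
    refine tendsto_integral_of_dominated_convergence (fun x => |φ x| * |b x|) (fun n => ?_) hb0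
      (fun n => ?_) ?_
    · have := ((hw n).norm.sub (hz n).1.norm).aemeasurable.max
        (aemeasurable_const (b := (0 : ℝ)))
      exact hφ.1.norm.mul this.aestronglyMeasurable
    · filter_upwards [hle n] with x hx
      rw [Real.norm_of_nonneg (by positivity)]
      gcongr
      exact max_le ((sub_le_iff_le_add.2 hx).trans (le_abs_self _)) (abs_nonneg _)
    · filter_upwards [hlim] with x hx
      have h2 : Tendsto (fun n => |φ x| * ‖w n x‖) atTop (𝓝 0) := by
        simpa using hx.norm.const_mul |φ x|
      refine squeeze_zero (fun n => by positivity) (fun n => ?_) h2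
      gcongr
      exact max_le (sub_le_self _ (norm_nonneg _)) (norm_nonneg _)
  rw [integral_zero] at h1
  have h2 := h1.add (tendsto_integral_mul_norm hφ (fun n => (hz n).1) h)
  rw [add_zero] at h2
  refine squeeze_zero_norm (fun n => ?_) h2
  have hz1 : Integrable fun x => |φ x| * ‖z n x‖ := hφ.norm.integrable_mul (hz n).norm
  have hm1 : Integrable fun x => |φ x| * max (‖w n x‖ - ‖z n x‖) 0 := by
    refine hb0.mono' ?_ ?_
    · have := ((hw n).norm.sub (hz n).1.norm).aemeasurable.max
        (aemeasurable_const (b := (0 : ℝ)))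
      exact hφ.1.norm.mul this.aestronglyMeasurable
    · filter_upwards [hle n] with x hx
      rw [Real.norm_of_nonneg (by positivity)]
      gcongr
      exact max_le ((sub_le_iff_le_add.2 hx).trans (le_abs_self _)) (abs_nonneg _)
  rw [← integral_add hm1 hz1]
  refine norm_integral_le_of_norm_le (hm1.add hz1) (Eventually.of_forall fun x => ?_)
  rw [norm_smul, Real.norm_eq_abs, ← mul_add]
  gcongr
  have := le_max_left (‖w n x‖ - ‖z n x‖) 0
  linarith

variable {ι : Type*} [Fintype ι]

theorem tendsto_eLpNorm_pi {α : Type*} {l : Filter α} {z : α → Dom d → ι → ℂ}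
    (hz : ∀ s, AEStronglyMeasurable (z s) volume)
    (h : ∀ j, Tendsto (fun s => eLpNorm (fun x => z s x j) 2 volume) l (𝓝 0)) :
    Tendsto (fun s => eLpNorm (z s) 2 volume) l (𝓝 0) := by
  have h1 : Tendsto (fun s => ∑ j, eLpNorm (fun x => z s x j) 2 volume) l (𝓝 (∑ _j : ι, 0)) :=
    tendsto_finsetSum _ fun j _ => h j
  rw [Finset.sum_const_zero] at h1
  refine tendsto_of_tendsto_of_tendsto_of_le_of_le tendsto_const_nhds h1 (fun _ => zero_le)
    fun s => ?_
  have h2 : eLpNorm (z s) 2 volume ≤ eLpNorm (∑ j, fun x => ‖z s x j‖) 2 volume := by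
    refine eLpNorm_mono_ae (Eventually.of_forall fun x => ?_)
    rw [Finset.sum_apply, Real.norm_of_nonneg (by positivity),
      pi_norm_le_iff_of_nonneg (by positivity)]
    exact fun j => Finset.single_le_sum (f := fun j => ‖z s x j‖) (fun _ _ => norm_nonneg _)
      (Finset.mem_univ j)
  refine h2.trans ((eLpNorm_sum_le (fun j _ => ?_) (by norm_num)).trans (le_of_eq ?_))
  · exact ((continuous_apply j).comp_aestronglyMeasurable (hz s)).norm
  · exact Finset.sum_congr rfl fun j _ => eLpNorm_norm _

theorem exists_seq_tendsto_ae_of_eLpNorm {z : ℕ → Dom d → ι → ℂ}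
    (hz : ∀ n, AEStronglyMeasurable (z n) volume)
    (h : Tendsto (fun n => eLpNorm (z n) 2 volume) atTop (𝓝 0)) :
    ∃ ns : ℕ → ℕ, StrictMono ns ∧ ∀ᵐ x, Tendsto (fun n => z (ns n) x) atTop (𝓝 0) := by
  have h2 : TendstoInMeasure volume z atTop (fun _ => (0 : ι → ℂ)) := by
    refine tendstoInMeasure_of_tendsto_eLpNorm (p := 2) (by norm_num) hz
      aestronglyMeasurable_const ?_
    refine h.congr fun n => ?_
    have h3 : z n - (fun _ => 0) = z n := sub_zero _
    rw [h3]
  exact h2.exists_seq_tendsto_ae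

/-- Chain rule for a differentiable Lipschitz function of finitely many `H¹` functions. The
difference quotients of the composition converge almost everywhere along a subsequence, and they
are dominated by the difference quotients of `u`, which converge in `L²`. -/
theorem isWeakPartial_comp {u v : Dom d → ι → ℂ}
    (huv : ∀ j, IsWeakPartial k (fun x => u x j) fun x => v x j)
    (hu : MemLp u 2 volume) (hv : MemLp v 2 volume)
    {Φ : (ι → ℂ) → ℂ} {Φ' : (ι → ℂ) → (ι → ℂ) →L[ℝ] ℂ} (hΦ : ∀ z, HasFDerivAt Φ (Φ' z) z)
    {L : ℝ} (hL : ∀ z, ‖Φ' z‖ ≤ L) (hΦ0 : Φ 0 = 0) :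
    IsWeakPartial k (fun x => Φ (u x)) (fun x => Φ' (u x) (v x)) ∧
      MemLp (fun x => Φ (u x)) 2 volume ∧ MemLp (fun x => Φ' (u x) (v x)) 2 volume := by
  set e : Dom d := EuclideanSpace.single k 1
  have hlip : ∀ z z', ‖Φ z - Φ z'‖ ≤ L * ‖z - z'‖ := fun z z' =>
    convex_univ.norm_image_sub_le_of_norm_hasFDerivWithin_le (𝕜 := ℝ)
      (fun y _ => (hΦ y).hasFDerivWithinAt) (fun y _ => hL y) (Set.mem_univ _) (Set.mem_univ _)
  have hL0 : 0 ≤ L := (norm_nonneg _).trans (hL 0)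
  have hΦc : Continuous Φ := continuous_iff_continuousAt.2 fun z => (hΦ z).continuousAt
  have mΦ : MemLp (fun x => Φ (u x)) 2 volume :=
    hu.of_le_mul (c := L) (hΦc.comp_aestronglyMeasurable hu.1) (Eventually.of_forall fun x => by
      simpa [hΦ0] using hlip (u x) 0)
  have lΦ := mΦ.locallyIntegrable (by norm_num)
  have hmp : ∀ s : ℝ, MeasurePreserving (fun x : Dom d => x + s • e) volume volume :=
    fun s => measurePreserving_add_right _ _
  let z : ℝ → Dom d → ι → ℂ := fun s x => s⁻¹ • (u (x + s • e) - u x) - v x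
  have hz : ∀ s, MemLp (z s) 2 volume := fun s =>
    (((hu.comp_measurePreserving (hmp s)).sub hu).const_smul s⁻¹).sub hv
  have hzlim : Tendsto (fun s => eLpNorm (z s) 2 volume) (𝓝[≠] 0) (𝓝 0) :=
    tendsto_eLpNorm_pi (fun s => (hz s).1) fun j => (huv j).tendsto_eLpNorm
      (memLp_pi_iff.1 hu j) (memLp_pi_iff.1 hv j)
  -- a sequence of steps along which the difference quotients converge almost everywhere
  obtain ⟨s, hs0, hsz, hsae⟩ : ∃ s : ℕ → ℝ, Tendsto s atTop (𝓝[≠] 0) ∧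
      Tendsto (fun n => eLpNorm (z (s n)) 2 volume) atTop (𝓝 0) ∧
      ∀ᵐ x, Tendsto (fun n => z (s n) x) atTop (𝓝 0) := by
    have hs : Tendsto (fun n : ℕ => 1 / ((n : ℝ) + 1)) atTop (𝓝[≠] 0) :=
      tendsto_nhdsWithin_iff.2 ⟨tendsto_one_div_add_atTop_nhds_zero_nat,
        Eventually.of_forall fun n => by
          have : (0 : ℝ) < 1 / ((n : ℝ) + 1) := by positivity
          exact this.ne'⟩
    have h1 := hzlim.comp hs
    obtain ⟨ns, hns, hae⟩ := exists_seq_tendsto_ae_of_eLpNorm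
      (z := fun n : ℕ => z (1 / ((n : ℝ) + 1))) (fun n => (hz _).1) h1
    exact ⟨fun n => 1 / ((ns n : ℝ) + 1), hs.comp hns.tendsto_atTop, h1.comp hns.tendsto_atTop,
      hae⟩
  have hs0' := (tendsto_nhdsWithin_iff.1 hs0).1
  let w : ℕ → Dom d → ℂ := fun n x => (s n)⁻¹ • (Φ (u (x + s n • e)) - Φ (u x))
  have mw : ∀ n, MemLp (w n) 2 volume := fun n =>
    ((mΦ.comp_measurePreserving (hmp (s n))).sub mΦ).const_smul (s n)⁻¹
  have hwlim : ∀ᵐ x, Tendsto (fun n => w n x) atTop (𝓝 (Φ' (u x) (v x))) := by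
    filter_upwards [hsae] with x hx
    have h1 : Tendsto (fun n => (s n)⁻¹ • (u (x + s n • e) - u x)) atTop (𝓝 (v x)) := by
      have := hx.add_const (v x)
      simpa [z] using this
    have hne : ∀ᶠ n in atTop, s n ≠ 0 := (tendsto_nhdsWithin_iff.1 hs0).2
    have h2 : Tendsto (fun n => u (x + s n • e) - u x) atTop (𝓝 0) := by
      have := hs0'.smul h1
      rw [zero_smul] at this
      refine this.congr' ?_
      filter_upwards [hne] with n hn
      rw [smul_smul, mul_inv_cancel₀ hn, one_smul]
    have := ((hΦ (u x)).hasFDerivWithinAt (s := Set.univ)).lim h2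
      (Eventually.of_forall fun _ => Set.mem_univ _) h1
    simpa [w] using this
  have hmeas : AEStronglyMeasurable (fun x => Φ' (u x) (v x)) volume :=
    aestronglyMeasurable_of_tendsto_ae atTop (fun n => (mw n).1) hwlim
  have mΦ' : MemLp (fun x => Φ' (u x) (v x)) 2 volume :=
    hv.of_le_mul hmeas (Eventually.of_forall fun x => (Φ' (u x)).le_of_opNorm_le (hL _) _)
  have lΦ' := mΦ'.locallyIntegrable (by norm_num)
  refine ⟨⟨lΦ, lΦ', fun φ h1 h2 => ?_⟩, mΦ, mΦ'⟩
  have hφ2 : MemLp φ 2 volume := h1.continuous.memLp_of_hasCompactSupport h2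
  have hlim1 : Tendsto (fun n => ∫ x, φ x • (w n x - Φ' (u x) (v x))) atTop (𝓝 0) := by
    refine tendsto_integral_of_le_add hφ2 (z := fun n x => L • z (s n) x)
      (b := fun x => 2 * L * ‖v x‖) (fun n => (hz _).const_smul L) ?_
      (fun n => (mw n).1.sub hmeas) (hv.norm.const_mul _) (fun n => ?_) ?_
    · have h3 : Tendsto (fun n => ‖L‖ₑ * eLpNorm (z (s n)) 2 volume) atTop (𝓝 (‖L‖ₑ * 0)) :=
        ENNReal.Tendsto.const_mul hsz (Or.inr enorm_ne_top)
      rw [mul_zero] at h3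
      refine h3.congr fun n => ?_
      exact (eLpNorm_const_smul L (z (s n)) 2 volume).symm
    · refine Eventually.of_forall fun x => ?_
      have e1 : ‖w n x‖ ≤ L * ‖(s n)⁻¹ • (u (x + s n • e) - u x)‖ := by
        simp only [w, norm_smul]
        rw [mul_left_comm]
        gcongr
        exact hlip _ _
      have e2 : (s n)⁻¹ • (u (x + s n • e) - u x) = z (s n) x + v x := by simp [z]
      rw [e2] at e1
      have e3 := (Φ' (u x)).le_of_opNorm_le (hL _) (v x)
      have e4 := mul_le_mul_of_nonneg_left (norm_add_le (z (s n) x) (v x)) hL0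
      have e5 := norm_sub_le (w n x) (Φ' (u x) (v x))
      rw [norm_smul, Real.norm_of_nonneg hL0]
      linarith
    · filter_upwards [hwlim] with x hx
      simpa using hx.sub_const (Φ' (u x) (v x))
  have i1 : ∀ n, Integrable fun x => φ x • w n x := fun n =>
    ((mw n).locallyIntegrable (by norm_num)).integrable_smul_left_of_hasCompactSupport
      h1.continuous h2
  have i2 : Integrable fun x => φ x • Φ' (u x) (v x) :=
    lΦ'.integrable_smul_left_of_hasCompactSupport h1.continuous h2
  have hlim2 : Tendsto (fun n => ∫ x, φ x • w n x) atTop (𝓝 (∫ x, φ x • Φ' (u x) (v x))) := by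
    have := hlim1.add_const (∫ x, φ x • Φ' (u x) (v x))
    rw [zero_add] at this
    refine this.congr fun n => ?_
    simp only [smul_sub]
    rw [integral_sub (i1 n) i2, sub_add_cancel]
  -- the same integrals, with the difference quotients moved to the test function
  have hlim3 : Tendsto (fun n => ∫ x, φ x • w n x) atTop (𝓝 (∫ x, (-dpart k φ x) • Φ (u x))) := by
    have h3 := (hasDerivAt_integral_translate (k := k) lΦ h1 h2 0).tendsto_slope_zero.comp hs0
    simp only [zero_smul, sub_zero, zero_add] at h3
    refine h3.congr fun n => ?_
    have c1 : ContDiff ℝ ∞ fun x => φ (x - s n • e) := contDiff_translate h1 (s n • e)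
    have c2 : HasCompactSupport fun x => φ (x - s n • e) := hasCompactSupport_translate h2 _
    have j1 : Integrable fun x => φ x • Φ (u x) :=
      lΦ.integrable_smul_left_of_hasCompactSupport h1.continuous h2
    have l2 : LocallyIntegrable (fun x => Φ (u (x + s n • e))) volume :=
      (mΦ.comp_measurePreserving (hmp (s n))).locallyIntegrable (by norm_num)
    have j2 : Integrable fun x => φ x • Φ (u (x + s n • e)) :=
      l2.integrable_smul_left_of_hasCompactSupport h1.continuous h2
    have e1 : ∫ x, φ (x - s n • e) • Φ (u x) = ∫ x, φ x • Φ (u (x + s n • e)) := by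
      rw [← integral_add_right_eq_self (fun x => φ (x - s n • e) • Φ (u x)) (s n • e)]
      simp only [add_sub_cancel_right]
    simp only [Function.comp_apply]
    rw [e1, ← integral_sub j2 j1, ← integral_smul]
    refine integral_congr_ae (Eventually.of_forall fun x => ?_)
    simp only [w]
    rw [← smul_sub, smul_comm]
  have h4 := tendsto_nhds_unique hlim2 hlim3
  rw [h4]
  simp only [neg_smul, integral_neg, neg_neg]
  rfl

end ChainRule

/-! ### Pointwise estimates for the coefficients -/

section Pointwise

variable {n : ℕ} (A : Matrix (Fin n) (Fin n) ℝ)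

theorem pair_add_left (ξ ξ' ζ : Fin n → ℂ) : pair A (ξ + ξ') ζ = pair A ξ ζ + pair A ξ' ζ := by
  simp only [pair, Pi.add_apply, mul_add, Finset.sum_add_distrib, add_mul]

theorem pair_smul_left (c : ℂ) (ξ ζ : Fin n → ℂ) : pair A (c • ξ) ζ = c * pair A ξ ζ := by
  simp only [pair, Pi.smul_apply, smul_eq_mul, Finset.mul_sum, Finset.sum_mul]
  exact Finset.sum_congr rfl fun i _ => Finset.sum_congr rfl fun j _ => by ring

theorem pair_add_right (ξ ζ ζ' : Fin n → ℂ) : pair A ξ (ζ + ζ') = pair A ξ ζ + pair A ξ ζ' := by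
  simp only [pair, Pi.add_apply, map_add, mul_add, Finset.sum_add_distrib]

theorem pair_smul_right (c : ℂ) (ξ ζ : Fin n → ℂ) :
    pair A ξ (c • ζ) = conj c * pair A ξ ζ := by
  simp only [pair, Pi.smul_apply, smul_eq_mul, map_mul, Finset.mul_sum]
  exact Finset.sum_congr rfl fun i _ => by ring

theorem pair_transpose (ξ ζ : Fin n → ℂ) : pair A.transpose ξ ζ = conj (pair A ζ ξ) := by
  simp only [pair, map_sum, map_mul, Complex.conj_conj, Complex.conj_ofReal, Finset.sum_mul,
    Matrix.transpose_apply]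
  rw [Finset.sum_comm]
  exact Finset.sum_congr rfl fun i _ => Finset.sum_congr rfl fun j _ => by ring

theorem pair_symPart (ξ ζ : Fin n → ℂ) :
    pair (symPart A) ξ ζ = (pair A ξ ζ + conj (pair A ζ ξ)) / 2 := by
  rw [← pair_transpose]
  simp only [pair, symPart, Matrix.smul_apply, Matrix.add_apply, smul_eq_mul]
  rw [← Finset.sum_add_distrib, Finset.sum_div]
  refine Finset.sum_congr rfl fun i _ => ?_
  rw [← add_mul, ← Finset.sum_add_distrib, mul_div_right_comm, Finset.sum_div]
  congr 1
  refine Finset.sum_congr rfl fun j _ => ?_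
  push_cast
  ring

theorem pair_symPart_self (ξ : Fin n → ℂ) : pair (symPart A) ξ ξ = ((pair A ξ ξ).re : ℂ) := by
  rw [pair_symPart, Complex.add_conj]
  push_cast
  ring

theorem conj_pair_symPart (ξ ζ : Fin n → ℂ) :
    conj (pair (symPart A) ξ ζ) = pair (symPart A) ζ ξ := by
  rw [pair_symPart, pair_symPart, map_div₀, map_add, Complex.conj_conj, add_comm, map_ofNat]

theorem pair_self_re (ξ : Fin n → ℂ) : (pair A ξ ξ).re =
    (∑ i, ∑ j, A i j * (ξ j).re * (ξ i).re) + ∑ i, ∑ j, A i j * (ξ j).im * (ξ i).im := by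
  simp only [pair, Complex.re_sum, Finset.sum_mul, ← Finset.sum_add_distrib]
  refine Finset.sum_congr rfl fun i _ => Finset.sum_congr rfl fun j _ => ?_
  simp only [Complex.mul_re, Complex.mul_im, Complex.ofReal_re, Complex.ofReal_im, Complex.conj_re,
    Complex.conj_im]
  ring

theorem pair_self_im_of_isSymm (hA : A.IsSymm) (ξ : Fin n → ℂ) : (pair A ξ ξ).im = 0 := by
  have := pair_transpose A ξ ξ
  rw [hA.eq] at this
  exact Complex.conj_eq_iff_im.1 this.symm

/-- A sectorial form is dominated by its real part on the diagonal; this is polarization. -/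
theorem norm_pair_le {A : Matrix (Fin n) (Fin n) ℝ} {M : ℝ}
    (hA : ∀ ξ : Fin n → ℂ, |(pair A ξ ξ).im| ≤ M * (pair A ξ ξ).re)
    (hA0 : ∀ ξ : Fin n → ℂ, 0 ≤ (pair A ξ ξ).re) (ξ ζ : Fin n → ℂ) :
    ‖pair A ξ ζ‖ ≤ (1 + M) * ((pair A ξ ξ).re + (pair A ζ ζ).re) := by
  have hdiag : ∀ η : Fin n → ℂ, ‖pair A η η‖ ≤ (1 + M) * (pair A η η).re := fun η => by
    refine (Complex.norm_le_abs_re_add_abs_im _).trans ?_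
    rw [abs_of_nonneg (hA0 η), one_add_mul]
    linarith [hA η]
  have hpol : 4 * pair A ξ ζ = pair A (ξ + ζ) (ξ + ζ) - pair A (ξ + (-1 : ℂ) • ζ) (ξ + (-1 : ℂ) • ζ)
      + Complex.I * pair A (ξ + Complex.I • ζ) (ξ + Complex.I • ζ)
      - Complex.I * pair A (ξ + (-Complex.I) • ζ) (ξ + (-Complex.I) • ζ) := by
    simp only [pair_add_left, pair_add_right, pair_smul_left, pair_smul_right, map_neg, map_one,
      Complex.conj_I]
    linear_combination 2 * (pair A ξ ζ - pair A ζ ξ) * Complex.I_mul_I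
  have hpar : (pair A (ξ + ζ) (ξ + ζ)).re + (pair A (ξ + (-1 : ℂ) • ζ) (ξ + (-1 : ℂ) • ζ)).re
      + (pair A (ξ + Complex.I • ζ) (ξ + Complex.I • ζ)).re
      + (pair A (ξ + (-Complex.I) • ζ) (ξ + (-Complex.I) • ζ)).re =
      4 * ((pair A ξ ξ).re + (pair A ζ ζ).re) := by
    rw [← Complex.add_re, ← Complex.add_re, ← Complex.add_re, ← Complex.add_re]
    have : ((4 : ℝ) : ℂ) * (pair A ξ ξ + pair A ζ ζ) = pair A (ξ + ζ) (ξ + ζ)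
        + pair A (ξ + (-1 : ℂ) • ζ) (ξ + (-1 : ℂ) • ζ)
        + pair A (ξ + Complex.I • ζ) (ξ + Complex.I • ζ)
        + pair A (ξ + (-Complex.I) • ζ) (ξ + (-Complex.I) • ζ) := by
      simp only [pair_add_left, pair_add_right, pair_smul_left, pair_smul_right, map_neg, map_one,
        Complex.conj_I]
      push_cast
      linear_combination 2 * pair A ζ ζ * Complex.I_mul_I
    rw [← this, Complex.re_ofReal_mul]
  have h4 : 4 * ‖pair A ξ ζ‖ ≤ (1 + M) * (4 * ((pair A ξ ξ).re + (pair A ζ ζ).re)) := by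
    have h5 : 4 * ‖pair A ξ ζ‖ = ‖4 * pair A ξ ζ‖ := by simp
    rw [h5, hpol, ← hpar]
    refine (norm_sub_le _ _).trans ?_
    refine (add_le_add_left ((norm_add_le _ _).trans (add_le_add_left (norm_sub_le _ _) _)) _).trans ?_
    rw [norm_mul, norm_mul, Complex.norm_I, one_mul, one_mul]
    have := hdiag (ξ + ζ)
    have := hdiag (ξ + (-1 : ℂ) • ζ)
    have := hdiag (ξ + Complex.I • ζ)
    have := hdiag (ξ + (-Complex.I) • ζ)
    linarith
  linarith

end Pointwise

section Jets

variable {d m : ℕ}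

/-- The values at a point of a function `ℝ^d → ℂ^m` and of its first partial derivatives. -/
abbrev Jet (d m : ℕ) : Type := (Fin m → ℂ) × (Fin m → Fin d → ℂ)

/-- The (almost everywhere defined) jet of a function; the derivatives are weak ones. -/
noncomputable def jet (f : L2 d m) (x : Dom d) : Jet d m :=
  (fun i => f x i, fun i k => grad f i x k)

/-- `|f|²` in terms of the jet of `f`. -/
noncomputable def valSq (J : Jet d m) : ℝ := ∑ i, ‖J.1 i‖ ^ 2

/-- `|∇f|²` in terms of the jet of `f`. -/
noncomputable def gradSq (J : Jet d m) : ℝ := ∑ i, ∑ k, ‖J.2 i k‖ ^ 2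

/-- The density of the square of the form norm. -/
noncomputable def weight (a : Coeffs d m) (x : Dom d) (J : Jet d m) : ℝ :=
  valSq J + gradSq J + (pair (a.V x) J.1 J.1).re

/-- A first order term with coefficients `b`. -/
noncomputable def firstOrder (b : Fin m → Fin m → Fin d → ℝ) (p : Fin m → Fin d → ℂ)
    (ζ : Fin m → ℂ) : ℂ := ∑ i, ∑ j, (∑ k, (b i j k : ℂ) * p j k) * conj (ζ i)

theorem valSq_nonneg (J : Jet d m) : 0 ≤ valSq J := by unfold valSq; positivity

theorem gradSq_nonneg (J : Jet d m) : 0 ≤ gradSq J := by unfold gradSq; positivity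

theorem sq_norm_le_valSq (J : Jet d m) (i : Fin m) : ‖J.1 i‖ ^ 2 ≤ valSq J :=
  Finset.single_le_sum (f := fun i => ‖J.1 i‖ ^ 2) (fun _ _ => by positivity) (Finset.mem_univ i)

theorem sum_sq_norm_le_gradSq (J : Jet d m) (i : Fin m) : ∑ k, ‖J.2 i k‖ ^ 2 ≤ gradSq J :=
  Finset.single_le_sum (f := fun i => ∑ k, ‖J.2 i k‖ ^ 2) (fun _ _ => by positivity)
    (Finset.mem_univ i)

theorem sq_norm_le_gradSq (J : Jet d m) (i : Fin m) (k : Fin d) : ‖J.2 i k‖ ^ 2 ≤ gradSq J :=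
  (Finset.single_le_sum (f := fun k => ‖J.2 i k‖ ^ 2) (fun _ _ => by positivity)
    (Finset.mem_univ k)).trans (sum_sq_norm_le_gradSq J i)

/-- Bounded first order terms are small with respect to the gradient, up to a zero order term. -/
theorem exists_norm_firstOrder_le (κ : ℝ) {ε : ℝ} (hε : 0 < ε) : ∃ C : ℝ, 0 ≤ C ∧
    ∀ b : Fin m → Fin m → Fin d → ℝ, (∀ i j k, |b i j k| ≤ κ) →
      ∀ (p : Fin m → Fin d → ℂ) (ζ : Fin m → ℂ),
        ‖firstOrder b p ζ‖ ≤ ε * (∑ i, ∑ k, ‖p i k‖ ^ 2) + C * ∑ i, ‖ζ i‖ ^ 2 := by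
  set δ : ℝ := ε / (m + 1)
  have hδ : 0 < δ := by positivity
  -- Young's inequality `κ s t ≤ δ s² + κ² t² / (4 δ)` in each of the `m² d` summands
  refine ⟨m * d * (κ ^ 2 / (4 * δ)), by positivity, fun b hb p ζ => ?_⟩
  have h1 : ‖firstOrder b p ζ‖ ≤
      ∑ i : Fin m, ∑ j : Fin m, ∑ k : Fin d, (δ * ‖p j k‖ ^ 2 + κ ^ 2 / (4 * δ) * ‖ζ i‖ ^ 2) := by
    refine (norm_sum_le _ _).trans (Finset.sum_le_sum fun i _ => (norm_sum_le _ _).trans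
      (Finset.sum_le_sum fun j _ => ?_))
    rw [Finset.sum_mul]
    refine (norm_sum_le _ _).trans (Finset.sum_le_sum fun k _ => ?_)
    rw [norm_mul, norm_mul, Complex.norm_real, RCLike.norm_conj, Real.norm_eq_abs]
    have h2 : |b i j k| * ‖p j k‖ * ‖ζ i‖ ≤ κ * (‖p j k‖ * ‖ζ i‖) := by
      rw [mul_assoc]; exact mul_le_mul_of_nonneg_right (hb i j k) (by positivity)
    have h3 : δ * ‖p j k‖ ^ 2 + κ ^ 2 / (4 * δ) * ‖ζ i‖ ^ 2 - κ * (‖p j k‖ * ‖ζ i‖) =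
        (2 * δ * ‖p j k‖ - κ * ‖ζ i‖) ^ 2 / (4 * δ) := by
      field_simp
      ring
    have h4 : 0 ≤ (2 * δ * ‖p j k‖ - κ * ‖ζ i‖) ^ 2 / (4 * δ) := by positivity
    linarith
  refine h1.trans ?_
  simp only [Finset.sum_add_distrib, Finset.sum_const, Finset.card_univ, Fintype.card_fin,
    nsmul_eq_mul, ← Finset.mul_sum]
  have h5 : m * δ ≤ ε := by
    simp only [δ]
    rw [mul_div_assoc', div_le_iff₀ (by positivity)]
    nlinarith
  have h6 : 0 ≤ ∑ i, ∑ k, ‖p i k‖ ^ 2 := by positivity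
  have h7 := mul_le_mul_of_nonneg_right h5 h6
  refine le_of_eq_of_le (b := m * δ * (∑ i, ∑ k, ‖p i k‖ ^ 2) +
    m * d * (κ ^ 2 / (4 * δ)) * ∑ i, ‖ζ i‖ ^ 2) (by ring) (by linarith)

variable {a : Coeffs d m}

theorem HypH1.pair_V_re_nonneg (h : HypH1 a) (x : Dom d) (ξ : Fin m → ℂ) :
    0 ≤ (pair (a.V x) ξ ξ).re := by
  obtain ⟨M, hM, hV⟩ := h.sectorial_V
  have := (abs_nonneg _).trans (hV x (WithLp.toLp 2 ξ))
  exact nonneg_of_mul_nonneg_right this hM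

theorem HypH1.exists_norm_pair_V_le (h : HypH1 a) : ∃ M : ℝ, 0 ≤ M ∧ ∀ x ξ ζ,
    ‖pair (a.V x) ξ ζ‖ ≤ M * ((pair (a.V x) ξ ξ).re + (pair (a.V x) ζ ζ).re) := by
  obtain ⟨M, hM, hV⟩ := h.sectorial_V
  exact ⟨1 + M, by positivity, fun x ξ ζ => norm_pair_le (fun ξ => hV x (WithLp.toLp 2 ξ))
    (h.pair_V_re_nonneg x) ξ ζ⟩

theorem HypH1.exists_pair_Q_bounds (h : HypH1 a) : ∃ η₁ η₂ : ℝ, 0 < η₁ ∧ 0 < η₂ ∧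
    ∀ x (ξ : Fin d → ℂ), η₁ * ∑ k, ‖ξ k‖ ^ 2 ≤ (pair (a.Q x) ξ ξ).re ∧
      (pair (a.Q x) ξ ξ).re ≤ η₂ * ∑ k, ‖ξ k‖ ^ 2 := by
  obtain ⟨η₁, η₂, h1, h2, hQ⟩ := h.elliptic_Q
  refine ⟨η₁, η₂, h1, h2, fun x ξ => ?_⟩
  have hre := hQ x (WithLp.toLp 2 fun k => (ξ k).re)
  have him := hQ x (WithLp.toLp 2 fun k => (ξ k).im)
  rw [EuclideanSpace.real_norm_sq_eq] at hre him
  simp only at hre him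
  have hs : ∑ k, ‖ξ k‖ ^ 2 = (∑ k, (ξ k).re ^ 2) + ∑ k, (ξ k).im ^ 2 := by
    rw [← Finset.sum_add_distrib]
    refine Finset.sum_congr rfl fun k _ => ?_
    rw [← Complex.normSq_eq_norm_sq, Complex.normSq_apply]
    ring
  rw [pair_self_re, hs, mul_add, mul_add]
  exact ⟨add_le_add hre.1 him.1, add_le_add hre.2 him.2⟩

theorem HypH1.exists_norm_pair_Q_le (h : HypH1 a) : ∃ C : ℝ, 0 ≤ C ∧ ∀ x ξ ζ,
    ‖pair (a.Q x) ξ ζ‖ ≤ C * ((∑ k, ‖ξ k‖ ^ 2) + ∑ k, ‖ζ k‖ ^ 2) := by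
  obtain ⟨η₁, η₂, h1, h2, hQ⟩ := h.exists_pair_Q_bounds
  refine ⟨η₂, h2.le, fun x ξ ζ => ?_⟩
  have := norm_pair_le (A := a.Q x) (M := 0)
    (fun ξ => by rw [pair_self_im_of_isSymm _ (h.symm_Q x)]; simp)
    (fun ξ => le_trans (by positivity) (hQ x ξ).1) ξ ζ
  rw [add_zero, one_mul] at this
  linarith [(hQ x ξ).2, (hQ x ζ).2]

theorem exists_bound_of_memLp_top {b : Fin m → Fin m → Dom d → Dom d}
    (h : ∀ i j, MemLp (b i j) ∞ volume) :
    ∃ κ : ℝ, 0 ≤ κ ∧ ∀ᵐ x, ∀ i j k, |b i j x k| ≤ κ := by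
  refine ⟨∑ i, ∑ j, (eLpNorm (b i j) ∞ volume).toReal, by positivity, ?_⟩
  have h1 : ∀ᵐ x, ∀ i j, ‖b i j x‖ ≤ (eLpNorm (b i j) ∞ volume).toReal := by
    rw [ae_all_iff]; intro i
    rw [ae_all_iff]; intro j
    filter_upwards [ae_le_eLpNormEssSup (f := b i j) (μ := volume)] with x hx
    rw [eLpNorm_exponent_top, ← toReal_enorm]
    refine ENNReal.toReal_mono ?_ hx
    rw [← eLpNorm_exponent_top]
    exact (h i j).2.ne
  filter_upwards [h1] with x hx i j k
  calc |b i j x k| ≤ ‖b i j x‖ := PiLp.norm_apply_le (b i j x) k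
    _ ≤ (eLpNorm (b i j) ∞ volume).toReal := hx i j
    _ ≤ ∑ j, (eLpNorm (b i j) ∞ volume).toReal :=
      Finset.single_le_sum (f := fun j => (eLpNorm (b i j) ∞ volume).toReal)
        (fun _ _ => ENNReal.toReal_nonneg) (Finset.mem_univ j)
    _ ≤ _ := Finset.single_le_sum (f := fun i => ∑ j, (eLpNorm (b i j) ∞ volume).toReal)
        (fun _ _ => by positivity) (Finset.mem_univ i)

end Jets

/-! ### The form domain -/

section FormDomain

variable {d m : ℕ} {a : Coeffs d m} {f g : L2 d m}

theorem memLp_coord (f : L2 d m) (i : Fin m) : MemLp (fun x => f x i) 2 volume :=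
  (Lp.memLp f).eval_piLp i

theorem MemH1.isWeakPartial (hf : MemH1 f) (i : Fin m) (k : Fin d) :
    IsWeakPartial k (fun x => f x i) fun x => grad f i x k := by
  obtain ⟨v, hv, -⟩ := hf i k
  exact isWeakPartial_weakPartial hv

theorem grad_ae_eq {i : Fin m} {k : Fin d} {v : Dom d → ℂ}
    (h : IsWeakPartial k (fun x => f x i) v) : (fun x => grad f i x k) =ᵐ[volume] v :=
  h.weakPartial_ae_eq

theorem MemH1.memLp_grad (hf : MemH1 f) (i : Fin m) (k : Fin d) :
    MemLp (fun x => grad f i x k) 2 volume := by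
  obtain ⟨v, hv, hv2⟩ := hf i k
  exact hv2.ae_eq (grad_ae_eq hv).symm

theorem isWeakPartial_coord_add (hf : MemH1 f) (hg : MemH1 g) (i : Fin m) (k : Fin d) :
    IsWeakPartial k (fun x => (f + g) x i) fun x => grad f i x k + grad g i x k := by
  refine ((hf.isWeakPartial i k).add (hg.isWeakPartial i k)).congr ?_ (ae_eq_refl _)
  filter_upwards [Lp.coeFn_add f g] with x hx
  rw [hx]
  rfl

theorem isWeakPartial_coord_smul (c : ℂ) (hf : MemH1 f) (i : Fin m) (k : Fin d) :
    IsWeakPartial k (fun x => (c • f) x i) fun x => c * grad f i x k := by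
  refine ((hf.isWeakPartial i k).clm_comp
    ((ContinuousLinearMap.mul ℂ ℂ c).restrictScalars ℝ)).congr ?_ (ae_eq_refl _)
  filter_upwards [Lp.coeFn_smul c f] with x hx
  rw [hx]
  rfl

theorem MemH1.add (hf : MemH1 f) (hg : MemH1 g) : MemH1 (f + g) := fun i k =>
  ⟨_, isWeakPartial_coord_add hf hg i k, (hf.memLp_grad i k).add (hg.memLp_grad i k)⟩

theorem MemH1.smul (c : ℂ) (hf : MemH1 f) : MemH1 (c • f) := fun i k =>
  ⟨_, isWeakPartial_coord_smul c hf i k, (hf.memLp_grad i k).const_mul c⟩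

theorem memH1_zero : MemH1 (0 : L2 d m) := fun i k => by
  refine ⟨fun _ => 0, IsWeakPartial.zero.congr ?_ (ae_eq_refl _), MemLp.zero⟩
  filter_upwards [Lp.coeFn_zero (EuclideanSpace ℂ (Fin m)) 2 (volume : Measure (Dom d))] with x hx
  rw [hx]
  rfl

theorem jet_add (hf : MemH1 f) (hg : MemH1 g) : ∀ᵐ x, jet (f + g) x = jet f x + jet g x := by
  have h1 : ∀ᵐ x, ∀ i k, grad (f + g) i x k = grad f i x k + grad g i x k := by
    simp only [ae_all_iff]
    exact fun i k => grad_ae_eq (isWeakPartial_coord_add hf hg i k)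
  filter_upwards [Lp.coeFn_add f g, h1] with x hx h2
  refine Prod.ext ?_ ?_
  · funext i
    simp only [jet, hx]
    rfl
  · funext i k; simp [jet, h2]

theorem jet_smul (c : ℂ) (hf : MemH1 f) : ∀ᵐ x, jet (c • f) x = c • jet f x := by
  have h1 : ∀ᵐ x, ∀ i k, grad (c • f) i x k = c * grad f i x k := by
    simp only [ae_all_iff]
    exact fun i k => grad_ae_eq (isWeakPartial_coord_smul c hf i k)
  filter_upwards [Lp.coeFn_smul c f, h1] with x hx h2
  refine Prod.ext ?_ ?_
  · funext i
    simp only [jet, hx]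
    rfl
  · funext i k; simp [jet, h2]

theorem integrable_valSq (f : L2 d m) : Integrable fun x => valSq (jet f x) :=
  integrable_finsetSum _ fun i _ => (memLp_coord f i).integrable_norm_pow (by norm_num)

theorem MemH1.integrable_gradSq (hf : MemH1 f) : Integrable fun x => gradSq (jet f x) :=
  integrable_finsetSum _ fun i _ => integrable_finsetSum _ fun k _ =>
    (hf.memLp_grad i k).integrable_norm_pow (by norm_num)

theorem valSq_jet (f : L2 d m) (x : Dom d) : valSq (jet f x) = ‖f x‖ ^ 2 :=
  (EuclideanSpace.norm_sq_eq (f x)).symm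

theorem integral_valSq (f : L2 d m) : ∫ x, valSq (jet f x) = ‖f‖ ^ 2 := by
  have h2 : ∫ x, (inner ℂ (f x) (f x) : ℂ) = ((∫ x, valSq (jet f x) : ℝ) : ℂ) := by
    rw [← integral_complex_ofReal]
    refine integral_congr_ae (Eventually.of_forall fun x => ?_)
    simp only [inner_self_eq_norm_sq_to_K, valSq_jet]
    push_cast
    rfl
  rw [← inner_self_eq_norm_sq (𝕜 := ℂ), L2.inner_def, h2]
  exact (Complex.ofReal_re _).symm

theorem aestronglyMeasurable_pair_V (h : HypH1 a) {u v : Dom d → Fin m → ℂ}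
    (hu : ∀ i, AEStronglyMeasurable (fun x => u x i) volume)
    (hv : ∀ i, AEStronglyMeasurable (fun x => v x i) volume) :
    AEStronglyMeasurable (fun x => pair (a.V x) (u x) (v x)) volume := by
  have : (fun x => pair (a.V x) (u x) (v x)) =
      ∑ i, (∑ j, (fun x => (a.V x i j : ℂ)) * fun x => u x j) * fun x => conj (v x i) := by
    funext x; simp [pair]
  rw [this]
  refine Finset.aestronglyMeasurable_sum _ fun i _ =>
    (Finset.aestronglyMeasurable_sum _ fun j _ => ?_).mul
      (Complex.continuous_conj.comp_aestronglyMeasurable (hv i))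
  exact (Complex.continuous_ofReal.comp_aestronglyMeasurable
    (h.locallyIntegrable_V i j).aestronglyMeasurable).mul (hu j)

theorem aestronglyMeasurable_pair_Q (h : HypH1 a) {u v : Dom d → Fin d → ℂ}
    (hu : ∀ i, AEStronglyMeasurable (fun x => u x i) volume)
    (hv : ∀ i, AEStronglyMeasurable (fun x => v x i) volume) :
    AEStronglyMeasurable (fun x => pair (a.Q x) (u x) (v x)) volume := by
  have : (fun x => pair (a.Q x) (u x) (v x)) =
      ∑ i, (∑ j, (fun x => (a.Q x i j : ℂ)) * fun x => u x j) * fun x => conj (v x i) := by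
    funext x; simp [pair]
  rw [this]
  refine Finset.aestronglyMeasurable_sum _ fun i _ =>
    (Finset.aestronglyMeasurable_sum _ fun j _ => ?_).mul
      (Complex.continuous_conj.comp_aestronglyMeasurable (hv i))
  exact (Complex.continuous_ofReal.comp_aestronglyMeasurable
    (h.measurable_Q i j).aestronglyMeasurable).mul (hu j)

theorem memFormDomain_iff : MemFormDomain a f ↔
    MemH1 f ∧ Integrable (fun x => (pair (a.V x) (jet f x).1 (jet f x).1).re) volume := by
  refine and_congr_right fun _ => ?_
  have : (fun x => pair (symPart (a.V x)) (f x) (f x)) =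
      fun x => (((pair (a.V x) (jet f x).1 (jet f x).1).re : ℝ) : ℂ) := by
    funext x; exact pair_symPart_self _ _
  rw [this]
  exact ⟨fun h => by simpa using h.re, fun h => h.ofReal⟩

theorem MemFormDomain.integrable_pair_V_re (hf : MemFormDomain a f) :
    Integrable fun x => (pair (a.V x) (jet f x).1 (jet f x).1).re := (memFormDomain_iff.1 hf).2

theorem MemFormDomain.integrable_weight (hf : MemFormDomain a f) :
    Integrable fun x => weight a x (jet f x) :=
  ((integrable_valSq f).add hf.1.integrable_gradSq).add hf.integrable_pair_V_re

/-- An `H¹` function lies in the form domain as soon as the real part of the quadratic form of `V`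
is dominated by an integrable function. -/
theorem memFormDomain_of_le (h : HypH1 a) (hf : MemH1 f) {b : Dom d → ℝ} (hb : Integrable b)
    (hle : ∀ᵐ x, (pair (a.V x) (jet f x).1 (jet f x).1).re ≤ b x) : MemFormDomain a f := by
  refine memFormDomain_iff.2 ⟨hf, hb.mono' ?_ ?_⟩
  · exact (aestronglyMeasurable_pair_V h (fun i => (memLp_coord f i).1)
      fun i => (memLp_coord f i).1).re
  · filter_upwards [hle] with x hx
    rwa [Real.norm_of_nonneg (h.pair_V_re_nonneg x _)]

theorem HypH1.pair_V_re_add_le (h : HypH1 a) (x : Dom d) (ξ ζ : Fin m → ℂ) :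
    (pair (a.V x) (ξ + ζ) (ξ + ζ)).re ≤
      2 * (pair (a.V x) ξ ξ).re + 2 * (pair (a.V x) ζ ζ).re := by
  have h1 := h.pair_V_re_nonneg x (ξ + (-1 : ℂ) • ζ)
  simp only [pair_add_left, pair_add_right, pair_smul_left, pair_smul_right, map_neg, map_one,
    Complex.add_re] at h1 ⊢
  simp only [neg_mul, one_mul, Complex.neg_re, Complex.add_re] at h1
  linarith

theorem MemFormDomain.add (h : HypH1 a) (hf : MemFormDomain a f) (hg : MemFormDomain a g) :
    MemFormDomain a (f + g) := by
  refine memFormDomain_of_le h (hf.1.add hg.1)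
    ((hf.integrable_pair_V_re.const_mul 2).add (hg.integrable_pair_V_re.const_mul 2)) ?_
  filter_upwards [jet_add hf.1 hg.1] with x hx
  rw [hx]
  exact h.pair_V_re_add_le x _ _

theorem MemFormDomain.smul (h : HypH1 a) (c : ℂ) (hf : MemFormDomain a f) :
    MemFormDomain a (c • f) := by
  refine memFormDomain_of_le h (hf.1.smul c) (hf.integrable_pair_V_re.const_mul (‖c‖ ^ 2)) ?_
  filter_upwards [jet_smul c hf.1] with x hx
  rw [hx, Prod.smul_fst, pair_smul_left, pair_smul_right, ← mul_assoc, Complex.mul_conj,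
    Complex.normSq_eq_norm_sq, Complex.re_ofReal_mul]

theorem memFormDomain_zero : MemFormDomain a (0 : L2 d m) := by
  refine memFormDomain_iff.2 ⟨memH1_zero, (integrable_zero _ _ _).congr ?_⟩
  filter_upwards [Lp.coeFn_zero (EuclideanSpace ℂ (Fin m)) 2 (volume : Measure (Dom d))] with x hx
  have : (jet (0 : L2 d m) x).1 = 0 := by
    funext i
    simp only [jet, hx]
    rfl
  rw [this]
  simp [pair]

/-- The form domain as a subspace of `L²`. -/
def formSubmodule (h : HypH1 a) : Submodule ℂ (L2 d m) where
  carrier := {f | MemFormDomain a f}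
  add_mem' hf hg := hf.add h hg
  zero_mem' := memFormDomain_zero
  smul_mem' c _ hf := hf.smul h c

/-- The inner product density of the form norm, conjugate linear in the first jet. -/
noncomputable def weightInner (a : Coeffs d m) (x : Dom d) (J K : Jet d m) : ℂ :=
  (∑ i, conj (J.1 i) * K.1 i) + (∑ i, ∑ k, conj (J.2 i k) * K.2 i k) +
    pair (symPart (a.V x)) K.1 J.1

theorem weightInner_self (x : Dom d) (J : Jet d m) :
    weightInner a x J J = (weight a x J : ℂ) := by
  simp only [weightInner, weight, valSq, gradSq, pair_symPart_self, Complex.conj_mul']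
  push_cast
  rfl

theorem weightInner_add_left (x : Dom d) (J J' K : Jet d m) :
    weightInner a x (J + J') K = weightInner a x J K + weightInner a x J' K := by
  simp only [weightInner, Prod.fst_add, Prod.snd_add, Pi.add_apply, map_add, add_mul,
    Finset.sum_add_distrib, pair_add_right]
  ring

theorem weightInner_smul_left (x : Dom d) (c : ℂ) (J K : Jet d m) :
    weightInner a x (c • J) K = conj c * weightInner a x J K := by
  simp only [weightInner, Prod.smul_fst, Prod.smul_snd, Pi.smul_apply, smul_eq_mul, map_mul,
    pair_smul_right, mul_add, Finset.mul_sum, mul_assoc]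

theorem conj_weightInner (x : Dom d) (J K : Jet d m) :
    conj (weightInner a x J K) = weightInner a x K J := by
  simp only [weightInner, map_add, map_sum, map_mul, Complex.conj_conj, conj_pair_symPart,
    mul_comm]

theorem weight_nonneg (h : HypH1 a) (x : Dom d) (J : Jet d m) : 0 ≤ weight a x J :=
  add_nonneg (add_nonneg (valSq_nonneg J) (gradSq_nonneg J)) (h.pair_V_re_nonneg x _)

theorem valSq_le_weight (h : HypH1 a) (x : Dom d) (J : Jet d m) : valSq J ≤ weight a x J := by
  have := gradSq_nonneg J
  have := h.pair_V_re_nonneg x J.1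
  unfold weight
  linarith

theorem gradSq_le_weight (h : HypH1 a) (x : Dom d) (J : Jet d m) : gradSq J ≤ weight a x J := by
  have := valSq_nonneg J
  have := h.pair_V_re_nonneg x J.1
  unfold weight
  linarith

theorem pair_V_re_le_weight (x : Dom d) (J : Jet d m) :
    (pair (a.V x) J.1 J.1).re ≤ weight a x J := by
  have := valSq_nonneg J
  have := gradSq_nonneg J
  unfold weight
  linarith

theorem integrable_conj_mul {u v : Dom d → ℂ} (hu : MemLp u 2 volume) (hv : MemLp v 2 volume) :
    Integrable fun x => conj (u x) * v x := hu.star.integrable_mul hv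

theorem integrable_pair_V (h : HypH1 a) (hf : MemFormDomain a f) (hg : MemFormDomain a g) :
    Integrable fun x => pair (a.V x) (jet f x).1 (jet g x).1 := by
  obtain ⟨M, hM, hV⟩ := h.exists_norm_pair_V_le
  refine ((hf.integrable_pair_V_re.add hg.integrable_pair_V_re).const_mul M).mono' ?_
    (Eventually.of_forall fun x => hV x _ _)
  exact aestronglyMeasurable_pair_V h (fun i => (memLp_coord f i).1) fun i => (memLp_coord g i).1

theorem integrable_pair_symPart_V (h : HypH1 a) (hf : MemFormDomain a f)
    (hg : MemFormDomain a g) :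
    Integrable fun x => pair (symPart (a.V x)) (jet f x).1 (jet g x).1 := by
  simp only [pair_symPart]
  exact ((integrable_pair_V h hf hg).add
    (Complex.conjLIE.toContinuousLinearEquiv.toContinuousLinearMap.integrable_comp
      (integrable_pair_V h hg hf))).div_const 2

theorem integrable_weightInner (h : HypH1 a) (hf : MemFormDomain a f) (hg : MemFormDomain a g) :
    Integrable fun x => weightInner a x (jet f x) (jet g x) := by
  refine ((integrable_finsetSum _ fun i _ => ?_).add (integrable_finsetSum _ fun i _ =>
    integrable_finsetSum _ fun k _ => ?_)).add (integrable_pair_symPart_V h hg hf)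
  · exact integrable_conj_mul (memLp_coord f i) (memLp_coord g i)
  · exact integrable_conj_mul (hf.1.memLp_grad i k) (hg.1.memLp_grad i k)

end FormDomain

section FormSpace

variable {d m : ℕ} {a : Coeffs d m}

/-- The form domain, to be equipped with the form norm instead of the norm of `L²`. -/
def FormSpace (h : HypH1 a) : Type := formSubmodule h

noncomputable instance (h : HypH1 a) : AddCommGroup (FormSpace h) :=
  inferInstanceAs (AddCommGroup (formSubmodule h))

noncomputable instance (h : HypH1 a) : Module ℂ (FormSpace h) :=
  inferInstanceAs (Module ℂ (formSubmodule h))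

variable {h : HypH1 a}

/-- The inclusion of the form domain into `L²`. -/
noncomputable def FormSpace.val : FormSpace h →ₗ[ℂ] L2 d m := (formSubmodule h).subtype

theorem FormSpace.mem (f : FormSpace h) : MemFormDomain a f.val := f.2

theorem FormSpace.val_injective : Function.Injective (FormSpace.val (h := h)) :=
  Subtype.val_injective

theorem FormSpace.exists_val_eq {f : L2 d m} (hf : MemFormDomain a f) :
    ∃ u : FormSpace h, u.val = f := ⟨⟨f, hf⟩, rfl⟩

noncomputable instance (h : HypH1 a) : InnerProductSpace.Core ℂ (FormSpace h) where
  inner f g := ∫ x, weightInner a x (jet f.val x) (jet g.val x)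
  conj_inner_symm f g := by
    rw [← integral_conj]
    simp only [conj_weightInner]
  re_inner_nonneg f := by
    simp only [weightInner_self]
    rw [integral_complex_ofReal]
    exact integral_nonneg fun x => weight_nonneg h x _
  add_left f g k := by
    rw [← integral_add (integrable_weightInner h f.mem k.mem)
      (integrable_weightInner h g.mem k.mem)]
    refine integral_congr_ae ?_
    filter_upwards [jet_add f.mem.1 g.mem.1] with x hx
    rw [map_add, hx, weightInner_add_left]
  smul_left f g c := by
    rw [← integral_const_mul]
    refine integral_congr_ae ?_
    filter_upwards [jet_smul c f.mem.1] with x hx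
    rw [map_smul, hx, weightInner_smul_left]
  definite f hf := by
    simp only [weightInner_self] at hf
    rw [integral_complex_ofReal] at hf
    have h1 : ∫ x, weight a x (jet f.val x) = 0 := by exact_mod_cast hf
    have h2 : ‖f.val‖ ^ 2 ≤ 0 := by
      rw [← integral_valSq, ← h1]
      exact integral_mono (integrable_valSq _) f.mem.integrable_weight
        fun x => valSq_le_weight h x _
    have h3 : f.val = 0 := by
      have : ‖f.val‖ = 0 := by nlinarith [norm_nonneg f.val]
      exact norm_eq_zero.1 this
    exact FormSpace.val_injective (h3.trans (map_zero _).symm)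

noncomputable instance (h : HypH1 a) : NormedAddCommGroup (FormSpace h) :=
  InnerProductSpace.Core.toNormedAddCommGroup (𝕜 := ℂ)

noncomputable instance (h : HypH1 a) : InnerProductSpace ℂ (FormSpace h) :=
  InnerProductSpace.ofCore _

theorem FormSpace.norm_sq_eq (f : FormSpace h) :
    ‖f‖ ^ 2 = ∫ x, weight a x (jet f.val x) := by
  have h1 : (inner ℂ f f : ℂ) = ∫ x, weightInner a x (jet f.val x) (jet f.val x) := rfl
  rw [← inner_self_eq_norm_sq (𝕜 := ℂ), h1]
  simp only [weightInner_self]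
  rw [integral_complex_ofReal]
  exact Complex.ofReal_re _

end FormSpace

/-! ### Completeness of the form space -/

section Completeness

variable {d m : ℕ} {a : Coeffs d m} {h : HypH1 a}

/-- The graph of a weak partial derivative is closed in `L² × L²`. -/
theorem IsWeakPartial.of_tendsto {k : Fin d} {u v : ℕ → Lp ℂ 2 (volume : Measure (Dom d))}
    {U V : Lp ℂ 2 (volume : Measure (Dom d))} (huv : ∀ n, IsWeakPartial k (u n) (v n))
    (hu : Tendsto u atTop (𝓝 U)) (hv : Tendsto v atTop (𝓝 V)) : IsWeakPartial k U V := by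
  refine ⟨(Lp.memLp U).locallyIntegrable (by norm_num),
    (Lp.memLp V).locallyIntegrable (by norm_num), fun φ h1 h2 => ?_⟩
  have key : ∀ ψ : Dom d → ℝ, ContDiff ℝ ∞ ψ → HasCompactSupport ψ →
      ∀ (w : ℕ → Lp ℂ 2 (volume : Measure (Dom d))) (W : Lp ℂ 2 (volume : Measure (Dom d))),
        Tendsto w atTop (𝓝 W) →
        Tendsto (fun n => ∫ x, ψ x • w n x) atTop (𝓝 (∫ x, ψ x • W x)) := by
    intro ψ h3 h4 w W hw
    have hmem : MemLp (fun x => (ψ x : ℂ)) 2 (volume : Measure (Dom d)) :=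
      MemLp.ofReal (h3.continuous.memLp_of_hasCompactSupport h4)
    have e : ∀ f : Lp ℂ 2 (volume : Measure (Dom d)),
        inner ℂ (hmem.toLp _) f = ∫ x, ψ x • f x := by
      intro f
      rw [L2.inner_def]
      refine integral_congr_ae ?_
      filter_upwards [hmem.coeFn_toLp] with x hx
      rw [hx]
      simp [mul_comm]
    simp only [← e]
    exact tendsto_const_nhds.inner hw
  have l1 := key (dpart k φ) (contDiff_dpart h1) (hasCompactSupport_dpart h2) u U hu
  have l2 := (key φ h1 h2 v V hv).neg
  exact tendsto_nhds_unique l1 (l2.congr fun n => ((huv n).2.2 φ h1 h2).symm)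

theorem jet_sub {f g : L2 d m} (hf : MemH1 f) (hg : MemH1 g) :
    ∀ᵐ x, jet (f - g) x = jet f x - jet g x := by
  have e : f - g = f + (-1 : ℂ) • g := by simp [sub_eq_add_neg]
  filter_upwards [jet_add hf (hg.smul (-1)), jet_smul (-1) hg] with x h1 h2
  rw [e, h1, h2]
  simp [sub_eq_add_neg]

theorem FormSpace.norm_val_le (f : FormSpace h) : ‖f.val‖ ≤ ‖f‖ := by
  refine le_of_sq_le_sq ?_ (norm_nonneg _)
  rw [← integral_valSq, FormSpace.norm_sq_eq]
  exact integral_mono (integrable_valSq _) f.mem.integrable_weight fun x => valSq_le_weight h x _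

/-- The inclusion of the form space into `L²`. -/
noncomputable def FormSpace.valL : FormSpace h →L[ℂ] L2 d m :=
  FormSpace.val.mkContinuous 1 fun f => by simpa using f.norm_val_le

/-- The weak partial derivatives as operators on the form space. -/
noncomputable def FormSpace.gradL (i : Fin m) (k : Fin d) :
    FormSpace h →L[ℂ] Lp ℂ 2 (volume : Measure (Dom d)) :=
  LinearMap.mkContinuous
    { toFun := fun f => (f.mem.1.memLp_grad i k).toLp _
      map_add' := fun f g => by
        rw [← MemLp.toLp_add]
        refine MemLp.toLp_congr _ _ ?_
        filter_upwards [jet_add f.mem.1 g.mem.1] with x hx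
        exact congrFun (congrFun (congrArg Prod.snd hx) i) k
      map_smul' := fun c f => by
        rw [RingHom.id_apply, ← MemLp.toLp_const_smul]
        refine MemLp.toLp_congr _ _ ?_
        filter_upwards [jet_smul c f.mem.1] with x hx
        exact congrFun (congrFun (congrArg Prod.snd hx) i) k } 1 fun f => by
    rw [one_mul]
    refine le_of_sq_le_sq ?_ (norm_nonneg _)
    rw [FormSpace.norm_sq_eq]
    have hmem := f.mem.1.memLp_grad i k
    have e : ‖hmem.toLp _‖ ^ 2 = ∫ x, ‖grad f.val i x k‖ ^ 2 := by
      rw [← inner_self_eq_norm_sq (𝕜 := ℂ), L2.inner_def,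
        integral_congr_ae (g := fun x => ((‖grad f.val i x k‖ ^ 2 : ℝ) : ℂ)),
        integral_complex_ofReal]
      · exact Complex.ofReal_re _
      · filter_upwards [hmem.coeFn_toLp] with x hx
        rw [hx, inner_self_eq_norm_sq_to_K]
        push_cast
        rfl
    exact e.trans_le (integral_mono (hmem.integrable_norm_pow (by norm_num))
      f.mem.integrable_weight fun x =>
        (sq_norm_le_gradSq (jet f.val x) i k).trans (gradSq_le_weight h x _))

theorem FormSpace.gradL_coeFn (f : FormSpace h) (i : Fin m) (k : Fin d) :
    FormSpace.gradL i k f =ᵐ[volume] fun x => grad f.val i x k :=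
  (f.mem.1.memLp_grad i k).coeFn_toLp

/-- The components of an element of `L²(ℝ^d, ℂ^m)`. -/
noncomputable def coordL (i : Fin m) : L2 d m →L[ℂ] Lp ℂ 2 (volume : Measure (Dom d)) :=
  ContinuousLinearMap.compLpL 2 volume (EuclideanSpace.proj (𝕜 := ℂ) i)

theorem coordL_coeFn (i : Fin m) (f : L2 d m) : coordL i f =ᵐ[volume] fun x => f x i :=
  ContinuousLinearMap.coeFn_compLpL _ f

theorem weight_continuous (x : Dom d) : Continuous (weight a x) := by
  unfold weight valSq gradSq pair
  fun_prop

theorem aestronglyMeasurable_weight (h : HypH1 a) {f g : L2 d m} (hf : MemH1 f) (hg : MemH1 g) :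
    AEStronglyMeasurable (fun x => weight a x (jet f x - jet g x)) volume := by
  have c1 : ∀ i, AEStronglyMeasurable (fun x => (jet f x - jet g x).1 i) volume :=
    fun i => (memLp_coord f i).1.sub (memLp_coord g i).1
  have c2 : ∀ i k, AEStronglyMeasurable (fun x => (jet f x - jet g x).2 i k) volume :=
    fun i k => (hf.memLp_grad i k).1.sub (hg.memLp_grad i k).1
  have e : (fun x => weight a x (jet f x - jet g x)) =
      (∑ i, fun x => ‖(jet f x - jet g x).1 i‖ ^ 2) +
      (∑ i, ∑ k, fun x => ‖(jet f x - jet g x).2 i k‖ ^ 2) +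
      fun x => (pair (a.V x) (jet f x - jet g x).1 (jet f x - jet g x).1).re := by
    funext x
    simp [weight, valSq, gradSq]
  rw [e]
  refine ((Finset.aestronglyMeasurable_sum _ fun i _ => (c1 i).norm.pow 2).add
    (Finset.aestronglyMeasurable_sum _ fun i _ => Finset.aestronglyMeasurable_sum _
      fun k _ => (c2 i k).norm.pow 2)).add (aestronglyMeasurable_pair_V h c1 c1).re

theorem lintegral_weight_sub (f g : FormSpace h) :
    ∫⁻ x, ENNReal.ofReal (weight a x (jet f.val x - jet g.val x)) =
      ENNReal.ofReal (‖f - g‖ ^ 2) := by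
  rw [FormSpace.norm_sq_eq, ofReal_integral_eq_lintegral_ofReal (f - g).mem.integrable_weight
    (Eventually.of_forall fun x => weight_nonneg h x _)]
  refine lintegral_congr_ae ?_
  filter_upwards [jet_sub f.mem.1 g.mem.1] with x hx
  rw [map_sub, hx]

/-- The form norm is complete: the `L²` limits of the functions and of their derivatives provide
the limit in `H¹`, and the potential term is controlled by Fatou's lemma. -/
instance (h : HypH1 a) : CompleteSpace (FormSpace h) := by
  refine Metric.complete_of_cauchySeq_tendsto fun F hF => ?_
  obtain ⟨g, hg⟩ := cauchySeq_tendsto_of_complete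
    ((FormSpace.valL (h := h)).uniformContinuous.comp_cauchySeq hF)
  choose p hp using fun (i : Fin m) (k : Fin d) => cauchySeq_tendsto_of_complete
    ((FormSpace.gradL (h := h) i k).uniformContinuous.comp_cauchySeq hF)
  have hcoord : ∀ i, Tendsto (fun n => coordL i (F n).val) atTop (𝓝 (coordL i g)) := fun i =>
    ((coordL i).continuous.tendsto g).comp hg
  have hweak : ∀ i k, IsWeakPartial k (fun x => g x i) (p i k) := fun i k =>
    (IsWeakPartial.of_tendsto (fun n => ((F n).mem.1.isWeakPartial i k).congr
      (coordL_coeFn i _).symm ((F n).gradL_coeFn i k).symm) (hcoord i) (hp i k)).congr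
      (coordL_coeFn i g) (ae_eq_refl _)
  have hgH : MemH1 g := fun i k => ⟨p i k, hweak i k, Lp.memLp _⟩
  -- almost everywhere convergence of the jets along a subsequence
  obtain ⟨ns, hns, hae⟩ : ∃ ns : ℕ → ℕ, StrictMono ns ∧
      ∀ᵐ x, Tendsto (fun n => jet (F (ns n)).val x) atTop (𝓝 (jet g x)) := by
    let z : ℕ → Dom d → (Fin m ⊕ Fin m × Fin d) → ℂ := fun n x =>
      Sum.elim (fun i => coordL i (F n).val x - coordL i g x)
        fun q => FormSpace.gradL q.1 q.2 (F n) x - p q.1 q.2 x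
    have hz : ∀ n, AEStronglyMeasurable (z n) volume := fun n => by
      refine AEMeasurable.aestronglyMeasurable (aemeasurable_pi_iff.2 ?_)
      rintro (i | q)
      · exact ((Lp.memLp (coordL i (F n).val)).sub (Lp.memLp (coordL i g))).1.aemeasurable
      · exact ((Lp.memLp (FormSpace.gradL q.1 q.2 (F n))).sub
          (Lp.memLp (p q.1 q.2))).1.aemeasurable
    obtain ⟨ns, hns, hae⟩ := exists_seq_tendsto_ae_of_eLpNorm hz (tendsto_eLpNorm_pi hz (by
      rintro (i | q)
      · exact (Lp.tendsto_Lp_iff_tendsto_eLpNorm' _ _).1 (hcoord i)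
      · exact (Lp.tendsto_Lp_iff_tendsto_eLpNorm' _ _).1 (hp q.1 q.2)))
    refine ⟨ns, hns, ?_⟩
    have e1 : ∀ᵐ x, ∀ n i, coordL i (F n).val x = (F n).val x i := by
      simp only [ae_all_iff]; exact fun n i => coordL_coeFn i _
    have e2 : ∀ᵐ x, ∀ i, coordL i g x = g x i := by
      simp only [ae_all_iff]; exact fun i => coordL_coeFn i _
    have e3 : ∀ᵐ x, ∀ n i k, FormSpace.gradL i k (F n) x = grad (F n).val i x k := by
      simp only [ae_all_iff]; exact fun n i k => FormSpace.gradL_coeFn _ i k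
    have e4 : ∀ᵐ x, ∀ i k, grad g i x k = p i k x := by
      simp only [ae_all_iff]; exact fun i k => grad_ae_eq (hweak i k)
    filter_upwards [hae, e1, e2, e3, e4] with x hx h1 h2 h3 h4
    rw [tendsto_pi_nhds] at hx
    refine Tendsto.prodMk_nhds (tendsto_pi_nhds.2 fun i => ?_)
      (tendsto_pi_nhds.2 fun i => tendsto_pi_nhds.2 fun k => ?_)
    · have := (hx (Sum.inl i)).add_const (coordL i g x)
      simpa [z, h1, h2] using this
    · have := (hx (Sum.inr (i, k))).add_const (p i k x)
      simpa [z, h3, h4] using this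
  have hfatou : ∀ ε > 0, ∃ N, ∀ n ≥ N,
      ∫⁻ x, ENNReal.ofReal (weight a x (jet (F n).val x - jet g x)) ≤ ENNReal.ofReal (ε ^ 2) := by
    intro ε hε
    obtain ⟨N, hN⟩ := Metric.cauchySeq_iff.1 hF ε hε
    refine ⟨N, fun n hn => ?_⟩
    calc ∫⁻ x, ENNReal.ofReal (weight a x (jet (F n).val x - jet g x))
        ≤ ∫⁻ x, liminf (fun l => ENNReal.ofReal
            (weight a x (jet (F n).val x - jet (F (ns l)).val x))) atTop := by
          refine lintegral_mono_ae ?_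
          filter_upwards [hae] with x hx
          refine le_of_eq (Tendsto.liminf_eq ?_).symm
          exact ENNReal.tendsto_ofReal (((weight_continuous x).tendsto _).comp
            (tendsto_const_nhds.sub hx))
      _ ≤ liminf (fun l => ∫⁻ x, ENNReal.ofReal
            (weight a x (jet (F n).val x - jet (F (ns l)).val x))) atTop :=
          lintegral_liminf_le' fun l => (aestronglyMeasurable_weight h (F n).mem.1
            (F (ns l)).mem.1).aemeasurable.ennreal_ofReal
      _ ≤ ENNReal.ofReal (ε ^ 2) := by
          refine liminf_le_of_frequently_le' (Eventually.frequently ?_)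
          filter_upwards [hns.tendsto_atTop.eventually_ge_atTop N] with l hl
          rw [lintegral_weight_sub]
          refine ENNReal.ofReal_le_ofReal ?_
          have := (hN n hn (ns l) hl).le
          rw [dist_eq_norm] at this
          gcongr
  have hgD : MemFormDomain a g := by
    obtain ⟨N, hN⟩ := hfatou 1 one_pos
    have hint : Integrable fun x => weight a x (jet (F N).val x - jet g x) := by
      refine ⟨aestronglyMeasurable_weight h (F N).mem.1 hgH, ?_⟩
      rw [hasFiniteIntegral_iff_ofReal (Eventually.of_forall fun x => weight_nonneg h x _)]
      exact (hN N le_rfl).trans_lt ENNReal.ofReal_lt_top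
    have hsub : MemFormDomain a ((-1 : ℂ) • ((F N).val + (-1 : ℂ) • g)) := by
      refine MemFormDomain.smul h _ (memFormDomain_of_le h ((F N).mem.1.add (hgH.smul _)) hint ?_)
      filter_upwards [jet_add (F N).mem.1 (hgH.smul (-1)), jet_smul (-1) hgH] with x h1 h2
      rw [h1, h2, neg_one_smul, ← sub_eq_add_neg]
      exact pair_V_re_le_weight x _
    have e : g = (F N).val + (-1 : ℂ) • ((F N).val + (-1 : ℂ) • g) := by module
    rw [e]
    exact (F N).mem.add h hsub
  obtain ⟨G, hG⟩ := FormSpace.exists_val_eq (h := h) hgD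
  refine ⟨G, Metric.tendsto_atTop.2 fun ε hε => ?_⟩
  obtain ⟨N, hN⟩ := hfatou (ε / 2) (by positivity)
  refine ⟨N, fun n hn => ?_⟩
  have h1 := hN n hn
  rw [← hG, lintegral_weight_sub, ENNReal.ofReal_le_ofReal_iff (by positivity)] at h1
  have h2 := le_of_sq_le_sq h1 (by positivity)
  rw [dist_eq_norm]
  linarith

end Completeness

/-! ### The form, the Lax–Milgram theorem and the resolvent equation -/

section LaxMilgram

/-- **Lax–Milgram theorem** for sesquilinear forms on a complex Hilbert space. -/
theorem exists_eq_of_coercive {W : Type*} [NormedAddCommGroup W] [InnerProductSpace ℂ W]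
    [CompleteSpace W] (B : W →L⋆[ℂ] W →L[ℂ] ℂ) {c : ℝ} (hc : 0 < c)
    (hB : ∀ v, c * ‖v‖ ^ 2 ≤ (B v v).re) (Λ : W →L[ℂ] ℂ) : ∃ u, ∀ v, B u v = Λ v := by
  set T := InnerProductSpace.continuousLinearMapOfBilin (𝕜 := ℂ) B with hT
  have hTB : ∀ u v, inner ℂ (T u) v = B u v := fun u v =>
    InnerProductSpace.continuousLinearMapOfBilin_apply B u v
  have hbelow : ∀ v, c * ‖v‖ ≤ ‖T v‖ := by
    intro v
    rcases eq_or_ne v 0 with rfl | hv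
    · simp
    have h1 : c * ‖v‖ ^ 2 ≤ ‖T v‖ * ‖v‖ := by
      refine (hB v).trans ?_
      rw [← hTB]
      exact re_inner_le_norm (𝕜 := ℂ) _ _
    have h2 : 0 < ‖v‖ := norm_pos_iff.2 hv
    refine le_of_mul_le_mul_right ?_ h2
    linarith [sq ‖v‖, mul_assoc c ‖v‖ ‖v‖]
  have hanti : AntilipschitzWith (c⁻¹).toNNReal T := by
    refine T.antilipschitz_of_bound fun v => ?_
    rw [Real.coe_toNNReal _ (inv_nonneg.2 hc.le), inv_mul_eq_div, le_div_iff₀' hc]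
    exact hbelow v
  have hclosed : IsClosed (LinearMap.range (T : W →ₗ[ℂ] W) : Set W) :=
    hanti.isClosed_range T.uniformContinuous
  have htop : LinearMap.range (T : W →ₗ[ℂ] W) = ⊤ := by
    have := hclosed.completeSpace_coe
    rw [← Submodule.orthogonal_orthogonal (LinearMap.range (T : W →ₗ[ℂ] W)),
      Submodule.eq_top_iff']
    intro v w hw
    have h1 : inner ℂ (T w) w = 0 := hw _ ⟨w, rfl⟩
    have h2 := hB w
    rw [← hTB, h1, Complex.zero_re] at h2
    have h3 : ‖w‖ = 0 := by
      have := nonpos_of_mul_nonpos_right h2 hc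
      nlinarith [norm_nonneg w]
    rw [norm_eq_zero.1 h3, inner_zero_left]
  obtain ⟨u, hu⟩ := (LinearMap.range_eq_top.1 htop) ((InnerProductSpace.toDual ℂ W).symm Λ)
  refine ⟨u, fun v => ?_⟩
  have hu' : T u = (InnerProductSpace.toDual ℂ W).symm Λ := hu
  rw [← hTB, hu', InnerProductSpace.toDual_symm_apply]

end LaxMilgram

section Form

variable {d m : ℕ} {a : Coeffs d m}

/-- The density of the form, as a function of the jets of its two arguments. -/
noncomputable def formDensity (a : Coeffs d m) (x : Dom d) (J K : Jet d m) : ℂ :=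
  (∑ i, pair (a.Q x) (J.2 i) (K.2 i)) + firstOrder (fun i j k => a.F i j x k) J.2 K.1 +
    conj (firstOrder (fun i j k => a.C j i x k) K.2 J.1) + pair (a.V x) J.1 K.1

theorem firstOrder_add_left (b : Fin m → Fin m → Fin d → ℝ) (p p' : Fin m → Fin d → ℂ)
    (ζ : Fin m → ℂ) : firstOrder b (p + p') ζ = firstOrder b p ζ + firstOrder b p' ζ := by
  simp only [firstOrder, Pi.add_apply, mul_add, Finset.sum_add_distrib, add_mul]

theorem firstOrder_smul_left (b : Fin m → Fin m → Fin d → ℝ) (c : ℂ) (p : Fin m → Fin d → ℂ)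
    (ζ : Fin m → ℂ) : firstOrder b (c • p) ζ = c * firstOrder b p ζ := by
  simp only [firstOrder, Pi.smul_apply, smul_eq_mul, Finset.mul_sum, Finset.sum_mul]
  exact Finset.sum_congr rfl fun i _ => Finset.sum_congr rfl fun j _ =>
    Finset.sum_congr rfl fun k _ => by ring

theorem firstOrder_add_right (b : Fin m → Fin m → Fin d → ℝ) (p : Fin m → Fin d → ℂ)
    (ζ ζ' : Fin m → ℂ) : firstOrder b p (ζ + ζ') = firstOrder b p ζ + firstOrder b p ζ' := by
  simp only [firstOrder, Pi.add_apply, map_add, mul_add, Finset.sum_add_distrib]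

theorem firstOrder_smul_right (b : Fin m → Fin m → Fin d → ℝ) (c : ℂ) (p : Fin m → Fin d → ℂ)
    (ζ : Fin m → ℂ) : firstOrder b p (c • ζ) = conj c * firstOrder b p ζ := by
  simp only [firstOrder, Pi.smul_apply, smul_eq_mul, map_mul, Finset.mul_sum]
  exact Finset.sum_congr rfl fun i _ => Finset.sum_congr rfl fun j _ => by ring

theorem formDensity_add_left (x : Dom d) (J J' K : Jet d m) :
    formDensity a x (J + J') K = formDensity a x J K + formDensity a x J' K := by
  simp only [formDensity, Prod.fst_add, Prod.snd_add, Pi.add_apply, pair_add_left,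
    firstOrder_add_left, firstOrder_add_right, map_add, Finset.sum_add_distrib]
  ring

theorem formDensity_smul_left (x : Dom d) (c : ℂ) (J K : Jet d m) :
    formDensity a x (c • J) K = c * formDensity a x J K := by
  simp only [formDensity, Prod.smul_fst, Prod.smul_snd, Pi.smul_apply, pair_smul_left,
    firstOrder_smul_left, firstOrder_smul_right, map_mul, Complex.conj_conj, ← Finset.mul_sum]
  ring

theorem formDensity_add_right (x : Dom d) (J K K' : Jet d m) :
    formDensity a x J (K + K') = formDensity a x J K + formDensity a x J K' := by
  simp only [formDensity, Prod.fst_add, Prod.snd_add, Pi.add_apply, pair_add_right,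
    firstOrder_add_left, firstOrder_add_right, map_add, Finset.sum_add_distrib]
  ring

theorem formDensity_smul_right (x : Dom d) (c : ℂ) (J K : Jet d m) :
    formDensity a x J (c • K) = conj c * formDensity a x J K := by
  simp only [formDensity, Prod.smul_fst, Prod.smul_snd, Pi.smul_apply, pair_smul_right,
    firstOrder_smul_left, firstOrder_smul_right, map_mul, ← Finset.mul_sum]
  ring

theorem memLp_bounded_mul {b : Dom d → Dom d} (hb : MemLp b ∞ volume) (k : Fin d)
    {u : Dom d → ℂ} (hu : MemLp u 2 volume) : MemLp (fun x => (b x k : ℂ) * u x) 2 volume :=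
  MemLp.mul (p := ∞) (q := 2) (r := 2) hu (hb.eval_piLp k).ofReal

section Integrability

variable {f g : L2 d m}

theorem integrable_pair_Q (h : HypH1 a) (hf : MemH1 f) (hg : MemH1 g) (i : Fin m) :
    Integrable fun x => pair (a.Q x) (grad f i x) (grad g i x) := by
  obtain ⟨C, hC, hQ⟩ := h.exists_norm_pair_Q_le
  refine ((hf.integrable_gradSq.add hg.integrable_gradSq).const_mul C).mono' ?_
    (Eventually.of_forall fun x => (hQ x _ _).trans ?_)
  · exact aestronglyMeasurable_pair_Q h (fun k => (hf.memLp_grad i k).1)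
      fun k => (hg.memLp_grad i k).1
  · exact mul_le_mul_of_nonneg_left (add_le_add (sum_sq_norm_le_gradSq (jet f x) i)
      (sum_sq_norm_le_gradSq (jet g x) i)) hC

theorem integrable_F (h : HypH1 a) (hf : MemH1 f) (g : L2 d m) (i j : Fin m) :
    Integrable fun x => (∑ k, (a.F i j x k : ℂ) * grad f j x k) * conj (g x i) := by
  have h1 : MemLp (fun x => ∑ k, (a.F i j x k : ℂ) * grad f j x k) 2 volume :=
    memLp_finsetSum _ fun k _ => memLp_bounded_mul (h.bounded_F i j) k (hf.memLp_grad j k)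
  exact h1.integrable_mul (memLp_coord g i).star

theorem integrable_C (h : HypH1 a) (f : L2 d m) (hg : MemH1 g) (i j : Fin m) :
    Integrable fun x => f x j * ∑ k, (a.C i j x k : ℂ) * conj (grad g i x k) := by
  have h1 : MemLp (fun x => ∑ k, (a.C i j x k : ℂ) * conj (grad g i x k)) 2 volume :=
    memLp_finsetSum _ fun k _ => memLp_bounded_mul (h.bounded_C i j) k (hg.memLp_grad i k).star
  exact (memLp_coord f j).integrable_mul h1

theorem conj_firstOrder_C (x : Dom d) (J K : Jet d m) :
    conj (firstOrder (fun i j k => a.C j i x k) K.2 J.1) =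
      ∑ i, ∑ j, J.1 j * ∑ k, (a.C i j x k : ℂ) * conj (K.2 i k) := by
  simp only [firstOrder, map_sum, map_mul, Complex.conj_conj, Complex.conj_ofReal]
  rw [Finset.sum_comm]
  exact Finset.sum_congr rfl fun i _ => Finset.sum_congr rfl fun j _ => mul_comm _ _

theorem integrable_formDensity (h : HypH1 a) (hf : MemFormDomain a f) (hg : MemFormDomain a g) :
    Integrable fun x => formDensity a x (jet f x) (jet g x) := by
  unfold formDensity
  simp only [conj_firstOrder_C]
  exact (((integrable_finsetSum _ fun i _ => integrable_pair_Q h hf.1 hg.1 i).add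
    (integrable_finsetSum _ fun i _ => integrable_finsetSum _ fun j _ =>
      integrable_F h hf.1 g i j)).add
    (integrable_finsetSum _ fun i _ => integrable_finsetSum _ fun j _ =>
      integrable_C h f hg.1 i j)).add (integrable_pair_V h hf hg)

theorem form_eq_integral (h : HypH1 a) (hf : MemFormDomain a f) (hg : MemFormDomain a g) :
    form a f g = ∫ x, formDensity a x (jet f x) (jet g x) := by
  have i1 := fun i => integrable_pair_Q h hf.1 hg.1 i
  have i2 := fun i j => integrable_F h hf.1 g i j
  have i3 := fun i j => integrable_C h f hg.1 i j
  have i4 := integrable_pair_V h hf hg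
  have s1 := integrable_finsetSum Finset.univ fun i _ => i1 i
  have s2 := integrable_finsetSum Finset.univ fun i _ =>
    integrable_finsetSum Finset.univ fun j _ => i2 i j
  have s3 := integrable_finsetSum Finset.univ fun i _ =>
    integrable_finsetSum Finset.univ fun j _ => i3 i j
  have e : ∫ x, formDensity a x (jet f x) (jet g x) =
      (∫ x, ∑ i, pair (a.Q x) (grad f i x) (grad g i x)) +
      (∫ x, ∑ i, ∑ j, (∑ k, (a.F i j x k : ℂ) * grad f j x k) * conj (g x i)) +
      (∫ x, ∑ i, ∑ j, f x j * ∑ k, (a.C i j x k : ℂ) * conj (grad g i x k)) +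
      ∫ x, pair (a.V x) (jet f x).1 (jet g x).1 := by
    have e1 := integral_add s1 s2
    have e2 := integral_add (s1.add s2) s3
    have e3 := integral_add ((s1.add s2).add s3) i4
    rw [← e1]
    refine Eq.trans ?_ (e3.trans (congrArg (· + _) e2))
    refine integral_congr_ae (Eventually.of_forall fun x => ?_)
    simp only [formDensity, conj_firstOrder_C]
    rfl
  rw [e, integral_finsetSum _ fun i _ => i1 i,
    integral_finsetSum _ fun i _ => integrable_finsetSum _ fun j _ => i2 i j,
    integral_finsetSum _ fun i _ => integrable_finsetSum _ fun j _ => i3 i j]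
  simp only [fun i => integral_finsetSum Finset.univ fun j _ => i2 i j,
    fun i => integral_finsetSum Finset.univ fun j _ => i3 i j]
  rfl

end Integrability

variable {h : HypH1 a}

theorem form_add_left (f f' g : FormSpace h) :
    form a (f + f').val g.val = form a f.val g.val + form a f'.val g.val := by
  rw [form_eq_integral h (f + f').mem g.mem, form_eq_integral h f.mem g.mem,
    form_eq_integral h f'.mem g.mem, ← integral_add (integrable_formDensity h f.mem g.mem)
      (integrable_formDensity h f'.mem g.mem)]
  refine integral_congr_ae ?_
  filter_upwards [jet_add f.mem.1 f'.mem.1] with x hx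
  rw [map_add, hx, formDensity_add_left]

theorem form_add_right (f g g' : FormSpace h) :
    form a f.val (g + g').val = form a f.val g.val + form a f.val g'.val := by
  rw [form_eq_integral h f.mem (g + g').mem, form_eq_integral h f.mem g.mem,
    form_eq_integral h f.mem g'.mem, ← integral_add (integrable_formDensity h f.mem g.mem)
      (integrable_formDensity h f.mem g'.mem)]
  refine integral_congr_ae ?_
  filter_upwards [jet_add g.mem.1 g'.mem.1] with x hx
  rw [map_add, hx, formDensity_add_right]

theorem form_smul_left (c : ℂ) (f g : FormSpace h) :
    form a (c • f).val g.val = c * form a f.val g.val := by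
  rw [form_eq_integral h (c • f).mem g.mem, form_eq_integral h f.mem g.mem, ← integral_const_mul]
  refine integral_congr_ae ?_
  filter_upwards [jet_smul c f.mem.1] with x hx
  rw [map_smul, hx, formDensity_smul_left]

theorem form_smul_right (c : ℂ) (f g : FormSpace h) :
    form a f.val (c • g).val = conj c * form a f.val g.val := by
  rw [form_eq_integral h f.mem (c • g).mem, form_eq_integral h f.mem g.mem, ← integral_const_mul]
  refine integral_congr_ae ?_
  filter_upwards [jet_smul c g.mem.1] with x hx
  rw [map_smul, hx, formDensity_smul_right]

theorem exists_norm_formDensity_le (h : HypH1 a) : ∃ C : ℝ, 0 ≤ C ∧ ∀ᵐ x, ∀ J K : Jet d m,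
    ‖formDensity a x J K‖ ≤ C * (weight a x J + weight a x K) := by
  obtain ⟨CQ, hCQ, hQ⟩ := h.exists_norm_pair_Q_le
  obtain ⟨κF, -, hκF⟩ := exists_bound_of_memLp_top h.bounded_F
  obtain ⟨κC, -, hκC⟩ := exists_bound_of_memLp_top h.bounded_C
  obtain ⟨CF, hCF, hF⟩ := exists_norm_firstOrder_le (d := d) (m := m) κF one_pos
  obtain ⟨CC, hCC, hC⟩ := exists_norm_firstOrder_le (d := d) (m := m) κC one_pos
  obtain ⟨M, hM, hV⟩ := h.exists_norm_pair_V_le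
  refine ⟨CQ + (1 + CF) + (1 + CC) + M, by positivity, ?_⟩
  filter_upwards [hκF, hκC] with x h1 h2 J K
  have b1 : ‖∑ i, pair (a.Q x) (J.2 i) (K.2 i)‖ ≤ CQ * (gradSq J + gradSq K) := by
    refine (norm_sum_le_of_le _ fun i _ => hQ x (J.2 i) (K.2 i)).trans (le_of_eq ?_)
    rw [← Finset.mul_sum, Finset.sum_add_distrib]
    rfl
  have b2 := hF (fun i j k => a.F i j x k) h1 J.2 K.1
  have b3 := hC (fun i j k => a.C j i x k) (fun i j k => h2 j i k) K.2 J.1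
  have b4 := hV x J.1 K.1
  change _ ≤ 1 * gradSq J + CF * valSq K at b2
  change _ ≤ 1 * gradSq K + CC * valSq J at b3
  have n1 := gradSq_le_weight h x J
  have n2 := gradSq_le_weight h x K
  have n3 := valSq_le_weight h x J
  have n4 := valSq_le_weight h x K
  have n5 := pair_V_re_le_weight (a := a) x J
  have n6 := pair_V_re_le_weight (a := a) x K
  have w1 := weight_nonneg h x J
  have w2 := weight_nonneg h x K
  have c1 := mul_le_mul_of_nonneg_left (add_le_add n1 n2) hCQ
  have c2 := mul_le_mul_of_nonneg_left n4 hCF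
  have c3 := mul_le_mul_of_nonneg_left n3 hCC
  have c4 := mul_le_mul_of_nonneg_left (add_le_add n5 n6) hM
  have c5 := mul_nonneg hCF w1
  have c6 := mul_nonneg hCC w2
  have e : ‖formDensity a x J K‖ ≤ ‖∑ i, pair (a.Q x) (J.2 i) (K.2 i)‖ +
      ‖firstOrder (fun i j k => a.F i j x k) J.2 K.1‖ +
      ‖firstOrder (fun i j k => a.C j i x k) K.2 J.1‖ + ‖pair (a.V x) J.1 K.1‖ := by
    refine (norm_add_le _ _).trans (add_le_add_left ((norm_add_le _ _).trans ?_) _)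
    rw [RCLike.norm_conj]
    exact add_le_add_left (norm_add_le _ _) _
  linarith

/-- Pointwise Gårding inequality for the form. -/
theorem exists_formDensity_re_ge (h : HypH1 a) : ∃ α w : ℝ, 0 < α ∧ 0 ≤ w ∧
    ∀ᵐ x, ∀ J : Jet d m, α * weight a x J ≤ (formDensity a x J J).re + w * valSq J := by
  obtain ⟨η₁, η₂, hη, -, hQ⟩ := h.exists_pair_Q_bounds
  obtain ⟨κF, -, hκF⟩ := exists_bound_of_memLp_top h.bounded_F
  obtain ⟨κC, -, hκC⟩ := exists_bound_of_memLp_top h.bounded_C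
  obtain ⟨CF, hCF, hF⟩ := exists_norm_firstOrder_le (d := d) (m := m) κF
    (show 0 < η₁ / 4 by positivity)
  obtain ⟨CC, hCC, hC⟩ := exists_norm_firstOrder_le (d := d) (m := m) κC
    (show 0 < η₁ / 4 by positivity)
  have hα : 0 < min (η₁ / 2) 1 := lt_min (by positivity) one_pos
  refine ⟨min (η₁ / 2) 1, min (η₁ / 2) 1 + CF + CC, hα, by positivity, ?_⟩
  filter_upwards [hκF, hκC] with x h1 h2 J
  have b1 : η₁ * gradSq J ≤ (∑ i, pair (a.Q x) (J.2 i) (J.2 i)).re := by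
    rw [Complex.re_sum, gradSq, Finset.mul_sum]
    exact Finset.sum_le_sum fun i _ => (hQ x (J.2 i)).1
  have b2 := hF (fun i j k => a.F i j x k) h1 J.2 J.1
  have b3 := hC (fun i j k => a.C j i x k) (fun i j k => h2 j i k) J.2 J.1
  change _ ≤ η₁ / 4 * gradSq J + CF * valSq J at b2
  change _ ≤ η₁ / 4 * gradSq J + CC * valSq J at b3
  have r2 := (abs_le.1 (Complex.abs_re_le_norm (firstOrder (fun i j k => a.F i j x k) J.2 J.1))).1
  have r3 := (abs_le.1 (Complex.abs_re_le_norm (firstOrder (fun i j k => a.C j i x k) J.2 J.1))).1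
  have n1 := mul_le_mul_of_nonneg_right (min_le_left (η₁ / 2) 1) (gradSq_nonneg J)
  have n2 := mul_le_mul_of_nonneg_right (min_le_right (η₁ / 2) 1) (h.pair_V_re_nonneg x J.1)
  simp only [formDensity, weight, Complex.add_re, Complex.conj_re]
  linarith

/-- Boundedness of the form in the form norm. -/
theorem exists_norm_form_le (h : HypH1 a) : ∃ C : ℝ, ∀ f g : FormSpace h,
    ‖form a f.val g.val‖ ≤ C * ‖f‖ * ‖g‖ := by
  obtain ⟨C, hC, hle⟩ := exists_norm_formDensity_le h
  have h1 : ∀ f g : FormSpace h, ‖form a f.val g.val‖ ≤ C * (‖f‖ ^ 2 + ‖g‖ ^ 2) := by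
    intro f g
    rw [form_eq_integral h f.mem g.mem, FormSpace.norm_sq_eq, FormSpace.norm_sq_eq,
      ← integral_add f.mem.integrable_weight g.mem.integrable_weight, ← integral_const_mul]
    refine norm_integral_le_of_norm_le
      ((f.mem.integrable_weight.add g.mem.integrable_weight).const_mul C) ?_
    filter_upwards [hle] with x hx using hx _ _
  refine ⟨2 * C, fun f g => ?_⟩
  rcases eq_or_ne f 0 with rfl | hf
  · have := form_smul_left (h := h) 0 0 g
    rw [zero_smul, zero_mul] at this
    rw [this]
    simp
  rcases eq_or_ne g 0 with rfl | hg
  · have := form_smul_right (h := h) 0 f 0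
    rw [zero_smul, map_zero (starRingEnd ℂ), zero_mul] at this
    rw [this]
    simp
  have hf' : 0 < ‖f‖ := norm_pos_iff.2 hf
  have hg' : 0 < ‖g‖ := norm_pos_iff.2 hg
  -- scale both arguments to the same norm
  have h2 := h1 ((‖g‖ : ℂ) • f) ((‖f‖ : ℂ) • g)
  rw [form_smul_left, form_smul_right, norm_mul, norm_mul, norm_smul, norm_smul,
    RCLike.norm_conj, Complex.norm_real, Complex.norm_real, norm_norm, norm_norm] at h2
  have h3 : 0 < ‖f‖ * ‖g‖ := by positivity
  refine le_of_mul_le_mul_left ?_ h3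
  linarith [show C * ((‖g‖ * ‖f‖) ^ 2 + (‖f‖ * ‖g‖) ^ 2) = ‖f‖ * ‖g‖ * (2 * C * ‖f‖ * ‖g‖) by ring]

/-- Gårding inequality: a shift of the form is coercive in the form norm. -/
theorem exists_form_re_ge (h : HypH1 a) : ∃ α w : ℝ, 0 < α ∧ 0 ≤ w ∧ ∀ f : FormSpace h,
    α * ‖f‖ ^ 2 ≤ (form a f.val f.val).re + w * ‖f.val‖ ^ 2 := by
  obtain ⟨α, w, hα, hw, hle⟩ := exists_formDensity_re_ge h
  refine ⟨α, w, hα, hw, fun f => ?_⟩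
  have i1 := integrable_formDensity h f.mem f.mem
  have e := integral_re i1
  change ∫ x, (formDensity a x (jet f.val x) (jet f.val x)).re = _ at e
  rw [form_eq_integral h f.mem f.mem, FormSpace.norm_sq_eq, ← integral_valSq]
  change _ ≤ RCLike.re (∫ x, formDensity a x (jet f.val x) (jet f.val x)) + _
  have e' := integral_add i1.re ((integrable_valSq f.val).const_mul w)
  change _ = (∫ x, (formDensity a x (jet f.val x) (jet f.val x)).re) + _ at e'
  rw [← e, ← integral_const_mul, ← integral_const_mul, ← e']
  refine integral_mono_ae (f.mem.integrable_weight.const_mul α)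
    (i1.re.add ((integrable_valSq _).const_mul w)) ?_
  filter_upwards [hle] with x hx using hx _

/-- The conjugate of the form (so that it is conjugate linear in the first argument) as a bounded
sesquilinear form on the form space. -/
theorem exists_conj_form (h : HypH1 a) : ∃ B : FormSpace h →L⋆[ℂ] FormSpace h →L[ℂ] ℂ,
    ∀ f g, B f g = conj (form a f.val g.val) := by
  obtain ⟨C, hC⟩ := exists_norm_form_le h
  exact ⟨(LinearMap.mk₂'ₛₗ (starRingEnd ℂ) (RingHom.id ℂ)
      (fun f g : FormSpace h => conj (form a f.val g.val))
      (fun f f' g => by rw [form_add_left, map_add])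
      (fun c f g => by rw [form_smul_left, map_mul, smul_eq_mul])
      (fun f g g' => by rw [form_add_right, map_add])
      (fun c f g => by
        rw [form_smul_right, map_mul, Complex.conj_conj, RingHom.id_apply, smul_eq_mul])).mkContinuous₂
      C fun f g => by
        rw [LinearMap.mk₂'ₛₗ_apply, RCLike.norm_conj]; exact hC f g, fun f g => rfl⟩

/-- The graph of the realization of `𝓛` in `L²` as a subspace. -/
def realizationGraph (h : HypH1 a) : Submodule ℂ (L2 d m × L2 d m) where
  carrier := {p | IsL2Realization a p.1 p.2}
  add_mem' := by
    rintro ⟨f, y⟩ ⟨f', y'⟩ ⟨hf, hfy⟩ ⟨hf', hfy'⟩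
    refine ⟨hf.add h hf', fun g hg => ?_⟩
    have e := form_add_left (h := h) ⟨f, hf⟩ ⟨f', hf'⟩ ⟨g, hg⟩
    have e1 := hfy g hg
    have e2 := hfy' g hg
    change form a (f + f') g = -inner ℂ g (y + y')
    rw [inner_add_right, neg_add]
    exact e.trans (congrArg₂ (· + ·) e1 e2)
  zero_mem' := by
    refine ⟨memFormDomain_zero, fun g hg => ?_⟩
    have e := form_smul_left (h := h) 0 0 ⟨g, hg⟩
    rw [zero_smul, zero_mul, map_zero] at e
    exact e.trans (by simp)
  smul_mem' := by
    rintro c ⟨f, y⟩ ⟨hf, hfy⟩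
    refine ⟨hf.smul h c, fun g hg => ?_⟩
    have e := form_smul_left (h := h) c ⟨f, hf⟩ ⟨g, hg⟩
    have e1 := hfy g hg
    change form a (c • f) g = -inner ℂ g (c • y)
    rw [inner_smul_right, ← mul_neg, ← e1]
    exact e

/-- Resolvent equation: for large `l`, `l - L₂` is onto. -/
theorem exists_realizationGraph_eq {α w : ℝ} (hα : 0 < α)
    (hw : ∀ f : FormSpace h, α * ‖f‖ ^ 2 ≤ (form a f.val f.val).re + w * ‖f.val‖ ^ 2)
    {l : ℝ} (hl : w ≤ l) (y : L2 d m) : ∃ p ∈ realizationGraph h, (l : ℂ) • p.1 - p.2 = y := by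
  obtain ⟨B, hB⟩ := exists_conj_form h
  let B' : FormSpace h →L⋆[ℂ] FormSpace h →L[ℂ] ℂ :=
    B + (l : ℂ) • ((innerSL ℂ).bilinearComp FormSpace.valL FormSpace.valL)
  have hB' : ∀ u v, B' u v = conj (form a u.val v.val) + (l : ℂ) * inner ℂ u.val v.val := by
    intro u v
    change B u v + (l : ℂ) * _ = _
    rw [hB]
    rfl
  obtain ⟨u, hu⟩ := exists_eq_of_coercive B' hα (fun v => by
      refine (hw v).trans ?_
      rw [hB', Complex.add_re, Complex.conj_re, Complex.re_ofReal_mul,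
        show (inner ℂ v.val v.val).re = ‖v.val‖ ^ 2 from inner_self_eq_norm_sq (𝕜 := ℂ) v.val]
      gcongr) ((innerSL ℂ y).comp FormSpace.valL)
  refine ⟨(u.val, (l : ℂ) • u.val - y), ⟨u.mem, fun g hg => ?_⟩, by simp⟩
  have h1 : conj (form a u.val g) + (l : ℂ) * inner ℂ u.val g = inner ℂ y g := by
    exact (hB' u ⟨g, hg⟩).symm.trans (hu ⟨g, hg⟩)
  have h2 := congrArg conj h1
  simp only [map_add, map_mul, Complex.conj_conj, Complex.conj_ofReal, inner_conj_symm] at h2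
  simp only [inner_sub_right, inner_smul_right]
  linear_combination h2

/-- The form domain is dense, since it contains the functions with one nonzero component, which is
a test function. -/
theorem eq_zero_of_inner_formDomain (h : HypH1 a) {y : L2 d m}
    (hy : ∀ g, MemFormDomain a g → inner ℂ g y = 0) : y = 0 := by
  have hcoord : ∀ i, ∀ᵐ x, y x i = 0 := by
    intro i
    refine ae_eq_zero_of_integral_contDiff_smul_eq_zero
      ((memLp_coord y i).locallyIntegrable (by norm_num)) fun φ h1 h2 => ?_
    have hφ2 : MemLp φ 2 (volume : Measure (Dom d)) := h1.continuous.memLp_of_hasCompactSupport h2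
    have hval : ∀ x j, (EuclideanSpace.single i (φ x : ℂ) : EuclideanSpace ℂ (Fin m)) j =
        if j = i then (φ x : ℂ) else 0 := fun x j => by
      simp
    have hmem : MemLp (fun x => (EuclideanSpace.single i (φ x : ℂ) : EuclideanSpace ℂ (Fin m))) 2
        (volume : Measure (Dom d)) := by
      refine MemLp.of_eval_piLp fun j => ?_
      simp only [hval]
      split_ifs
      · exact hφ2.ofReal
      · exact MemLp.zero
    set g : L2 d m := hmem.toLp _
    have hg : ∀ᵐ x, ∀ j, g x j = if j = i then (φ x : ℂ) else 0 := by
      filter_upwards [hmem.coeFn_toLp] with x hx j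
      rw [hx, hval]
    have hgH : MemH1 g := by
      intro j k
      rcases eq_or_ne j i with rfl | hji
      · refine ⟨fun x => (dpart k φ x : ℂ), ((isWeakPartial_of_contDiff h1 h2).clm_comp
          Complex.ofRealCLM).congr ?_ (ae_eq_refl _),
          ((contDiff_dpart h1).continuous.memLp_of_hasCompactSupport
            (hasCompactSupport_dpart h2)).ofReal⟩
        filter_upwards [hg] with x hx
        rw [hx, if_pos rfl]
        rfl
      · refine ⟨fun _ => 0, IsWeakPartial.zero.congr ?_ (ae_eq_refl _), MemLp.zero⟩
        filter_upwards [hg] with x hx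
        rw [hx, if_neg hji]
    have hgD : MemFormDomain a g := by
      have hint : Integrable fun x => (φ x * φ x) • a.V x i i :=
        (h.locallyIntegrable_V i i).integrable_smul_left_of_hasCompactSupport
          (h1.continuous.mul h1.continuous) h2.mul_right
      refine memFormDomain_of_le h hgH hint ?_
      filter_upwards [hg] with x hx
      have e : (jet g x).1 = fun j => if j = i then (φ x : ℂ) else 0 := by
        funext j; exact hx j
      rw [e]
      simp [pair, apply_ite Complex.re]
      linarith
    have h3 := hy g hgD
    rw [L2.inner_def] at h3
    rw [← h3]
    refine integral_congr_ae ?_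
    filter_upwards [hg] with x hx
    simp [PiLp.inner_apply, hx, mul_comm, apply_ite (starRingEnd ℂ)]
  refine (Lp.eq_zero_iff_ae_eq_zero).2 ?_
  have h4 : ∀ᵐ x, ∀ i, y x i = 0 := ae_all_iff.2 hcoord
  filter_upwards [h4] with x hx
  ext i
  exact hx i

theorem realizationGraph_re_le {α w : ℝ} (hα : 0 < α)
    (hw : ∀ f : FormSpace h, α * ‖f‖ ^ 2 ≤ (form a f.val f.val).re + w * ‖f.val‖ ^ 2)
    (p : L2 d m × L2 d m) (hp : p ∈ realizationGraph h) :
    (inner ℂ p.1 p.2).re ≤ w * ‖p.1‖ ^ 2 := by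
  have h1 := hp.2 p.1 hp.1
  obtain ⟨f, hf⟩ := FormSpace.exists_val_eq (h := h) hp.1
  have h2 := hw f
  rw [hf, h1, Complex.neg_re] at h2
  have h3 : 0 ≤ α * ‖f‖ ^ 2 := by positivity
  linarith

/-- The realization is densely defined: a vector `y` orthogonal to its domain is the right-hand side
of a resolvent equation whose solution is `0`. -/
theorem dense_realizationGraph {α w : ℝ} (hα : 0 < α)
    (hw : ∀ f : FormSpace h, α * ‖f‖ ^ 2 ≤ (form a f.val f.val).re + w * ‖f.val‖ ^ 2) :
    Dense {f : L2 d m | ∃ y, (f, y) ∈ realizationGraph h} := by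
  have e : {f : L2 d m | ∃ y, (f, y) ∈ realizationGraph h} =
      ((realizationGraph h).map (LinearMap.fst ℂ _ _) : Set (L2 d m)) := by
    ext f
    constructor
    · rintro ⟨y, hy⟩
      exact ⟨(f, y), hy, rfl⟩
    · rintro ⟨⟨f', y⟩, hy, rfl⟩
      exact ⟨y, hy⟩
  rw [e, Submodule.dense_iff_topologicalClosure_eq_top, Submodule.topologicalClosure_eq_top_iff,
    Submodule.eq_bot_iff]
  intro y hy
  -- the solution `u` of the resolvent equation with right-hand side `y` vanishes
  obtain ⟨p, hp, hpy⟩ := exists_realizationGraph_eq hα hw (le_refl w) y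
  have h1 : inner ℂ p.1 y = 0 := hy _ ⟨p, hp, rfl⟩
  have h2 : ∀ g, MemFormDomain a g → form a p.1 g + (w : ℂ) * inner ℂ g p.1 = inner ℂ g y := by
    intro g hg
    rw [hp.2 g hg, ← hpy, inner_sub_right, inner_smul_right]
    ring
  have h3 := congrArg Complex.re (h2 p.1 hp.1)
  rw [h1, Complex.add_re, Complex.re_ofReal_mul, Complex.zero_re,
    show (inner ℂ p.1 p.1).re = ‖p.1‖ ^ 2 from inner_self_eq_norm_sq (𝕜 := ℂ) p.1] at h3
  obtain ⟨f, hf⟩ := FormSpace.exists_val_eq (h := h) hp.1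
  have h4 := hw f
  rw [hf, h3] at h4
  have h5 : f = 0 := by
    have h6 := nonpos_of_mul_nonpos_right h4 hα
    exact norm_eq_zero.1 (by nlinarith [norm_nonneg f])
  have h6 : p.1 = 0 := by rw [← hf, h5, map_zero]
  refine eq_zero_of_inner_formDomain h fun g hg => ?_
  rw [← h2 g hg, h6, inner_zero_right, mul_zero, add_zero]
  have := form_smul_left (h := h) 0 0 ⟨g, hg⟩
  rw [zero_smul, zero_mul, map_zero] at this
  exact this

end Form

/-! ### Truncation -/

section Truncation

/-- A nondecreasing differentiable function `Ψ` with derivative `Ψ'` that vanishes exactly on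
`(-∞, 1]`, takes values in `[0, 1]`, and is such that `Ψ' s * s` is bounded for `s ≥ 0`. The map
`z ↦ Ψ(|z|²) z` is then Lipschitz and kills the vectors of length at most `1`. -/
structure IsTruncation (Ψ Ψ' : ℝ → ℝ) : Prop where
  hasDerivAt : ∀ s, HasDerivAt Ψ (Ψ' s) s
  nonneg : ∀ s, 0 ≤ Ψ s
  le_one : ∀ s, Ψ s ≤ 1
  eq_zero : ∀ s ≤ 1, Ψ s = 0
  pos : ∀ s, 1 < s → 0 < Ψ s
  deriv_nonneg : ∀ s, 0 ≤ Ψ' s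
  bound : ∃ D, ∀ s, 0 ≤ s → Ψ' s * s ≤ D

theorem exists_isTruncation : ∃ Ψ Ψ', IsTruncation Ψ Ψ' := by
  have hd : ContDiff ℝ 1 fun s : ℝ => Real.smoothTransition (s - 1) :=
    Real.smoothTransition.contDiff.comp (contDiff_id.sub contDiff_const)
  have hmono : Monotone fun s : ℝ => Real.smoothTransition (s - 1) := fun s t hst =>
    Real.smoothTransition.monotone (sub_le_sub_right hst 1)
  have hc : Continuous (deriv fun s : ℝ => Real.smoothTransition (s - 1)) :=
    hd.continuous_deriv le_rfl
  refine ⟨fun s => Real.smoothTransition (s - 1), deriv fun s => Real.smoothTransition (s - 1),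
    fun s => (hd.differentiable (by norm_num) s).hasDerivAt,
    fun s => Real.smoothTransition.nonneg _, fun s => Real.smoothTransition.le_one _,
    fun s hs => Real.smoothTransition.zero_of_nonpos (sub_nonpos.2 hs),
    fun s hs => Real.smoothTransition.pos_of_pos (sub_pos.2 hs), fun s => hmono.deriv_nonneg, ?_⟩
  obtain ⟨D, hD⟩ := (isCompact_Icc (a := (0 : ℝ)) (b := 2)).exists_bound_of_continuousOn
    (hc.mul continuous_id).continuousOn
  refine ⟨max D 0, fun s hs => ?_⟩
  rcases le_or_gt s 2 with h2 | h2
  · exact (le_abs_self _).trans ((hD s ⟨hs, h2⟩).trans (le_max_left _ _))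
  · -- the function is constant to the right of `2`
    have : (fun s : ℝ => Real.smoothTransition (s - 1)) =ᶠ[𝓝 s] fun _ => 1 := by
      filter_upwards [lt_mem_nhds h2] with t ht
      exact Real.smoothTransition.one_of_one_le (by linarith)
    rw [this.deriv_eq, deriv_const, zero_mul]
    exact le_max_right _ _

variable {d m : ℕ} {Ψ Ψ' : ℝ → ℝ}

/-- The `k`-th partial derivative of `|f|²` in terms of the jet of `f`. -/
noncomputable def dvalSq (J : Jet d m) (k : Fin d) : ℝ := 2 * (∑ j, conj (J.1 j) * J.2 j k).re

/-- The jet of `Ψ(|f|²) f` in terms of the jet of `f`. -/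
noncomputable def truncJet (Ψ Ψ' : ℝ → ℝ) (J : Jet d m) : Jet d m :=
  (fun i => (Ψ (valSq J) : ℂ) * J.1 i,
    fun i k => (Ψ (valSq J) : ℂ) * J.2 i k + (Ψ' (valSq J) * dvalSq J k : ℝ) * J.1 i)

/-- The derivative of `z ↦ |z|²`. -/
noncomputable def sqDeriv (z : Fin m → ℂ) : (Fin m → ℂ) →L[ℝ] ℝ :=
  ∑ j, ((2 * (z j).re) • Complex.reCLM.comp (ContinuousLinearMap.proj j) +
    (2 * (z j).im) • Complex.imCLM.comp (ContinuousLinearMap.proj j))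

theorem sqDeriv_apply (z w : Fin m → ℂ) : sqDeriv z w = 2 * (∑ j, conj (z j) * w j).re := by
  simp only [sqDeriv, Complex.re_sum, Finset.mul_sum]
  rw [sum_apply]
  refine Finset.sum_congr rfl fun j _ => ?_
  simp only [add_apply, smul_apply, ContinuousLinearMap.comp_apply,
    ContinuousLinearMap.proj_apply, Complex.reCLM_apply, Complex.imCLM_apply, smul_eq_mul,
    Complex.mul_re, Complex.conj_re, Complex.conj_im]
  ring

theorem hasFDerivAt_sum_norm_sq (z : Fin m → ℂ) :
    HasFDerivAt (fun z : Fin m → ℂ => ∑ j, ‖z j‖ ^ 2) (sqDeriv z) z := by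
  refine HasFDerivAt.fun_sum fun j _ => ?_
  have h := (ContinuousLinearMap.proj (R := ℝ) (φ := fun _ : Fin m => ℂ) j).hasFDerivAt (x := z)
  have h1 := (Complex.reCLM.hasFDerivAt.comp z h).pow 2
  have h2 := (Complex.imCLM.hasFDerivAt.comp z h).pow 2
  have h3 : (fun z : Fin m → ℂ => ‖z j‖ ^ 2) = fun z => (z j).re ^ 2 + (z j).im ^ 2 := by
    funext z
    rw [← Complex.normSq_eq_norm_sq, Complex.normSq_apply]
    ring
  rw [h3]
  refine (h1.add h2).congr_fderiv ?_
  ext w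
  simp

theorem IsTruncation.hasFDerivAt (hΨ : IsTruncation Ψ Ψ') (i : Fin m) (z : Fin m → ℂ) :
    HasFDerivAt (fun z : Fin m → ℂ => Ψ (∑ j, ‖z j‖ ^ 2) • z i)
      (Ψ (∑ j, ‖z j‖ ^ 2) • ContinuousLinearMap.proj (R := ℝ) i +
        (Ψ' (∑ j, ‖z j‖ ^ 2) • sqDeriv z).smulRight (z i)) z := by
  have h1 := (hΨ.hasDerivAt (∑ j, ‖z j‖ ^ 2)).comp_hasFDerivAt z (hasFDerivAt_sum_norm_sq z)
  exact h1.smul (ContinuousLinearMap.proj (R := ℝ) (φ := fun _ : Fin m => ℂ) i).hasFDerivAt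

theorem IsTruncation.exists_norm_deriv_le (hΨ : IsTruncation Ψ Ψ') (m : ℕ) :
    ∃ L : ℝ, ∀ (i : Fin m) (z : Fin m → ℂ),
      ‖Ψ (∑ j, ‖z j‖ ^ 2) • ContinuousLinearMap.proj (R := ℝ) (φ := fun _ : Fin m => ℂ) i +
        (Ψ' (∑ j, ‖z j‖ ^ 2) • sqDeriv z).smulRight (z i)‖ ≤ L := by
  obtain ⟨D, hD⟩ := hΨ.bound
  have hD0 : 0 ≤ D := by simpa using hD 0 le_rfl
  refine ⟨1 + 2 * m * D, fun i z => ContinuousLinearMap.opNorm_le_bound _ (by positivity)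
    fun w => ?_⟩
  set s := ∑ j, ‖z j‖ ^ 2
  have hs : 0 ≤ s := by positivity
  have hle : ∀ j, ‖z j‖ ^ 2 ≤ s := fun j =>
    Finset.single_le_sum (f := fun j => ‖z j‖ ^ 2) (fun _ _ => by positivity) (Finset.mem_univ j)
  have e1 : ‖Ψ s • w i‖ ≤ ‖w‖ := by
    rw [norm_smul, Real.norm_of_nonneg (hΨ.nonneg _)]
    exact (mul_le_of_le_one_left (norm_nonneg _) (hΨ.le_one _)).trans (norm_le_pi_norm w i)
  have e2 : |sqDeriv z w| * ‖z i‖ ≤ 2 * m * s * ‖w‖ := by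
    rw [sqDeriv_apply, abs_mul, abs_two]
    have e3 : |(∑ j, conj (z j) * w j).re| ≤ ∑ j, ‖z j‖ * ‖w‖ := by
      refine (Complex.abs_re_le_norm _).trans (norm_sum_le_of_le _ fun j _ => ?_)
      rw [norm_mul, RCLike.norm_conj]
      exact mul_le_mul_of_nonneg_left (norm_le_pi_norm w j) (norm_nonneg _)
    calc 2 * |(∑ j, conj (z j) * w j).re| * ‖z i‖ ≤ 2 * (∑ j, ‖z j‖ * ‖w‖) * ‖z i‖ := by gcongr
      _ = 2 * ∑ j, ‖z j‖ * ‖z i‖ * ‖w‖ := by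
        rw [mul_assoc, Finset.sum_mul]
        exact congrArg _ (Finset.sum_congr rfl fun j _ => by ring)
      _ ≤ 2 * ∑ _j : Fin m, s * ‖w‖ := by
        gcongr with j
        nlinarith [hle i, hle j, sq_nonneg (‖z j‖ - ‖z i‖)]
      _ = 2 * m * s * ‖w‖ := by simp; ring
  have e4 : ‖(Ψ' s • sqDeriv z) w • z i‖ ≤ 2 * m * D * ‖w‖ := by
    rw [norm_smul, smul_apply, smul_eq_mul, norm_mul, Real.norm_of_nonneg (hΨ.deriv_nonneg _),
      Real.norm_eq_abs, mul_assoc]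
    have h1 := mul_le_mul_of_nonneg_left e2 (hΨ.deriv_nonneg s)
    have h2 := mul_le_mul_of_nonneg_left (hD s hs) (show 0 ≤ 2 * m * ‖w‖ by positivity)
    linarith
  have h3 : (Ψ s • ContinuousLinearMap.proj (R := ℝ) (φ := fun _ : Fin m => ℂ) i +
        (Ψ' s • sqDeriv z).smulRight (z i)) w = Ψ s • w i + (Ψ' s • sqDeriv z) w • z i := rfl
  rw [h3]
  exact (norm_add_le _ _).trans (by linarith)

theorem IsTruncation.continuous (hΨ : IsTruncation Ψ Ψ') : Continuous Ψ :=
  continuous_iff_continuousAt.2 fun s => (hΨ.hasDerivAt s).continuousAt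

theorem IsTruncation.integrable (hΨ : IsTruncation Ψ Ψ') (f : L2 d m) :
    Integrable fun x => Ψ (valSq (jet f x)) * valSq (jet f x) := by
  have i := integrable_valSq f
  refine i.mono' ((hΨ.continuous.comp_aestronglyMeasurable i.1).mul i.1)
    (Eventually.of_forall fun x => ?_)
  rw [norm_mul, Real.norm_of_nonneg (hΨ.nonneg _), Real.norm_of_nonneg (valSq_nonneg _)]
  exact mul_le_of_le_one_left (valSq_nonneg _) (hΨ.le_one _)

/-- The form domain is stable under `f ↦ Ψ(|f|²) f`. -/
theorem IsTruncation.exists_jet_eq (hΨ : IsTruncation Ψ Ψ') {a : Coeffs d m} (h : HypH1 a)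
    {u : L2 d m} (hu : MemFormDomain a u) :
    ∃ g, MemFormDomain a g ∧ ∀ᵐ x, jet g x = truncJet Ψ Ψ' (jet u x) := by
  obtain ⟨L, hL⟩ := hΨ.exists_norm_deriv_le m
  have hu2 : MemLp (fun x => (jet u x).1) 2 volume := MemLp.of_eval fun i => memLp_coord u i
  have key := fun (i : Fin m) (k : Fin d) => isWeakPartial_comp (k := k)
    (u := fun x => (jet u x).1) (v := fun x i => grad u i x k)
    (fun j => hu.1.isWeakPartial j k) hu2 (MemLp.of_eval fun i => hu.1.memLp_grad i k)
    (Φ := fun z : Fin m → ℂ => Ψ (∑ j, ‖z j‖ ^ 2) • z i) (hΨ.hasFDerivAt i) (hL i) (by simp)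
  have hg2 : MemLp (fun x => (Ψ (valSq (jet u x)) : ℂ) • u x) 2 volume := by
    refine (Lp.memLp u).of_le ?_ (Eventually.of_forall fun x => ?_)
    · exact (Complex.continuous_ofReal.comp_aestronglyMeasurable
        (hΨ.continuous.comp_aestronglyMeasurable (integrable_valSq u).1)).smul (Lp.memLp u).1
    · rw [norm_smul, Complex.norm_real, Real.norm_of_nonneg (hΨ.nonneg _)]
      exact mul_le_of_le_one_left (norm_nonneg _) (hΨ.le_one _)
  set g : L2 d m := hg2.toLp _
  have hg : ∀ᵐ x, g x = (Ψ (valSq (jet u x)) : ℂ) • u x := hg2.coeFn_toLp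
  have hw : ∀ i k, IsWeakPartial k (fun x => g x i) fun x =>
      (Ψ (valSq (jet u x)) • ContinuousLinearMap.proj (R := ℝ) (φ := fun _ : Fin m => ℂ) i +
        (Ψ' (valSq (jet u x)) • sqDeriv (jet u x).1).smulRight ((jet u x).1 i))
        fun i => grad u i x k := by
    intro i k
    refine (key i k).1.congr ?_ (ae_eq_refl _)
    filter_upwards [hg] with x hx
    rw [hx]
    rfl
  have hgH : MemH1 g := fun i k => ⟨_, hw i k, (key i k).2.2⟩
  have hjet : ∀ᵐ x, jet g x = truncJet Ψ Ψ' (jet u x) := by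
    have hgrad : ∀ᵐ x, ∀ i k, grad g i x k =
        (Ψ (valSq (jet u x)) • ContinuousLinearMap.proj (R := ℝ) (φ := fun _ : Fin m => ℂ) i +
        (Ψ' (valSq (jet u x)) • sqDeriv (jet u x).1).smulRight ((jet u x).1 i))
        fun i => grad u i x k := by
      simp only [ae_all_iff]
      exact fun i k => grad_ae_eq (hw i k)
    filter_upwards [hg, hgrad] with x h1 h2
    refine Prod.ext ?_ ?_
    · funext i
      simp only [jet, h1]
      rfl
    · funext i k
      refine (h2 i k).trans ?_
      change Ψ (valSq (jet u x)) • grad u i x k +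
        (Ψ' (valSq (jet u x)) * sqDeriv (jet u x).1 fun i => grad u i x k) • (jet u x).1 i = _
      rw [sqDeriv_apply, Complex.real_smul, Complex.real_smul]
      rfl
  refine ⟨g, memFormDomain_of_le h hgH hu.integrable_pair_V_re ?_, hjet⟩
  filter_upwards [hjet] with x hx
  have e : (jet g x).1 = (Ψ (valSq (jet u x)) : ℂ) • (jet u x).1 := by rw [hx]; rfl
  rw [e, pair_smul_left, pair_smul_right, Complex.conj_ofReal, Complex.re_ofReal_mul,
    Complex.re_ofReal_mul, ← mul_assoc]
  exact mul_le_of_le_one_left (h.pair_V_re_nonneg x _)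
    (mul_le_one₀ (hΨ.le_one _) (hΨ.nonneg _) (hΨ.le_one _))

end Truncation

/-! ### The form tested with a truncation -/

section IntegrationByParts

variable {d m : ℕ}

/-- Cutoff functions that exhaust `ℝ^d` and whose gradients are bounded and tend to `0`. -/
theorem exists_seq_cutoff (d : ℕ) : ∃ χ : ℕ → Dom d → ℝ,
    (∀ n, ContDiff ℝ ∞ (χ n)) ∧ (∀ n, HasCompactSupport (χ n)) ∧
    (∀ n x, 0 ≤ χ n x) ∧ (∀ n x, χ n x ≤ 1) ∧ (∀ x, Tendsto (fun n => χ n x) atTop (𝓝 1)) ∧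
    ∃ D : ℝ, ∀ n k x, |dpart k (χ n) x| ≤ D / (n + 1) := by
  let ψ : ContDiffBump (0 : Dom d) := ⟨1, 2, one_pos, one_lt_two⟩
  have hψ : ContDiff ℝ ∞ (ψ : Dom d → ℝ) := ψ.contDiff
  obtain ⟨D, hD⟩ := (hψ.continuous_fderiv (by simp)).bounded_above_of_compact_support
    (ψ.hasCompactSupport.fderiv ℝ)
  have hpos : ∀ n : ℕ, (0 : ℝ) < ((n : ℝ) + 1)⁻¹ := fun n => by positivity
  refine ⟨fun n x => ψ (((n : ℝ) + 1)⁻¹ • x), fun n => hψ.comp (contDiff_const_smul _), fun n => ?_,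
    fun n x => ψ.nonneg, fun n x => ψ.le_one, fun x => ?_, D, fun n k x => ?_⟩
  · exact ψ.hasCompactSupport.comp_homeomorph (Homeomorph.smulOfNeZero _ (hpos n).ne')
  · refine tendsto_const_nhds.congr' ?_
    filter_upwards [eventually_ge_atTop ⌈‖x‖⌉₊] with n hn
    refine (ψ.one_of_mem_closedBall ?_).symm
    rw [mem_closedBall_zero_iff, norm_smul, Real.norm_of_nonneg (hpos n).le, inv_mul_le_iff₀
      (by positivity), mul_one]
    have := (Nat.le_ceil ‖x‖).trans (Nat.cast_le.2 hn)
    linarith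
  · have h1 : HasFDerivAt (fun x : Dom d => ψ (((n : ℝ) + 1)⁻¹ • x))
        ((fderiv ℝ ψ (((n : ℝ) + 1)⁻¹ • x)).comp
          (((n : ℝ) + 1)⁻¹ • ContinuousLinearMap.id ℝ (Dom d))) x :=
      (hψ.differentiable (by simp) _).hasFDerivAt.comp x
        ((hasFDerivAt_id x).fun_const_smul ((n : ℝ) + 1)⁻¹)
    rw [dpart, h1.fderiv, ContinuousLinearMap.comp_apply, smul_apply,
      ContinuousLinearMap.id_apply, map_smul, smul_eq_mul, abs_mul, abs_of_pos (hpos n),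
      ← Real.norm_eq_abs, div_eq_inv_mul]
    refine mul_le_mul_of_nonneg_left ?_ (hpos n).le
    refine ((fderiv ℝ ψ _).le_of_opNorm_le (hD _) _).trans (le_of_eq ?_)
    simp

/-- A locally bounded function times a cutoff function is bounded and square integrable. -/
theorem MemLinftyLoc.memLp_mul {v χ : Dom d → ℝ} (hv : MemLinftyLoc v)
    (hχ : Continuous χ) (hχc : HasCompactSupport χ) :
    MemLp (fun x => χ x • v x) 2 volume ∧ MemLp (fun x => χ x • v x) ∞ volume := by
  obtain ⟨R, hR⟩ := hχc.isCompact.isBounded.subset_ball (0 : Dom d)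
  have h1 : (fun x => χ x • v x) = (Metric.ball (0 : Dom d) R).indicator fun x => χ x • v x := by
    refine (Set.indicator_eq_self.2 fun x hx => hR (subset_tsupport _ ?_)).symm
    intro h0
    exact hx (by simp [h0])
  have h2 : MemLp (fun x => χ x • v x) ∞ (volume.restrict (Metric.ball (0 : Dom d) R)) :=
    (hv R).smul (p := ∞) (q := ∞) (r := ∞) (hχ.memLp_top_of_hasCompactSupport hχc _)
  have : IsFiniteMeasure (volume.restrict (Metric.ball (0 : Dom d) R)) :=
    ⟨by rw [Measure.restrict_apply_univ]; exact measure_ball_lt_top⟩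
  rw [h1]
  exact ⟨(memLp_indicator_iff_restrict measurableSet_ball).2 (h2.mono_exponent le_top),
    (memLp_indicator_iff_restrict measurableSet_ball).2 h2⟩

variable {k : Fin d} {b : Dom d → ℝ} {u u' g g' : Dom d → ℂ}

/-- Integration by parts with a cutoff function `χ` and a locally Lipschitz coefficient `b`. -/
theorem integral_cutoff_mul (hb : MemW1inftyLoc b) {χ : Dom d → ℝ}
    (hχ : ContDiff ℝ ∞ χ) (hχc : HasCompactSupport χ)
    (hu : IsWeakPartial k u u') (hu2 : MemLp u 2 volume) (hu2' : MemLp u' 2 volume)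
    (hg : IsWeakPartial k g g') (hg2 : MemLp g 2 volume) (hg2' : MemLp g' 2 volume) :
    ∫ x, (χ x : ℂ) * ((b x : ℂ) * (u x * conj (g' x) + u' x * conj (g x))) =
      -∫ x, ((dpart k χ x * b x + χ x * weakPartial k b x : ℝ) : ℂ) * (u x * conj (g x)) ∧
    Integrable (fun x => (χ x : ℂ) * ((b x : ℂ) * (u x * conj (g' x) + u' x * conj (g x)))) ∧
    Integrable fun x =>
      ((dpart k χ x * b x + χ x * weakPartial k b x : ℝ) : ℂ) * (u x * conj (g x)) := by
  obtain ⟨v, hv, hv'⟩ := hb.2 k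
  have hw := isWeakPartial_weakPartial hv
  have hwL : MemLinftyLoc (weakPartial k b) := fun R =>
    (hv' R).ae_eq (EventuallyEq.symm (ae_restrict_of_ae hv.weakPartial_ae_eq))
  have p1 := hb.1.memLp_mul hχ.continuous hχc
  have p2 := hb.1.memLp_mul (contDiff_dpart (k := k) hχ).continuous (hasCompactSupport_dpart hχc)
  have p3 := hwL.memLp_mul hχ.continuous hχc
  have key := (hw.smooth_smul hχ hχc).integral_smul_mul_conj p1.1 (p2.1.add p3.1) p1.2
    (p2.2.add p3.2) hu hu2 hu2' hg hg2 hg2'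
  have i1 : Integrable fun x => u x * conj (g' x) + u' x * conj (g x) :=
    (hu2.integrable_mul hg2'.star).add (hu2'.integrable_mul hg2.star)
  have i2 : Integrable fun x => u x * conj (g x) := hu2.integrable_mul hg2.star
  have j1 := i1.mul_of_top_right p1.2.ofReal
  have j2 := i2.mul_of_top_right (p2.2.add p3.2).ofReal
  refine ⟨?_, j1.congr (Eventually.of_forall fun x => ?_), j2⟩
  · simp only [smul_eq_mul, Complex.ofReal_mul, mul_assoc] at key ⊢
    exact key
  · change ((χ x * b x : ℝ) : ℂ) * _ = _
    rw [Complex.ofReal_mul, mul_assoc]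

variable {a : Coeffs d m} {f g : L2 d m}

/-- The two first order terms with coefficients `C` whose sum can be integrated by parts. -/
noncomputable def crossTerm (a : Coeffs d m) (x : Dom d) (J K : Jet d m) : ℂ :=
  conj (firstOrder (fun i j k => a.C j i x k) K.2 J.1) +
    firstOrder (fun i j k => a.C i j x k) J.2 K.1

theorem crossTerm_eq (x : Dom d) (J K : Jet d m) : crossTerm a x J K =
    ∑ i, ∑ j, ∑ k, (a.C i j x k : ℂ) * (J.1 j * conj (K.2 i k) + J.2 j k * conj (K.1 i)) := by
  rw [crossTerm, conj_firstOrder_C, firstOrder, ← Finset.sum_add_distrib]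
  refine Finset.sum_congr rfl fun i _ => ?_
  rw [← Finset.sum_add_distrib]
  refine Finset.sum_congr rfl fun j _ => ?_
  rw [Finset.mul_sum, Finset.sum_mul, ← Finset.sum_add_distrib]
  exact Finset.sum_congr rfl fun k _ => by ring

theorem integrable_crossTerm (h : HypH1 a) (hf : MemH1 f) (hg : MemH1 g) :
    Integrable fun x => crossTerm a x (jet f x) (jet g x) := by
  unfold crossTerm
  simp only [conj_firstOrder_C]
  refine (integrable_finsetSum _ fun i _ => integrable_finsetSum _ fun j _ =>
    integrable_C h f hg i j).add (integrable_finsetSum _ fun i _ =>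
      integrable_finsetSum _ fun j _ => ?_)
  have h1 : MemLp (fun x => ∑ k, (a.C i j x k : ℂ) * grad f j x k) 2 volume :=
    memLp_finsetSum _ fun k _ => memLp_bounded_mul (h.bounded_C i j) k (hf.memLp_grad j k)
  exact h1.integrable_mul (memLp_coord g i).star

/-- The density obtained from the cross term, cut off by `χ`, by integration by parts. -/
noncomputable def cutoffDensity (a : Coeffs d m) (χ : Dom d → ℝ) (x : Dom d) (J K : Jet d m) : ℂ :=
  ∑ i, ∑ j, ∑ k, ((dpart k χ x * a.C i j x k +
    χ x * weakPartial k (fun y => a.C i j y k) x : ℝ) : ℂ) * (J.1 j * conj (K.1 i))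

theorem integral_sum_sum_sum {F : Fin m → Fin m → Fin d → Dom d → ℂ}
    (hF : ∀ i j k, Integrable (F i j k)) :
    ∫ x, ∑ i, ∑ j, ∑ k, F i j k x = ∑ i, ∑ j, ∑ k, ∫ x, F i j k x := by
  rw [integral_finsetSum _ fun i _ => integrable_finsetSum _ fun j _ =>
    integrable_finsetSum _ fun k _ => hF i j k]
  refine Finset.sum_congr rfl fun i _ => ?_
  rw [integral_finsetSum _ fun j _ => integrable_finsetSum _ fun k _ => hF i j k]
  exact Finset.sum_congr rfl fun j _ => integral_finsetSum _ fun k _ => hF i j k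

theorem integral_cutoff_crossTerm (h₂ : HypH2 a) {χ : Dom d → ℝ}
    (hχ : ContDiff ℝ ∞ χ) (hχc : HasCompactSupport χ) (hf : MemH1 f) (hg : MemH1 g) :
    ∫ x, (χ x : ℂ) * crossTerm a x (jet f x) (jet g x) =
        -∫ x, cutoffDensity a χ x (jet f x) (jet g x) ∧
      Integrable fun x => cutoffDensity a χ x (jet f x) (jet g x) := by
  have key := fun i j k => integral_cutoff_mul (k := k) (h₂.regular_C i j k) hχ hχc
    (hf.isWeakPartial j k) (memLp_coord f j) (hf.memLp_grad j k)
    (hg.isWeakPartial i k) (memLp_coord g i) (hg.memLp_grad i k)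
  have i1 := fun i j k => (key i j k).2.1
  have i2 := fun i j k => (key i j k).2.2
  refine ⟨?_, integrable_finsetSum _ fun i _ => integrable_finsetSum _ fun j _ =>
    integrable_finsetSum _ fun k _ => i2 i j k⟩
  have e1 : ∫ x, (χ x : ℂ) * crossTerm a x (jet f x) (jet g x) =
      ∑ i, ∑ j, ∑ k, ∫ x, (χ x : ℂ) * ((a.C i j x k : ℂ) *
        (f x j * conj (grad g i x k) + grad f j x k * conj (g x i))) := by
    simp only [crossTerm_eq, Finset.mul_sum]
    exact integral_sum_sum_sum i1
  have e2 : ∫ x, cutoffDensity a χ x (jet f x) (jet g x) =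
      ∑ i, ∑ j, ∑ k, ∫ x, ((dpart k χ x * a.C i j x k +
        χ x * weakPartial k (fun y => a.C i j y k) x : ℝ) : ℂ) * (f x j * conj (g x i)) := by
    exact integral_sum_sum_sum i2
  rw [e1, e2]
  simp only [fun i j k => (key i j k).1, Finset.sum_neg_distrib]

variable {Ψ Ψ' : ℝ → ℝ}

/-- Pointwise form of the divergence condition on `C`, with an error term for the cutoff. -/
theorem cutoffDensity_re_le (hΨ : IsTruncation Ψ Ψ') {x : Dom d} {γ κ δ : ℝ} (hκ : 0 ≤ κ)
    (hγ : ∀ ξ : EuclideanSpace ℝ (Fin m),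
      ∑ i, ∑ j, weakDiv (a.C i j) x * ξ i * ξ j ≤ γ * ‖ξ‖ ^ 2)
    (hC : ∀ i j k, |a.C i j x k| ≤ κ) {χ : Dom d → ℝ} (h0 : 0 ≤ χ x) (h1 : χ x ≤ 1)
    (hδ : ∀ k, |dpart k χ x| ≤ δ) (J : Jet d m) :
    (cutoffDensity a χ x J (truncJet Ψ Ψ' J)).re ≤
      δ * (m * m * d * κ) * valSq J + |γ| * (Ψ (valSq J) * valSq J) := by
  set s := valSq J
  have hs : 0 ≤ s := valSq_nonneg J
  have hΨ0 := hΨ.nonneg s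
  have split : cutoffDensity a χ x J (truncJet Ψ Ψ' J) =
      (∑ i, ∑ j, ∑ k, ((dpart k χ x * a.C i j x k : ℝ) : ℂ) * (J.1 j * conj ((Ψ s : ℂ) * J.1 i))) +
      ((χ x * Ψ s : ℝ) : ℂ) * pair (Matrix.of fun i j => weakDiv (a.C i j) x) J.1 J.1 := by
    simp only [cutoffDensity, truncJet, pair, Finset.mul_sum, Finset.sum_mul,
      ← Finset.sum_add_distrib, weakDiv, Complex.ofReal_sum, Matrix.of_apply]
    refine Finset.sum_congr rfl fun i _ => Finset.sum_congr rfl fun j _ =>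
      Finset.sum_congr rfl fun k _ => ?_
    rw [map_mul, Complex.conj_ofReal]
    push_cast
    ring
  have b1 : (∑ i, ∑ j, ∑ k, ((dpart k χ x * a.C i j x k : ℝ) : ℂ) *
      (J.1 j * conj ((Ψ s : ℂ) * J.1 i))).re ≤ δ * (m * m * d * κ) * s := by
    refine (Complex.re_le_norm _).trans ?_
    have : ‖∑ i, ∑ j, ∑ k, ((dpart k χ x * a.C i j x k : ℝ) : ℂ) *
        (J.1 j * conj ((Ψ s : ℂ) * J.1 i))‖ ≤
        ∑ _i : Fin m, ∑ _j : Fin m, ∑ _k : Fin d, δ * κ * s := by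
      refine norm_sum_le_of_le _ fun i _ => norm_sum_le_of_le _ fun j _ =>
        norm_sum_le_of_le _ fun k _ => ?_
      have hδ0 : 0 ≤ δ := (abs_nonneg _).trans (hδ k)
      rw [norm_mul, norm_mul, RCLike.norm_conj, norm_mul, Complex.norm_real, Complex.norm_real,
        Real.norm_eq_abs, abs_mul, Real.norm_of_nonneg hΨ0]
      have h3 : ‖J.1 j‖ * (Ψ s * ‖J.1 i‖) ≤ s := by
        have h4 := mul_le_of_le_one_left (norm_nonneg (J.1 i)) (hΨ.le_one s)
        have h5 := mul_le_mul_of_nonneg_left h4 (norm_nonneg (J.1 j))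
        nlinarith [sq_norm_le_valSq J i, sq_norm_le_valSq J j, sq_nonneg (‖J.1 j‖ - ‖J.1 i‖)]
      exact mul_le_mul (mul_le_mul (hδ k) (hC i j k) (abs_nonneg _) hδ0) h3 (by positivity)
        (by positivity)
    refine this.trans (le_of_eq ?_)
    simp only [Finset.sum_const, Finset.card_univ, Fintype.card_fin, nsmul_eq_mul]
    ring
  have b2 : (pair (Matrix.of fun i j => weakDiv (a.C i j) x) J.1 J.1).re ≤ γ * s := by
    have hre := hγ (WithLp.toLp 2 fun i => (J.1 i).re)
    have him := hγ (WithLp.toLp 2 fun i => (J.1 i).im)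
    rw [EuclideanSpace.real_norm_sq_eq] at hre him
    have hsum : s = (∑ k, (J.1 k).re ^ 2) + ∑ k, (J.1 k).im ^ 2 := by
      rw [← Finset.sum_add_distrib]
      refine Finset.sum_congr rfl fun k _ => ?_
      rw [← Complex.normSq_eq_norm_sq, Complex.normSq_apply]
      ring
    rw [pair_self_re, hsum, mul_add]
    simp only [Matrix.of_apply, mul_right_comm _ (_ : ℝ) (_ : ℝ)]
    simp only at hre him
    exact add_le_add hre him
  have b3 : χ x * Ψ s * (pair (Matrix.of fun i j => weakDiv (a.C i j) x) J.1 J.1).re ≤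
      |γ| * (Ψ s * s) := by
    have h3 : 0 ≤ χ x * Ψ s := mul_nonneg h0 hΨ0
    have h4 := mul_le_mul_of_nonneg_left (b2.trans
      (mul_le_mul_of_nonneg_right (le_abs_self γ) hs)) h3
    have h5 : χ x * (Ψ s * (|γ| * s)) ≤ 1 * (Ψ s * (|γ| * s)) :=
      mul_le_mul_of_nonneg_right h1 (by positivity)
    linarith
  rw [split, Complex.add_re, Complex.re_ofReal_mul]
  exact add_le_add b1 b3

/-- The cross term is bounded below on a pair `f, Ψ(|f|²) f`: this is where the divergence
condition on `C` enters, through integration by parts. -/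
theorem exists_integral_crossTerm_ge (h : HypH1 a) (h₂ : HypH2 a) : ∃ γ : ℝ, 0 ≤ γ ∧
    ∀ Ψ Ψ' : ℝ → ℝ, IsTruncation Ψ Ψ' → ∀ f g : L2 d m, MemH1 f → MemH1 g →
      (∀ᵐ x, jet g x = truncJet Ψ Ψ' (jet f x)) →
      -(γ * ∫ x, Ψ (valSq (jet f x)) * valSq (jet f x)) ≤
        (∫ x, crossTerm a x (jet f x) (jet g x)).re := by
  obtain ⟨γ, -, hγ⟩ := h₂.div_le
  obtain ⟨κ, hκ, hC⟩ := exists_bound_of_memLp_top h.bounded_C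
  refine ⟨|γ|, abs_nonneg γ, fun Ψ Ψ' hΨ f g hf hg hfg => ?_⟩
  obtain ⟨χ, c1, c2, c3, c4, c5, D, c6⟩ := exists_seq_cutoff d
  have iT := integrable_crossTerm (a := a) h hf hg
  have iΨ := hΨ.integrable f
  have hlim : Tendsto (fun n => ∫ x, (χ n x : ℂ) * crossTerm a x (jet f x) (jet g x)) atTop
      (𝓝 (∫ x, crossTerm a x (jet f x) (jet g x))) := by
    refine tendsto_integral_of_dominated_convergence (fun x => ‖crossTerm a x (jet f x) (jet g x)‖)
      (fun n => (Complex.continuous_ofReal.comp (c1 n).continuous).aestronglyMeasurable.mul iT.1)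
      iT.norm (fun n => Eventually.of_forall fun x => ?_) (Eventually.of_forall fun x => ?_)
    · rw [norm_mul, Complex.norm_real, Real.norm_of_nonneg (c3 n x)]
      exact mul_le_of_le_one_left (norm_nonneg _) (c4 n x)
    · have := ((Complex.continuous_ofReal.tendsto 1).comp (c5 x)).mul_const
        (crossTerm a x (jet f x) (jet g x))
      rwa [Complex.ofReal_one, one_mul] at this
  have hre := (Complex.continuous_re.tendsto _).comp hlim
  have herr : Tendsto (fun n : ℕ => -(D / (n + 1) * (m * m * d * κ) * (∫ x, valSq (jet f x)) +
      |γ| * ∫ x, Ψ (valSq (jet f x)) * valSq (jet f x))) atTop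
      (𝓝 (-(|γ| * ∫ x, Ψ (valSq (jet f x)) * valSq (jet f x)))) := by
    have h1 : Tendsto (fun n : ℕ => D / ((n : ℝ) + 1)) atTop (𝓝 0) := by
      have := tendsto_one_div_add_atTop_nhds_zero_nat (𝕜 := ℝ).const_mul D
      simpa [div_eq_mul_inv] using this
    have h2 := (((h1.mul_const (m * m * d * κ : ℝ)).mul_const (∫ x, valSq (jet f x))).add_const
      (|γ| * ∫ x, Ψ (valSq (jet f x)) * valSq (jet f x))).neg
    simpa using h2
  refine le_of_tendsto_of_tendsto' herr hre fun n => ?_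
  obtain ⟨e, i⟩ := integral_cutoff_crossTerm h₂ (c1 n) (c2 n) hf hg
  have e' := integral_re i
  change ∫ x, (cutoffDensity a (χ n) x (jet f x) (jet g x)).re =
    (∫ x, cutoffDensity a (χ n) x (jet f x) (jet g x)).re at e'
  simp only [Function.comp_apply]
  rw [e, Complex.neg_re, ← e', neg_le_neg_iff, ← integral_const_mul, ← integral_const_mul,
    ← integral_add ((integrable_valSq f).const_mul _) (iΨ.const_mul _)]
  refine integral_mono_ae i.re (((integrable_valSq f).const_mul _).add (iΨ.const_mul _)) ?_
  filter_upwards [hfg, hγ, hC] with x x1 x2 x3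
  rw [x1]
  exact cutoffDensity_re_le hΨ hκ x2 x3 (c3 n x) (c4 n x) (fun k => c6 n k x) (jet f x)

/-- Up to the cross term, the form density is bounded below on a pair `f, Ψ(|f|²) f`. The
derivative of `Ψ(|f|²)` contributes the nonnegative term `Ψ' ⟨Q p, p⟩ / 2`, where `p` is the
gradient of `|f|²`. -/
theorem exists_formDensity_sub_crossTerm_ge (h : HypH1 a) : ∃ w : ℝ, 0 ≤ w ∧
    ∀ Ψ Ψ' : ℝ → ℝ, IsTruncation Ψ Ψ' → ∀ᵐ x, ∀ J : Jet d m,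
      -(w * (Ψ (valSq J) * valSq J)) ≤
        (formDensity a x J (truncJet Ψ Ψ' J)).re - (crossTerm a x J (truncJet Ψ Ψ' J)).re := by
  obtain ⟨η₁, η₂, hη, -, hQ⟩ := h.exists_pair_Q_bounds
  obtain ⟨κF, -, hκF⟩ := exists_bound_of_memLp_top h.bounded_F
  obtain ⟨κC, -, hκC⟩ := exists_bound_of_memLp_top h.bounded_C
  obtain ⟨CF, hCF, hF⟩ := exists_norm_firstOrder_le (d := d) (m := m) κF
    (show 0 < η₁ / 2 by positivity)
  obtain ⟨CC, hCC, hC⟩ := exists_norm_firstOrder_le (d := d) (m := m) κC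
    (show 0 < η₁ / 2 by positivity)
  refine ⟨CF + CC, by positivity, fun Ψ Ψ' hΨ => ?_⟩
  filter_upwards [hκF, hκC] with x h1 h2 J
  set s := valSq J
  have hΨ0 := hΨ.nonneg s
  have k1 : (truncJet Ψ Ψ' J).1 = (Ψ s : ℂ) • J.1 := rfl
  let p : Fin d → ℂ := fun k => (dvalSq J k : ℂ)
  have k2 : ∀ i, (truncJet Ψ Ψ' J).2 i = (Ψ s : ℂ) • J.2 i + ((Ψ' s : ℂ) * J.1 i) • p := by
    intro i
    funext k
    simp only [truncJet, p, Pi.add_apply, Pi.smul_apply, smul_eq_mul]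
    push_cast
    ring
  have q1 : η₁ * gradSq J ≤ (∑ i, pair (a.Q x) (J.2 i) (J.2 i)).re := by
    rw [Complex.re_sum, gradSq, Finset.mul_sum]
    exact Finset.sum_le_sum fun i _ => (hQ x (J.2 i)).1
  have q2 : 0 ≤ (∑ i, conj (J.1 i) * pair (a.Q x) (J.2 i) p).re := by
    have e1 : ∑ i, conj (J.1 i) * pair (a.Q x) (J.2 i) p =
        pair (a.Q x) (fun k => ∑ i, conj (J.1 i) * J.2 i k) p := by
      simp only [pair, Finset.mul_sum, Finset.sum_mul]
      rw [Finset.sum_comm]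
      refine Finset.sum_congr rfl fun l _ => ?_
      rw [Finset.sum_comm]
      exact Finset.sum_congr rfl fun j _ => Finset.sum_congr rfl fun i _ => by ring
    have e2 : ∀ q : Fin d → ℂ, (∀ k, p k = ((2 * (q k).re : ℝ) : ℂ)) →
        (pair (a.Q x) q p).re = (1 / 2) * (pair (a.Q x) p p).re := by
      intro q hq
      simp only [pair, hq, Complex.conj_ofReal, Complex.re_sum, Complex.re_mul_ofReal,
        Complex.re_ofReal_mul, Complex.ofReal_re, Finset.mul_sum, Finset.sum_mul]
      exact Finset.sum_congr rfl fun l _ => Finset.sum_congr rfl fun j _ => by ring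
    rw [e1, e2 _ fun k => rfl]
    have := (hQ x p).1
    have : 0 ≤ η₁ * ∑ k, ‖p k‖ ^ 2 := by positivity
    linarith
  have q : ∑ i, pair (a.Q x) (J.2 i) ((truncJet Ψ Ψ' J).2 i) =
      (Ψ s : ℂ) * (∑ i, pair (a.Q x) (J.2 i) (J.2 i)) +
        (Ψ' s : ℂ) * ∑ i, conj (J.1 i) * pair (a.Q x) (J.2 i) p := by
    simp only [k2, pair_add_right, pair_smul_right, map_mul, Complex.conj_ofReal,
      Finset.sum_add_distrib, Finset.mul_sum, mul_assoc]
  have b2 := hF (fun i j k => a.F i j x k) h1 J.2 J.1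
  have b3 := hC (fun i j k => a.C i j x k) h2 J.2 J.1
  change _ ≤ η₁ / 2 * gradSq J + CF * s at b2
  change _ ≤ η₁ / 2 * gradSq J + CC * s at b3
  have r2 := (abs_le.1 (Complex.abs_re_le_norm (firstOrder (fun i j k => a.F i j x k) J.2 J.1))).1
  have r3 := (abs_le.1 (Complex.abs_re_le_norm (firstOrder (fun i j k => a.C i j x k) J.2 J.1))).2
  have r4 := h.pair_V_re_nonneg x J.1
  have r5 := mul_nonneg (hΨ.deriv_nonneg s) q2
  have r6 : -((CF + CC) * s) ≤ (∑ i, pair (a.Q x) (J.2 i) (J.2 i)).re +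
      (firstOrder (fun i j k => a.F i j x k) J.2 J.1).re -
      (firstOrder (fun i j k => a.C i j x k) J.2 J.1).re + (pair (a.V x) J.1 J.1).re := by
    linarith
  have r7 := mul_le_mul_of_nonneg_left r6 hΨ0
  rw [formDensity, crossTerm, q, k1, firstOrder_smul_right, firstOrder_smul_right, pair_smul_right,
    Complex.conj_ofReal]
  simp only [Complex.add_re, Complex.re_ofReal_mul]
  linarith

/-- The form is bounded below on the pairs `f, Ψ(|f|²) f` in terms of the weight `Ψ(|f|²) |f|²`
alone. -/
theorem exists_form_trunc_re_ge (h : HypH1 a) (h₂ : HypH2 a) : ∃ w : ℝ, 0 ≤ w ∧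
    ∀ Ψ Ψ' : ℝ → ℝ, IsTruncation Ψ Ψ' → ∀ f g : L2 d m, MemFormDomain a f → MemFormDomain a g →
      (∀ᵐ x, jet g x = truncJet Ψ Ψ' (jet f x)) →
      -(w * ∫ x, Ψ (valSq (jet f x)) * valSq (jet f x)) ≤ (form a f g).re := by
  obtain ⟨γ, hγ, H1⟩ := exists_integral_crossTerm_ge h h₂
  obtain ⟨w, hw, H2⟩ := exists_formDensity_sub_crossTerm_ge h
  refine ⟨γ + w, by positivity, fun Ψ Ψ' hΨ f g hf hg hfg => ?_⟩
  have iT := integrable_crossTerm (a := a) h hf.1 hg.1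
  have iA := integrable_formDensity h hf hg
  have iΨ := hΨ.integrable f
  have h1 := H1 Ψ Ψ' hΨ f g hf.1 hg.1 hfg
  have h2 : -(w * ∫ x, Ψ (valSq (jet f x)) * valSq (jet f x)) ≤
      ∫ x, (formDensity a x (jet f x) (jet g x) - crossTerm a x (jet f x) (jet g x)).re := by
    rw [← integral_const_mul, ← integral_neg]
    refine integral_mono_ae (iΨ.const_mul w).neg (iA.sub iT).re ?_
    filter_upwards [hfg, H2 Ψ Ψ' hΨ] with x x1 x2
    rw [x1]
    exact (x2 (jet f x)).trans (le_of_eq (Complex.sub_re _ _).symm)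
  have h3 := integral_re (iA.sub iT)
  have h4 := integral_sub iA iT
  have h5 : ∫ x, (formDensity a x (jet f x) (jet g x) - crossTerm a x (jet f x) (jet g x)).re =
      (form a f g).re - (∫ x, crossTerm a x (jet f x) (jet g x)).re := by
    rw [form_eq_integral h hf hg, ← Complex.sub_re, ← h4]
    exact h3
  linarith

end IntegrationByParts

/-! ### The unit ball of `L^∞` -/

section UnitBall

variable {d m : ℕ} {a : Coeffs d m}

/-- The square integrable functions bounded by `1`. -/
def unitBallLinfty (d m : ℕ) : Set (L2 d m) := {f | ∀ᵐ x, ‖f x‖ ≤ 1}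

theorem zero_mem_unitBallLinfty : (0 : L2 d m) ∈ unitBallLinfty d m := by
  filter_upwards [Lp.coeFn_zero (EuclideanSpace ℂ (Fin m)) 2 (volume : Measure (Dom d))] with x hx
  rw [hx]
  simp

/-- Convexity of the unit ball of `L^∞`, for the real vector space underlying the complex one. -/
theorem smul_add_smul_mem_unitBallLinfty {f g : L2 d m} (hf : f ∈ unitBallLinfty d m)
    (hg : g ∈ unitBallLinfty d m) {s t : ℝ} (hs : 0 ≤ s) (ht : 0 ≤ t) (hst : s + t = 1) :
    (s : ℂ) • f + (t : ℂ) • g ∈ unitBallLinfty d m := by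
  filter_upwards [hf, hg, Lp.coeFn_add ((s : ℂ) • f) ((t : ℂ) • g), Lp.coeFn_smul (s : ℂ) f,
    Lp.coeFn_smul (t : ℂ) g] with x h1 h2 h3 h4 h5
  rw [h3, Pi.add_apply, h4, h5]
  refine (norm_add_le _ _).trans ?_
  rw [Pi.smul_apply, Pi.smul_apply, norm_smul, norm_smul, Complex.norm_real, Complex.norm_real,
    Real.norm_of_nonneg hs, Real.norm_of_nonneg ht]
  nlinarith

/-- The unit ball of `L^∞` is closed in `L²`: pass to an almost everywhere convergent
subsequence. -/
theorem isClosed_unitBallLinfty : IsClosed (unitBallLinfty d m) := by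
  refine IsSeqClosed.isClosed fun f g hf hfg => ?_
  obtain ⟨ns, -, hns⟩ := (tendstoInMeasure_of_tendsto_Lp hfg).exists_seq_tendsto_ae
  have hf' : ∀ᵐ x, ∀ n, ‖f n x‖ ≤ 1 := ae_all_iff.2 hf
  filter_upwards [hns, hf'] with x h1 h2
  exact le_of_tendsto h1.norm (Eventually.of_forall fun n => h2 (ns n))

/-- The resolvents of `L₂`, suitably normalized, map the unit ball of `L^∞` to itself. The
resolvent equation is tested with `Ψ(|u|²) u`. -/
theorem exists_mem_unitBallLinfty (h : HypH1 a) (h₂ : HypH2 a) : ∃ w₀ : ℝ, ∀ w, w₀ ≤ w →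
    ∀ l, 0 < l → ∀ p ∈ realizationGraph h, ∀ y ∈ unitBallLinfty d m,
      ((l + w : ℝ) : ℂ) • p.1 - p.2 = (l : ℂ) • y → p.1 ∈ unitBallLinfty d m := by
  obtain ⟨w₀, -, hw₀⟩ := exists_form_trunc_re_ge h h₂
  refine ⟨w₀, fun w hw l hl p hp y hy hpy => ?_⟩
  obtain ⟨Ψ, Ψ', hΨ⟩ := exists_isTruncation
  set u := p.1
  obtain ⟨g, hg, hgu⟩ := hΨ.exists_jet_eq h hp.1
  have key := hw₀ Ψ Ψ' hΨ u g hp.1 hg hgu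
  have iΨ := hΨ.integrable u
  have hgx : ∀ᵐ x, g x = (Ψ (valSq (jet u x)) : ℂ) • u x := by
    filter_upwards [hgu] with x hx
    ext i
    exact congrFun (congrArg Prod.fst hx) i
  -- `Ψ(s)` is nonzero only for `s > 1`, where `√s ≤ s`
  have hle : ∀ x, Ψ (valSq (jet u x)) * ‖u x‖ ≤ Ψ (valSq (jet u x)) * valSq (jet u x) := by
    intro x
    rcases le_or_gt (valSq (jet u x)) 1 with h1 | h1
    · rw [hΨ.eq_zero _ h1, zero_mul, zero_mul]
    · refine mul_le_mul_of_nonneg_left ?_ (hΨ.nonneg _)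
      rw [valSq_jet] at h1 ⊢
      nlinarith [norm_nonneg (u x)]
  have iN : Integrable fun x => Ψ (valSq (jet u x)) * ‖u x‖ := by
    refine iΨ.mono' ((hΨ.continuous.comp_aestronglyMeasurable (integrable_valSq u).1).mul
      (Lp.memLp u).1.norm) (Eventually.of_forall fun x => ?_)
    rw [Real.norm_of_nonneg (mul_nonneg (hΨ.nonneg _) (norm_nonneg _))]
    exact hle x
  have e1 : (inner ℂ g u).re = ∫ x, Ψ (valSq (jet u x)) * valSq (jet u x) := by
    have h1 := integral_re (L2.integrable_inner (𝕜 := ℂ) g u)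
    rw [L2.inner_def]
    refine h1.symm.trans (integral_congr_ae ?_)
    filter_upwards [hgx] with x hx
    rw [hx, inner_smul_left, Complex.conj_ofReal, valSq_jet, ← inner_self_eq_norm_sq (𝕜 := ℂ)]
    exact Complex.re_ofReal_mul _ _
  have e2 : (inner ℂ g y).re ≤ ∫ x, Ψ (valSq (jet u x)) * ‖u x‖ := by
    have h1 := integral_re (L2.integrable_inner (𝕜 := ℂ) g y)
    rw [L2.inner_def]
    refine h1.symm.le.trans (integral_mono_ae (L2.integrable_inner (𝕜 := ℂ) g y).re iN ?_)
    filter_upwards [hgx, hy] with x hx hyx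
    refine (re_inner_le_norm (𝕜 := ℂ) _ _).trans ?_
    rw [hx, norm_smul, Complex.norm_real, Real.norm_of_nonneg (hΨ.nonneg _)]
    exact mul_le_of_le_one_right (mul_nonneg (hΨ.nonneg _) (norm_nonneg _)) hyx
  have e3 : (form a u g).re = l * (inner ℂ g y).re - (l + w) * (inner ℂ g u).re := by
    have h2 : p.2 = ((l + w : ℝ) : ℂ) • u - (l : ℂ) • y := by rw [← hpy]; abel
    rw [hp.2 g hg, h2, inner_sub_right, inner_smul_right, inner_smul_right, Complex.neg_re,
      Complex.sub_re, Complex.re_ofReal_mul, Complex.re_ofReal_mul]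
    ring
  have I0 : 0 ≤ ∫ x, Ψ (valSq (jet u x)) * valSq (jet u x) :=
    integral_nonneg fun x => mul_nonneg (hΨ.nonneg _) (valSq_nonneg _)
  have hdiff : ∫ x, (Ψ (valSq (jet u x)) * valSq (jet u x) - Ψ (valSq (jet u x)) * ‖u x‖) = 0 := by
    refine le_antisymm ?_ (integral_nonneg fun x => sub_nonneg.2 (hle x))
    rw [integral_sub iΨ iN]
    rw [e3, e1] at key
    have h3 := mul_le_mul_of_nonneg_left e2 hl.le
    have h4 := mul_le_mul_of_nonneg_right hw I0
    refine nonpos_of_mul_nonpos_right (a := l) ?_ hl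
    linarith
  have hae := (integral_eq_zero_iff_of_nonneg (fun x => sub_nonneg.2 (hle x)) (iΨ.sub iN)).1 hdiff
  filter_upwards [hae] with x hx
  by_contra! hlt
  have h5 : 1 < valSq (jet u x) := by rw [valSq_jet]; nlinarith
  have h6 : Ψ (valSq (jet u x)) * (‖u x‖ ^ 2 - ‖u x‖) = 0 := by
    rw [mul_sub, ← valSq_jet]
    exact hx
  have h7 : 0 < ‖u x‖ ^ 2 - ‖u x‖ := by nlinarith
  exact (mul_pos (hΨ.pos _ h5) h7).ne' h6

/-- Invariance of the unit ball of `L^∞` gives contractivity, by scaling. -/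
theorem isLinftyContractive_of_mapsTo {w : ℝ} {S : ℝ≥0 → L2 d m →L[ℂ] L2 d m}
    (hS : ∀ t : ℝ≥0, ∀ f ∈ unitBallLinfty d m,
      (Real.exp (-w * t) : ℂ) • S t f ∈ unitBallLinfty d m) : IsLinftyContractive w S := by
  intro t f hf
  refine ENNReal.le_of_forall_pos_le_add fun ε hε _ => ?_
  -- scaling `f` by its norm plus `ε` also covers the case `f = 0`
  set r : ℝ := (eLpNorm f ∞ volume).toReal + ε
  have hr : 0 < r := by positivity
  have hfr : ∀ᵐ x, ‖f x‖ ≤ r := by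
    filter_upwards [ae_le_eLpNormEssSup (f := f) (μ := volume)] with x hx
    rw [← eLpNorm_exponent_top] at hx
    have := ENNReal.toReal_mono hf.2.ne hx
    rw [toReal_enorm] at this
    exact this.trans (le_add_of_nonneg_right ε.coe_nonneg)
  have hmem : ((r⁻¹ : ℝ) : ℂ) • f ∈ unitBallLinfty d m := by
    filter_upwards [hfr, Lp.coeFn_smul ((r⁻¹ : ℝ) : ℂ) f] with x h1 h2
    rw [h2, Pi.smul_apply, norm_smul, Complex.norm_real, Real.norm_of_nonneg (by positivity),
      inv_mul_le_iff₀ hr, mul_one]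
    exact h1
  have h1 := hS t _ hmem
  rw [map_smul, smul_comm] at h1
  have h2 : ∀ᵐ x, ‖((Real.exp (-w * t) : ℂ) • S t f : L2 d m) x‖ ≤ r := by
    filter_upwards [h1, Lp.coeFn_smul ((r⁻¹ : ℝ) : ℂ) ((Real.exp (-w * t) : ℂ) • S t f)]
      with x h3 h4
    rwa [h4, Pi.smul_apply, norm_smul, Complex.norm_real, Real.norm_of_nonneg (by positivity),
      inv_mul_le_iff₀ hr, mul_one] at h3
  rw [eLpNorm_exponent_top]
  refine (eLpNormEssSup_le_of_ae_bound h2).trans (le_of_eq ?_)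
  rw [ENNReal.ofReal_add ENNReal.toReal_nonneg ε.coe_nonneg, ENNReal.ofReal_toReal hf.2.ne,
    ENNReal.ofReal_coe_nnreal]

end UnitBall

end EllipticSystem

theorem mainTheorem7 {d m : ℕ} (hd : 1 ≤ d) (hm : 1 ≤ m) (a : EllipticSystem.Coeffs d m)
    (h₁ : EllipticSystem.HypH1 a) (h₂ : EllipticSystem.HypH2 a) :
    (∃! S : ℝ≥0 → EllipticSystem.L2 d m →L[ℂ] EllipticSystem.L2 d m,
      EllipticSystem.IsSemigroupS2 a S) ∧
    ∃ w : ℝ, ∀ S : ℝ≥0 → EllipticSystem.L2 d m →L[ℂ] EllipticSystem.L2 d m,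
      EllipticSystem.IsSemigroupS2 a S → EllipticSystem.IsLinftyContractive w S := by
  open EllipticSystem in
  obtain ⟨α, w₁, hα, -, hw₁⟩ := exists_form_re_ge h₁
  obtain ⟨w₂, hw₂⟩ := exists_mem_unitBallLinfty h₁ h₂
  set w := max w₁ w₂
  have hw : ∀ f : FormSpace h₁, α * ‖f‖ ^ 2 ≤ (form a f.val f.val).re + w * ‖f.val‖ ^ 2 :=
    fun f => (hw₁ f).trans (by gcongr; exact le_max_left _ _)
  obtain ⟨hex, hinv⟩ := existsUnique_semigroup (G := realizationGraph h₁) (w := w)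
    (dense_realizationGraph hα hw) (realizationGraph_re_le hα hw) fun l hl y =>
      exists_realizationGraph_eq hα hw (show w ≤ l + w by linarith) y
  exact ⟨hex, w, fun S hS => isLinftyContractive_of_mapsTo
    (hinv S hS _ (fun f hf g hg s t hs ht hst =>
      smul_add_smul_mem_unitBallLinfty hf hg hs ht hst) isClosed_unitBallLinfty
      zero_mem_unitBallLinfty (hw₂ w (le_max_right _ _)))⟩
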